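/- Let $E=(E^0,E^1,r,s)$ be a directed graph with countable vertex set $E^0$ and countable edge set $E^1$, where $s(e)$ and $r(e)$ denote the source and the range of an edge $e$, and let $R$ be a field. Let $L_R(E)$ be the Leavitt path algebra of $E$, i.e. the universal (not necessarily unital) $R$-algebra generated by pairwise orthogonal idempotents $v$ ($v\in E^0$) and elements $e,e^*$ ($e\in E^1$) subject to $s(e)e=er(e)=e$, $r(e)e^*=e^*s(e)=e^*$, $e^*f=\delta_{e,f}r(e)$, and $v=\sum_{s(e)=v}ee^*$ whenever $0<|s^{-1}(v)|<\infty$. It is $\mathbb Z$-graded, with degree $k$ component $L_R(E)_k$ spanned by the elements $\alpha\beta^*$ with $\alpha,\beta$ finite paths (vertices being the paths of length $0$) and $|\alpha|-|\beta|=k$. A two-sided ideal $I$ is graded if $I=\bigoplus_{k}(I\cap L_R(E)_k)$, and it is left (right) primitive if the ring $L_R(E)/I$ has a faithful simple left (right) module. Write $v\ge w$ if there is a path from $v$ to $w$. A nonempty set $M\subseteq E^0$ is a maximal tail if: (MT1) $v\ge w\in M$ implies $v\in M$; (MT2) for every $v\in M$ with $0<|s^{-1}(v)|<\infty$ there is an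 edge $e$ with $s(e)=v$ and $r(e)\in M$; (MT3) for all $v,w\in M$ there is $y\in M$ with $v\ge y$ and $w\ge y$. Let $M_\gamma(E)$ be the set of maximal tails $M$ such that the graph $(M,r^{-1}(M),r,s)$ satisfies Condition (L): for every closed simple path $e_1\cdots e_n$ (that is, $n\ge1$, $r(e_n)=s(e_1)$ and $s(e_i)\ne s(e_1)$ for $i>1$) there are an $i$ and an edge $f\ne e_i$ of this graph with $s(f)=s(e_i)$. For $\emptyset\neq X\subseteq E^0$ let $\Omega(X)=\{w\in E^0\setminus X: w\not\ge v\text{ for all }v\in X\}$ and $\Omega(v)=\Omega(\{v\})$. For a hereditary and saturated set $H\subseteq E^0$ (that is, $s(e)\in H$ implies $r(e)\in H$, and every $v$ with $0<|s^{-1}(v)|<\infty$ and $r(s^{-1}(v))\subseteq H$ lies in $H$), let $$B_H=\{v\in E^0\setminus H: |s^{-1}(v)|=\infty,\ 0<|s^{-1}(v)\cap r^{-1}(E^0\setminus H)|<\infty\},$$ and for $S\subseteq B_H$ let $I(H,S)$ be the two-sided ideal of $L_R(E)$ generated by $\{v:v\in H\}\cup\{v^H:v\in S\}$, where $v^H=v-\sum_{s(e)=v,\,r(e)\notin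 H}ee^*$. The sets $\Omega(M)$ for maximal tails $M$, and $\Omega(v)$ for $v$ with $|s^{-1}(v)|=\infty$, are hereditary and saturated. Let $BV(E)$ be the set of breaking vertices, i.e. of vertices $v$ with $|s^{-1}(v)|=\infty$ and $v\in B_{\Omega(v)}$. Then $$\{I(\Omega(M),B_{\Omega(M)}): M\in M_\gamma(E)\}\ \cup\ \{I(\Omega(v),B_{\Omega(v)}\setminus\{v\}): v\in BV(E)\}$$ is the set of left primitive graded ideals of $L_R(E)$, and it is also the set of right primitive graded ideals of $L_R(E)$. -/

import Mathlib

namespace LPA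

universe u v w

/-! ### Directed graphs -/

/-- A directed graph with vertex set `V`, edge set `A`, source map `s` and range map `r`.
(Countability of `V` and `A` is assumed where it is needed.) -/
structure DirectedGraph (V : Type u) (A : Type v) where
  /-- the source of an edge -/
  s : A → V
  /-- the range of an edge -/
  r : A → V

namespace DirectedGraph

variable {V : Type u} {A : Type v} (E : DirectedGraph V A)

/-- The set of edges emitted by `v`. -/
def out (v : V) : Set A := {e | E.s e = v}

/-- `E.IsPath v l w`: the list of edges `l` is a finite path with source `v` and range `w`;
the empty list is the path of length zero at `v = w`. -/
def IsPath : V → List A → V → Prop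
  | v, [], w => v = w
  | v, e :: l, w => E.s e = v ∧ IsPath (E.r e) l w

/-- `v ≥ w`: there is a path (possibly of length zero) from `v` to `w`. -/
def Reaches (v w : V) : Prop := ∃ l, E.IsPath v l w

/-- A closed simple path: a path `e :: l` of positive length which ends at its source `s(e)` and
does not pass through `s(e)` in between. -/
def IsClosedSimplePath (e : A) (l : List A) : Prop :=
  E.IsPath (E.s e) (e :: l) (E.s e) ∧ ∀ f ∈ l, E.s f ≠ E.s e

/-- A path has an exit if some edge `e` on it shares its source with an edge `f ≠ e`. -/
def HasExit (l : List A) : Prop := ∃ e ∈ l, ∃ f, E.s f = E.s e ∧ f ≠ e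

/-- Condition (L): every closed simple path has an exit. -/
def ConditionL : Prop := ∀ e l, E.IsClosedSimplePath e l → E.HasExit (e :: l)

/-- `B_H`: the vertices outside `H` that emit infinitely many edges, of which only finitely many,
but at least one, have range outside `H`. -/
def breakingSet (H : Set V) : Set V :=
  {v | v ∉ H ∧ (E.out v).Infinite ∧
    {e | E.s e = v ∧ E.r e ∉ H}.Nonempty ∧ {e | E.s e = v ∧ E.r e ∉ H}.Finite}

/-- `Ω(X)`: the vertices outside `X` from which no vertex of `X` can be reached. -/
def omega (X : Set V) : Set V := {w | w ∉ X ∧ ∀ v ∈ X, ¬ E.Reaches w v}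

/-- `BV(E)`: the infinite emitters `v` with `v ∈ B_{Ω(v)}`. -/
def breakingVertices : Set V :=
  {v | (E.out v).Infinite ∧ v ∈ E.breakingSet (E.omega {v})}

/-- Maximal tails. -/
structure IsMaximalTail (M : Set V) : Prop where
  nonempty : M.Nonempty
  mt1 : ∀ v w, w ∈ M → E.Reaches v w → v ∈ M
  mt2 : ∀ v ∈ M, (E.out v).Nonempty → (E.out v).Finite → ∃ e, E.s e = v ∧ E.r e ∈ M
  mt3 : ∀ v ∈ M, ∀ w ∈ M, ∃ y ∈ M, E.Reaches v y ∧ E.Reaches w y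

/-- The subgraph `(M, r⁻¹(M), r, s)` of a set `M` with property (MT1); by that property the source
of an edge with range in `M` lies in `M`. -/
def tailSubgraph (M : Set V) (h : ∀ v w, w ∈ M → E.Reaches v w → v ∈ M) :
    DirectedGraph M {e : A // E.r e ∈ M} where
  s e := ⟨E.s e.1, h _ _ e.2 ⟨[e.1], rfl, rfl⟩⟩
  r e := ⟨E.r e.1, e.2⟩

/-- `M_γ(E)`: the maximal tails whose subgraph satisfies Condition (L). -/
def maximalTailsL : Set (Set V) :=
  {M | ∃ h : E.IsMaximalTail M, (E.tailSubgraph M h.mt1).ConditionL}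

end DirectedGraph

/-! ### Leavitt path algebras -/

/-- A Leavitt `E`-family in a (not necessarily unital) ring `B`:
`p v`, `x e`, `y e` play the roles of `v`, `e`, `e^*`. -/
structure IsLeavittFamily {V : Type u} {A : Type v} (E : DirectedGraph V A)
    {B : Type w} [NonUnitalRing B] (p : V → B) (x y : A → B) : Prop where
  idem : ∀ v, p v * p v = p v
  orth : ∀ v w, v ≠ w → p v * p w = 0
  source_mul : ∀ e, p (E.s e) * x e = x e
  mul_range : ∀ e, x e * p (E.r e) = x e
  range_mul : ∀ e, p (E.r e) * y e = y e
  mul_source : ∀ e, y e * p (E.s e) = y e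
  star_mul_self : ∀ e, y e * x e = p (E.r e)
  star_mul_ne : ∀ e f, e ≠ f → y e * x f = 0
  sum_eq : ∀ v (h : (E.out v).Finite), (E.out v).Nonempty →
    p v = ∑ e ∈ h.toFinset, x e * y e

/-- The symbols generating the Leavitt path algebra: vertices, real edges and ghost edges. -/
inductive Gen (V : Type u) (A : Type v) : Type (max u v)
  | vert : V → Gen V A
  | edge : A → Gen V A
  | ghost : A → Gen V A

/-- The free (associative, non-unital) `R`-algebra on the generating symbols. -/
abbrev FreeAlg (R : Type w) [CommRing R] (V : Type u) (A : Type v) : Type (max u v w) :=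
  MonoidAlgebra R (FreeSemigroup (Gen V A))

/-- A generating symbol as an element of the free algebra. -/
noncomputable def gen (R : Type w) [CommRing R] {V : Type u} {A : Type v} (g : Gen V A) :
    FreeAlg R V A :=
  MonoidAlgebra.single (FreeSemigroup.of g) 1

/-- The defining relations of a Leavitt family and their scalar multiples. -/
inductive Rel (R : Type w) [CommRing R] {V : Type u} {A : Type v} (E : DirectedGraph V A) :
    FreeAlg R V A → FreeAlg R V A → Prop
  | idem (v : V) : Rel R E (gen R (.vert v) * gen R (.vert v)) (gen R (.vert v))
  | orth (v w : V) : v ≠ w → Rel R E (gen R (.vert v) * gen R (.vert w)) 0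
  | source_mul (e : A) : Rel R E (gen R (.vert (E.s e)) * gen R (.edge e)) (gen R (.edge e))
  | mul_range (e : A) : Rel R E (gen R (.edge e) * gen R (.vert (E.r e))) (gen R (.edge e))
  | range_mul (e : A) : Rel R E (gen R (.vert (E.r e)) * gen R (.ghost e)) (gen R (.ghost e))
  | mul_source (e : A) : Rel R E (gen R (.ghost e) * gen R (.vert (E.s e))) (gen R (.ghost e))
  | star_mul_self (e : A) : Rel R E (gen R (.ghost e) * gen R (.edge e)) (gen R (.vert (E.r e)))
  | star_mul_ne (e f : A) : e ≠ f → Rel R E (gen R (.ghost e) * gen R (.edge f)) 0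
  | sum_eq (v : V) (h : (E.out v).Finite) : (E.out v).Nonempty →
      Rel R E (gen R (.vert v)) (∑ e ∈ h.toFinset, gen R (.edge e) * gen R (.ghost e))
  | smul (t : R) (a b : FreeAlg R V A) : Rel R E a b → Rel R E (t • a) (t • b)

section Algebra

variable (R : Type w) [CommRing R] {V : Type u} {A : Type v} (E : DirectedGraph V A)

/-- The congruence on the free algebra generated by the Leavitt relations. -/
noncomputable def con : RingCon (FreeAlg R V A) := ringConGen (Rel R E)

theorem con_smul (t : R) {a b : FreeAlg R V A} (h : con R E a b) :
    con R E (t • a) (t • b) := by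
  have h' : RingConGen.Rel (Rel R E) a b := h
  clear h
  induction h' with
  | of _ _ h => exact RingConGen.Rel.of _ _ (Rel.smul t _ _ h)
  | refl x => exact (con R E).refl _
  | symm _ ih => exact (con R E).symm ih
  | trans _ _ ih₁ ih₂ => exact (con R E).trans ih₁ ih₂
  | add _ _ ih₁ ih₂ => rw [smul_add, smul_add]; exact (con R E).add ih₁ ih₂
  | mul _ h₂ ih₁ _ =>
    rw [← smul_mul_assoc, ← smul_mul_assoc]; exact (con R E).mul ih₁ h₂

/-- The Leavitt path algebra `L_R(E)`: the universal (associative, in general non-unital)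
`R`-algebra generated by a Leavitt `E`-family. -/
def LeavittAlgebra : Type (max u v w) := (con R E).Quotient

noncomputable instance : NonUnitalRing (LeavittAlgebra R E) :=
  inferInstanceAs (NonUnitalRing (con R E).Quotient)

/-- The quotient map from the free algebra. -/
noncomputable def LeavittAlgebra.mk (a : FreeAlg R V A) : LeavittAlgebra R E := (a : (con R E).Quotient)

theorem LeavittAlgebra.mk_surjective : Function.Surjective (LeavittAlgebra.mk R E) :=
  Quotient.mk''_surjective

noncomputable instance : SMul R (LeavittAlgebra R E) where
  smul t := Quotient.map' (t • ·) (fun _ _ h => con_smul R E t h)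

noncomputable instance : Module R (LeavittAlgebra R E) :=
  Function.Surjective.module R
    (⟨⟨LeavittAlgebra.mk R E, rfl⟩, fun _ _ => rfl⟩ : FreeAlg R V A →+ LeavittAlgebra R E)
    (LeavittAlgebra.mk_surjective R E) (fun _ _ => rfl)

instance : IsScalarTower R (LeavittAlgebra R E) (LeavittAlgebra R E) where
  smul_assoc t a b := by
    obtain ⟨a, rfl⟩ := LeavittAlgebra.mk_surjective R E a
    obtain ⟨b, rfl⟩ := LeavittAlgebra.mk_surjective R E b
    exact congrArg (LeavittAlgebra.mk R E) (smul_mul_assoc t a b)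

instance : SMulCommClass R (LeavittAlgebra R E) (LeavittAlgebra R E) where
  smul_comm t a b := by
    obtain ⟨a, rfl⟩ := LeavittAlgebra.mk_surjective R E a
    obtain ⟨b, rfl⟩ := LeavittAlgebra.mk_surjective R E b
    exact congrArg (LeavittAlgebra.mk R E) (mul_smul_comm t a b).symm

/-- The vertex `v` as an element of `L_R(E)`. -/
noncomputable def vert (v : V) : LeavittAlgebra R E := LeavittAlgebra.mk R E (gen R (.vert v))

/-- The real edge `e` as an element of `L_R(E)`. -/
noncomputable def edge (e : A) : LeavittAlgebra R E := LeavittAlgebra.mk R E (gen R (.edge e))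

/-- The ghost edge `e^*` as an element of `L_R(E)`. -/
noncomputable def ghost (e : A) : LeavittAlgebra R E := LeavittAlgebra.mk R E (gen R (.ghost e))

/-- The quotient map as a homomorphism of non-unital algebras. -/
noncomputable def LeavittAlgebra.mkHom : FreeAlg R V A →ₙₐ[R] LeavittAlgebra R E where
  toFun := LeavittAlgebra.mk R E
  map_smul' _ _ := rfl
  map_zero' := rfl
  map_add' _ _ := rfl
  map_mul' _ _ := rfl

theorem LeavittAlgebra.mk_eq {a b : FreeAlg R V A} (h : Rel R E a b) :
    LeavittAlgebra.mkHom R E a = LeavittAlgebra.mkHom R E b :=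
  Quotient.sound (s := (con R E).toSetoid) (RingConGen.Rel.of _ _ h)

/-- The generators of `L_R(E)` form a Leavitt `E`-family. -/
theorem isLeavittFamily : IsLeavittFamily E (vert R E) (edge R E) (ghost R E) where
  idem v := LeavittAlgebra.mk_eq R E (.idem v)
  orth v w h := LeavittAlgebra.mk_eq R E (.orth v w h)
  source_mul e := LeavittAlgebra.mk_eq R E (.source_mul e)
  mul_range e := LeavittAlgebra.mk_eq R E (.mul_range e)
  range_mul e := LeavittAlgebra.mk_eq R E (.range_mul e)
  mul_source e := LeavittAlgebra.mk_eq R E (.mul_source e)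
  star_mul_self e := LeavittAlgebra.mk_eq R E (.star_mul_self e)
  star_mul_ne e f h := LeavittAlgebra.mk_eq R E (.star_mul_ne e f h)
  sum_eq v h h' := by
    have := LeavittAlgebra.mk_eq R E (.sum_eq v h h')
    rw [map_sum] at this
    exact this

/-- The universal property of `L_R(E)`. -/
theorem existsUnique_lift {B : Type*} [NonUnitalRing B] [Module R B] [IsScalarTower R B B]
    [SMulCommClass R B B] {p : V → B} {x y : A → B} (hB : IsLeavittFamily E p x y) :
    ∃! φ : LeavittAlgebra R E →ₙₐ[R] B,
      (∀ v, φ (vert R E v) = p v) ∧ (∀ e, φ (edge R E e) = x e) ∧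
        ∀ e, φ (ghost R E e) = y e := by
  let g : Gen V A → B := fun a => match a with
    | .vert v => p v
    | .edge e => x e
    | .ghost e => y e
  let F : FreeAlg R V A →ₙₐ[R] B := MonoidAlgebra.liftMagma R (FreeSemigroup.lift g)
  have hF : ∀ a, F (gen R a) = g a := fun a => by
    simp [F, gen, MonoidAlgebra.liftMagma]
  have hrel : ∀ a b, Rel R E a b → F a = F b := by
    intro a b h
    induction h with
    | idem v => simpa only [map_mul, hF] using hB.idem v
    | orth v w h => simpa only [map_mul, map_zero, hF] using hB.orth v w h
    | source_mul e => simpa only [map_mul, hF] using hB.source_mul e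
    | mul_range e => simpa only [map_mul, hF] using hB.mul_range e
    | range_mul e => simpa only [map_mul, hF] using hB.range_mul e
    | mul_source e => simpa only [map_mul, hF] using hB.mul_source e
    | star_mul_self e => simpa only [map_mul, hF] using hB.star_mul_self e
    | star_mul_ne e f h => simpa only [map_mul, map_zero, hF] using hB.star_mul_ne e f h
    | sum_eq v h h' => simpa only [map_sum, map_mul, hF] using hB.sum_eq v h h'
    | smul t a b _ ih => rw [map_smul, map_smul, ih]
  have hcon : ∀ a b, con R E a b → F a = F b := by
    intro a b h
    have h' : RingConGen.Rel (Rel R E) a b := h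
    clear h
    induction h' with
    | of _ _ h => exact hrel _ _ h
    | refl _ => rfl
    | symm _ ih => exact ih.symm
    | trans _ _ ih₁ ih₂ => exact ih₁.trans ih₂
    | add _ _ ih₁ ih₂ => rw [map_add, map_add, ih₁, ih₂]
    | mul _ _ ih₁ ih₂ => rw [map_mul, map_mul, ih₁, ih₂]
  let φ : LeavittAlgebra R E →ₙₐ[R] B :=
    { toFun := fun a => Quotient.liftOn' a F hcon
      map_smul' := fun t a => by
        obtain ⟨a, rfl⟩ := LeavittAlgebra.mk_surjective R E a
        exact map_smul F t a
      map_zero' := map_zero F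
      map_add' := fun a b => by
        obtain ⟨a, rfl⟩ := LeavittAlgebra.mk_surjective R E a
        obtain ⟨b, rfl⟩ := LeavittAlgebra.mk_surjective R E b
        exact map_add F a b
      map_mul' := fun a b => by
        obtain ⟨a, rfl⟩ := LeavittAlgebra.mk_surjective R E a
        obtain ⟨b, rfl⟩ := LeavittAlgebra.mk_surjective R E b
        exact map_mul F a b }
  refine ⟨φ, ⟨fun v => hF (.vert v), fun e => hF (.edge e), fun e => hF (.ghost e)⟩, ?_⟩
  rintro ψ ⟨h₁, h₂, h₃⟩
  have key : ψ.comp (LeavittAlgebra.mkHom R E) = F := by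
    apply (MonoidAlgebra.liftMagma R).symm.injective
    apply FreeSemigroup.hom_ext
    funext a
    have : ψ (LeavittAlgebra.mk R E (gen R a)) = F (gen R a) := by
      rw [hF]
      cases a with
      | vert v => exact h₁ v
      | edge e => exact h₂ e
      | ghost e => exact h₃ e
    exact this
  ext a
  obtain ⟨a, rfl⟩ := LeavittAlgebra.mk_surjective R E a
  exact DFunLike.congr_fun key a

/-- The element `α = v e₁ ⋯ e_n` of `L_R(E)` attached to a path `α` with source `v`. -/
noncomputable def pathElt (v : V) (l : List A) : LeavittAlgebra R E :=
  l.foldl (fun a e => a * edge R E e) (vert R E v)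

/-- The element `α^* = e_n^* ⋯ e₁^* v` of `L_R(E)` attached to a path `α` with source `v`. -/
noncomputable def ghostElt (v : V) (l : List A) : LeavittAlgebra R E :=
  l.foldl (fun a e => ghost R E e * a) (vert R E v)

/-- The homogeneous component of degree `k` of `L_R(E)`: the span of the elements `α β^*` with
`|α| - |β| = k`. -/
noncomputable def component (k : ℤ) : Submodule R (LeavittAlgebra R E) :=
  Submodule.span R {a | ∃ v l v' w m w', E.IsPath v l v' ∧ E.IsPath w m w' ∧
    (l.length : ℤ) - m.length = k ∧ a = pathElt R E v l * ghostElt R E w m}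

/-- The degree `k` part `I ∩ L_R(E)_k` of a two-sided ideal `I`. -/
noncomputable def idealComponent (I : TwoSidedIdeal (LeavittAlgebra R E)) (k : ℤ) :
    AddSubgroup (LeavittAlgebra R E) :=
  AddSubgroup.ofClass I ⊓ (component R E k).toAddSubgroup

/-- `I` is a graded ideal: it is the (internal) direct sum of the subgroups `I ∩ L_R(E)_k`. -/
def IsGradedIdeal (I : TwoSidedIdeal (LeavittAlgebra R E)) : Prop :=
  iSupIndep (idealComponent R E I) ∧ ⨆ k, idealComponent R E I k = AddSubgroup.ofClass I

/-- The element `v^H = v - ∑ e e^*`, the sum being over the edges `e` with `s(e) = v` and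
`r(e) ∉ H`; it is used for `v ∈ B_H` only, where the sum is finite. -/
noncomputable def gap (H : Set V) (v : V) : LeavittAlgebra R E :=
  vert R E v - ∑ᶠ e ∈ {e | E.s e = v ∧ E.r e ∉ H}, edge R E e * ghost R E e

/-- `I(H, S)`: the two-sided ideal generated by the vertices in `H` and the elements `v^H` for
`v ∈ S`, where `S ⊆ B_H`. -/
noncomputable def pairIdeal (H S : Set V) : TwoSidedIdeal (LeavittAlgebra R E) :=
  TwoSidedIdeal.span (vert R E '' H ∪ gap R E H '' S)

end Algebra

/-! ### Primitive rings and primitive ideals -/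

/-- An action of a (not necessarily unital) ring `B` on an abelian group `N` makes `N` a simple
left `B`-module: `B N ≠ 0` and the only submodules of `N` are `0` and `N`. -/
def IsSimpleAction {B : Type u} [NonUnitalRing B] {N : Type v} [AddCommGroup N]
    (ρ : B →ₙ+* AddMonoid.End N) : Prop :=
  (∃ b n, ρ b n ≠ 0) ∧
    ∀ N' : AddSubgroup N, (∀ b, ∀ n ∈ N', ρ b n ∈ N') → N' = ⊥ ∨ N' = ⊤

/-- A (not necessarily unital) ring is left primitive if it has a faithful simple left module.
(A simple module is cyclic, so modules in the universe of the ring suffice.) -/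
def IsLeftPrimitiveRing (B : Type u) [NonUnitalRing B] : Prop :=
  ∃ (N : Type u) (_ : AddCommGroup N) (ρ : B →ₙ+* AddMonoid.End N),
    Function.Injective ρ ∧ IsSimpleAction ρ

/-- A ring is right primitive if it has a faithful simple right module, that is, if its opposite
ring is left primitive. -/
def IsRightPrimitiveRing (B : Type u) [NonUnitalRing B] : Prop := IsLeftPrimitiveRing Bᵐᵒᵖ

/-- A two-sided ideal `I` is left primitive if the quotient ring by `I` is left primitive. -/
def IsLeftPrimitiveIdeal {B : Type u} [NonUnitalRing B] (I : TwoSidedIdeal B) : Prop :=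
  IsLeftPrimitiveRing I.ringCon.Quotient

/-- A two-sided ideal `I` is right primitive if the quotient ring by `I` is right primitive. -/
def IsRightPrimitiveIdeal {B : Type u} [NonUnitalRing B] (I : TwoSidedIdeal B) : Prop :=
  IsRightPrimitiveRing I.ringCon.Quotient

/-- The ideals `I(Ω(M), B_{Ω(M)})` for `M ∈ M_γ(E)` together with the ideals
`I(Ω(v), B_{Ω(v)} \ {v})` for `v ∈ BV(E)`. -/
def listedIdeals (R : Type w) [CommRing R] {V : Type u} {A : Type v} (E : DirectedGraph V A) :
    Set (TwoSidedIdeal (LeavittAlgebra R E)) :=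
  {I | (∃ M ∈ E.maximalTailsL, I = pairIdeal R E (E.omega M) (E.breakingSet (E.omega M))) ∨
    ∃ v ∈ E.breakingVertices,
      I = pairIdeal R E (E.omega {v}) (E.breakingSet (E.omega {v}) \ {v})}

end LPA

set_option linter.unusedSectionVars false

namespace LPA

universe u v w

/-! ### Paths and reachability -/

namespace DirectedGraph

variable {V : Type u} {A : Type v} (E : DirectedGraph V A)

/-! The argument rests on a reduction theorem for the quotients of L = L_R(E) by ideals I(H,S). A
nonzero element of such a quotient can be multiplied on both sides so as to become a nonzero
multiple of the image of some v^H, or k·v plus a combination of closed paths of positive length at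
v, with k ≠ 0 (`exists_reduction`). If closed paths outside H have exits outside H, the closed paths
can be conjugated away (`exists_reduction_closedSum`). In a graded ideal they disappear on taking
the degree zero part. Hence an ideal properly containing I(H,S) contains a new vertex or a new v^H,
provided it is graded or exits exist. In particular every graded ideal is some I(H,S)
(`IsGradedIdeal.eq_pairIdeal`). Conversely, a representation on a free module with basis V × ℕ shows
that I(H,S) contains no vertices and no elements v^H, v ∈ B_H, beyond the prescribed ones
(`notMem_pairIdeal`).

The listed ideals are primitive by a criterion (`isLeftPrimitiveIdeal_of_idempotents`): it suffices
to have decreasing idempotents outside J such that every larger ideal contains one of them. For a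
breaking vertex v the constant sequence v^H works. For a maximal tail one takes α_n α_n^*, where the
α_n are growing initial segments of a path in the tail that every vertex of the tail eventually
reaches. Countability of the vertex set is needed for this path.

Conversely, let I = I(H,S) be graded and primitive, hence prime. Modulo I an element v^H is
annihilated by all ghost edges on its left and all edges on its right. So primeness allows at most
one v ∈ B_H with v^H ∉ I, and if there is one, every vertex outside H reaches it, so H = Ω(v). If
there is none, then S = B_H and primeness makes the complement of H a maximal tail. Condition (L)
holds there: a cycle c at v without exits would make the corner v(L/I)v commutative, so primitivity
would invert v − c. As in a Laurent polynomial ring, the grading forbids this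
(`IsGradedIdeal.no_inverse`).

The involution exchanging e and e^* turns right primitive ideals into left primitive ones and fixes
every listed ideal, which settles the right-handed statement. -/

theorem isPath_append {a b c : V} {l m : List A} (hl : E.IsPath a l b) (hm : E.IsPath b m c) :
    E.IsPath a (l ++ m) c := by
  induction l generalizing a with
  | nil => cases hl; exact hm
  | cons e l ih => exact ⟨hl.1, ih hl.2⟩

theorem isPath_of_append {a c : V} {l m : List A} (h : E.IsPath a (l ++ m) c) :
    ∃ b, E.IsPath a l b ∧ E.IsPath b m c := by
  induction l generalizing a with
  | nil => exact ⟨a, rfl, h⟩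
  | cons e l ih =>
    obtain ⟨b, h1, h2⟩ := ih h.2
    exact ⟨b, ⟨h.1, h1⟩, h2⟩

theorem isPath_range_unique {a b c : V} {l : List A} (h : E.IsPath a l b) (h' : E.IsPath a l c) :
    b = c := by
  induction l generalizing a with
  | nil => exact h.symm.trans h'
  | cons e l ih => exact ih h.2 h'.2

theorem isPath_singleton (e : A) : E.IsPath (E.s e) [e] (E.r e) := ⟨rfl, rfl⟩

theorem reaches_refl (a : V) : E.Reaches a a := ⟨[], rfl⟩

variable {E}

theorem Reaches.trans {a b c : V} (h : E.Reaches a b) (h' : E.Reaches b c) : E.Reaches a c := by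
  obtain ⟨l, hl⟩ := h
  obtain ⟨m, hm⟩ := h'
  exact ⟨l ++ m, E.isPath_append hl hm⟩

end DirectedGraph

/-! ### Products of paths in a Leavitt family -/

section Paths

variable {V : Type u} {A : Type v} {E : DirectedGraph V A} {B : Type*} [NonUnitalRing B]

/-- The product `v e₁ ⋯ e_n` in a family. -/
def pathOf (p : V → B) (x : A → B) (v : V) (l : List A) : B :=
  l.foldl (fun a e => a * x e) (p v)

/-- The product `e_n^* ⋯ e₁^* v` in a family. -/
def ghostOf (p : V → B) (y : A → B) (v : V) (l : List A) : B :=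
  l.foldl (fun a e => y e * a) (p v)


theorem foldl_mul_right (x : A → B) (a b : B) (l : List A) :
    l.foldl (fun a e => a * x e) (a * b) = a * l.foldl (fun a e => a * x e) b := by
  induction l generalizing b with
  | nil => rfl
  | cons e l ih => simp only [List.foldl_cons, mul_assoc, ih]

theorem foldl_mul_left (y : A → B) (a b : B) (l : List A) :
    l.foldl (fun a e => y e * a) (b * a) = l.foldl (fun a e => y e * a) b * a := by
  induction l generalizing b with
  | nil => rfl
  | cons e l ih => simp only [List.foldl_cons, ← mul_assoc, ih]

@[simp] theorem pathOf_nil (p : V → B) (x : A → B) (v : V) : pathOf p x v [] = p v := rfl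

@[simp] theorem ghostOf_nil (p : V → B) (y : A → B) (v : V) : ghostOf p y v [] = p v := rfl

namespace IsLeavittFamily

variable {p : V → B} {x y : A → B}

/-- The defining fold multiplies new edges on at the far end, whereas `IsPath` recurses on the first
edge. This is the recursion on which inductions over paths run. -/
theorem pathOf_cons (h : IsLeavittFamily E p x y) (e : A) (l : List A) :
    pathOf p x (E.s e) (e :: l) = x e * pathOf p x (E.r e) l := by
  rw [pathOf, List.foldl_cons, h.source_mul, ← h.mul_range, foldl_mul_right, pathOf, h.mul_range]

theorem ghostOf_cons (h : IsLeavittFamily E p x y) (e : A) (l : List A) :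
    ghostOf p y (E.s e) (e :: l) = ghostOf p y (E.r e) l * y e := by
  rw [ghostOf, List.foldl_cons, h.mul_source, ← h.range_mul, foldl_mul_left, ghostOf, h.range_mul]

theorem p_mul_pathOf (h : IsLeavittFamily E p x y) (a : V) (l : List A) :
    p a * pathOf p x a l = pathOf p x a l := by
  rw [pathOf, ← foldl_mul_right, h.idem]

theorem ghostOf_mul_p (h : IsLeavittFamily E p x y) (a : V) (l : List A) :
    ghostOf p y a l * p a = ghostOf p y a l := by
  rw [ghostOf, ← foldl_mul_left, h.idem]

theorem p_mul_pathOf_ne (h : IsLeavittFamily E p x y) {a b : V} (hab : a ≠ b) (l : List A) :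
    p a * pathOf p x b l = 0 := by
  rw [← h.p_mul_pathOf, ← mul_assoc, h.orth _ _ hab, zero_mul]

theorem ghostOf_mul_p_ne (h : IsLeavittFamily E p x y) {a b : V} (hab : b ≠ a) (l : List A) :
    ghostOf p y b l * p a = 0 := by
  rw [← h.ghostOf_mul_p, mul_assoc, h.orth _ _ hab, mul_zero]

theorem pathOf_mul_p (h : IsLeavittFamily E p x y) {a b : V} {l : List A} (hl : E.IsPath a l b) :
    pathOf p x a l * p b = pathOf p x a l := by
  induction l generalizing a with
  | nil => cases hl; exact h.idem _
  | cons e l ih => obtain ⟨rfl, hl⟩ := hl; rw [h.pathOf_cons, mul_assoc, ih hl]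

theorem p_mul_ghostOf (h : IsLeavittFamily E p x y) {a b : V} {l : List A} (hl : E.IsPath a l b) :
    p b * ghostOf p y a l = ghostOf p y a l := by
  induction l generalizing a with
  | nil => cases hl; exact h.idem _
  | cons e l ih => obtain ⟨rfl, hl⟩ := hl; rw [h.ghostOf_cons, ← mul_assoc, ih hl]

theorem pathOf_mul_p_ne (h : IsLeavittFamily E p x y) {a b c : V} {l : List A}
    (hl : E.IsPath a l b) (hbc : b ≠ c) : pathOf p x a l * p c = 0 := by
  rw [← h.pathOf_mul_p hl, mul_assoc, h.orth _ _ hbc, mul_zero]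

theorem pathOf_append (h : IsLeavittFamily E p x y) {a b : V} {l : List A} (hl : E.IsPath a l b)
    (m : List A) : pathOf p x a (l ++ m) = pathOf p x a l * pathOf p x b m := by
  induction l generalizing a with
  | nil => cases hl; simp [h.p_mul_pathOf]
  | cons e l ih =>
    obtain ⟨rfl, hl⟩ := hl
    rw [List.cons_append, h.pathOf_cons, h.pathOf_cons, mul_assoc, ih hl]

theorem ghostOf_append (h : IsLeavittFamily E p x y) {a b : V} {l : List A} (hl : E.IsPath a l b)
    (m : List A) : ghostOf p y a (l ++ m) = ghostOf p y b m * ghostOf p y a l := by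
  induction l generalizing a with
  | nil => cases hl; simp [h.ghostOf_mul_p]
  | cons e l ih =>
    obtain ⟨rfl, hl⟩ := hl
    rw [List.cons_append, h.ghostOf_cons, h.ghostOf_cons, ← mul_assoc, ih hl]

theorem pathOf_singleton (h : IsLeavittFamily E p x y) (e : A) : pathOf p x (E.s e) [e] = x e := by
  rw [h.pathOf_cons, pathOf_nil, h.mul_range]

theorem ghostOf_singleton (h : IsLeavittFamily E p x y) (e : A) :
    ghostOf p y (E.s e) [e] = y e := by
  rw [h.ghostOf_cons, ghostOf_nil, h.range_mul]

theorem ghostOf_mul_pathOf (h : IsLeavittFamily E p x y) {a b : V} {l : List A}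
    (hl : E.IsPath a l b) : ghostOf p y a l * pathOf p x a l = p b := by
  induction l generalizing a with
  | nil => cases hl; exact h.idem _
  | cons e l ih =>
    obtain ⟨rfl, hl⟩ := hl
    rw [h.ghostOf_cons, h.pathOf_cons, mul_assoc, ← mul_assoc (y e), h.star_mul_self,
      h.p_mul_pathOf, ih hl]

theorem ghostOf_mul_pathOf_append (h : IsLeavittFamily E p x y) {a b : V} {l : List A}
    (hl : E.IsPath a l b) (m : List A) :
    ghostOf p y a l * pathOf p x a (l ++ m) = pathOf p x b m := by
  rw [h.pathOf_append hl, ← mul_assoc, h.ghostOf_mul_pathOf hl, h.p_mul_pathOf]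

theorem y_mul_pathOf (h : IsLeavittFamily E p x y) (e : A) {a b : V} {l : List A}
    (hl : E.IsPath a l b) (hne : l ≠ []) (he : l.head? ≠ some e) :
    y e * pathOf p x a l = 0 := by
  cases l with
  | nil => exact absurd rfl hne
  | cons f l =>
    obtain ⟨rfl, hl⟩ := hl
    have : e ≠ f := fun hef => he (by simp [hef])
    rw [h.pathOf_cons, ← mul_assoc, h.star_mul_ne _ _ this, zero_mul]

/-- A ghost path times a path of at least the same length vanishes unless the former path is an
initial segment of the latter. -/
theorem ghostOf_mul_pathOf_eq_zero (h : IsLeavittFamily E p x y) {a a' b b' : V} {l l' : List A}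
    (hl : E.IsPath a l b) (hl' : E.IsPath a' l' b') (hlen : l.length ≤ l'.length)
    (hne : ¬ (a = a' ∧ l <+: l')) : ghostOf p y a l * pathOf p x a' l' = 0 := by
  induction l generalizing a a' l' with
  | nil =>
    cases hl
    exact h.p_mul_pathOf_ne (fun haa => hne ⟨haa, List.nil_prefix⟩) _
  | cons e l ih =>
    cases l' with
    | nil => simp at hlen
    | cons f l' =>
      obtain ⟨rfl, hl⟩ := hl
      obtain ⟨rfl, hl'⟩ := hl'
      rw [h.ghostOf_cons, h.pathOf_cons, mul_assoc, ← mul_assoc (y e)]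
      by_cases hef : e = f
      · subst hef
        rw [h.star_mul_self, h.p_mul_pathOf]
        refine ih hl hl' (by simpa using hlen) fun hh => hne ⟨rfl, ?_⟩
        exact (List.prefix_cons_inj e).2 hh.2
      · rw [h.star_mul_ne _ _ hef, zero_mul, mul_zero]

theorem map {C : Type*} [NonUnitalRing C] (h : IsLeavittFamily E p x y) (φ : B →ₙ+* C) :
    IsLeavittFamily E (φ ∘ p) (φ ∘ x) (φ ∘ y) where
  idem v := by simp only [Function.comp, ← map_mul, h.idem]
  orth v w hvw := by simp only [Function.comp, ← map_mul, h.orth v w hvw, map_zero]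
  source_mul e := by simp only [Function.comp, ← map_mul, h.source_mul]
  mul_range e := by simp only [Function.comp, ← map_mul, h.mul_range]
  range_mul e := by simp only [Function.comp, ← map_mul, h.range_mul]
  mul_source e := by simp only [Function.comp, ← map_mul, h.mul_source]
  star_mul_self e := by simp only [Function.comp, ← map_mul, h.star_mul_self]
  star_mul_ne e f hef := by simp only [Function.comp, ← map_mul, h.star_mul_ne e f hef, map_zero]
  sum_eq v hf hn := by simp only [Function.comp, ← map_mul, ← map_sum, ← h.sum_eq v hf hn]

end IsLeavittFamily

theorem map_pathOf {C : Type*} [NonUnitalRing C] (p : V → B) (x : A → B) (φ : B →ₙ+* C) (v : V)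
    (l : List A) : φ (pathOf p x v l) = pathOf (φ ∘ p) (φ ∘ x) v l := by
  induction l using List.reverseRecOn with
  | nil => rfl
  | append_singleton l e ih =>
    simp only [pathOf, List.foldl_append, List.foldl_cons, List.foldl_nil, map_mul] at ih ⊢
    rw [ih]; rfl

theorem map_ghostOf {C : Type*} [NonUnitalRing C] (p : V → B) (y : A → B) (φ : B →ₙ+* C) (v : V)
    (l : List A) : φ (ghostOf p y v l) = ghostOf (φ ∘ p) (φ ∘ y) v l := by
  induction l using List.reverseRecOn with
  | nil => rfl
  | append_singleton l e ih =>
    simp only [ghostOf, List.foldl_append, List.foldl_cons, List.foldl_nil, map_mul] at ih ⊢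
    rw [ih]; rfl

end Paths

/-! ### Spanning sets -/

section Span

variable (R : Type w) [CommRing R] {V : Type u} {A : Type v} (E : DirectedGraph V A) {B : Type*}
  [NonUnitalRing B] [Module R B]

/-- The span of the elements `α β^*`, where `α` and `β` are paths with the same range. -/
def pathSpan (p : V → B) (x y : A → B) : Submodule R B :=
  Submodule.span R {a | ∃ v l w m z, E.IsPath v l z ∧ E.IsPath w m z ∧
    a = pathOf p x v l * ghostOf p y w m}

variable {R E} [IsScalarTower R B B] [SMulCommClass R B B] {p : V → B} {x y : A → B}

namespace IsLeavittFamily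

theorem x_mul_mem_pathSpan (h : IsLeavittFamily E p x y) (e : A) {b : B}
    (hb : b ∈ pathSpan R E p x y) : x e * b ∈ pathSpan R E p x y := by
  induction hb using Submodule.span_induction with
  | mem b hb =>
    obtain ⟨v, l, w, m, z, hl, hm, rfl⟩ := hb
    by_cases hv : E.r e = v
    · subst hv
      rw [← mul_assoc, ← h.pathOf_cons]
      exact Submodule.subset_span ⟨E.s e, e :: l, w, m, z, ⟨rfl, hl⟩, hm, rfl⟩
    · rw [← h.p_mul_pathOf, ← h.mul_range, mul_assoc, mul_assoc, ← mul_assoc (p (E.r e)),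
        h.orth _ _ hv, zero_mul, mul_zero]
      exact zero_mem _
  | zero => rw [mul_zero]; exact zero_mem _
  | add a b _ _ ha hb => rw [mul_add]; exact add_mem ha hb
  | smul t a _ ha => rw [mul_smul_comm]; exact Submodule.smul_mem _ _ ha

theorem p_mul_mem_pathSpan (h : IsLeavittFamily E p x y) (a : V) {b : B}
    (hb : b ∈ pathSpan R E p x y) : p a * b ∈ pathSpan R E p x y := by
  induction hb using Submodule.span_induction with
  | mem b hb =>
    obtain ⟨v, l, w, m, z, hl, hm, rfl⟩ := hb
    by_cases hv : a = v
    · subst hv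
      rw [← mul_assoc, h.p_mul_pathOf]
      exact Submodule.subset_span ⟨_, _, _, _, z, hl, hm, rfl⟩
    · rw [← mul_assoc, h.p_mul_pathOf_ne hv, zero_mul]
      exact zero_mem _
  | zero => rw [mul_zero]; exact zero_mem _
  | add a b _ _ ha hb => rw [mul_add]; exact add_mem ha hb
  | smul t a _ ha => rw [mul_smul_comm]; exact Submodule.smul_mem _ _ ha

theorem y_mul_mem_pathSpan (h : IsLeavittFamily E p x y) (e : A) {b : B}
    (hb : b ∈ pathSpan R E p x y) : y e * b ∈ pathSpan R E p x y := by
  induction hb using Submodule.span_induction with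
  | mem b hb =>
    obtain ⟨v, l, w, m, z, hl, hm, rfl⟩ := hb
    cases l with
    | nil =>
      cases hl
      rw [pathOf_nil, h.p_mul_ghostOf hm]
      by_cases hv : E.s e = v
      · subst hv
        have key : y e * ghostOf p y w m = p (E.r e) * ghostOf p y w (m ++ [e]) := by
          rw [h.ghostOf_append hm, h.ghostOf_singleton, ← mul_assoc, h.range_mul]
        rw [key]
        exact Submodule.subset_span ⟨E.r e, [], w, m ++ [e], E.r e, rfl,
          E.isPath_append hm (E.isPath_singleton e), rfl⟩
      · rw [← h.p_mul_ghostOf hm, ← h.mul_source, mul_assoc, ← mul_assoc (p _), h.orth _ _ hv,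
          zero_mul, mul_zero]
        exact zero_mem _
    | cons f l =>
      obtain ⟨rfl, hl⟩ := hl
      rw [h.pathOf_cons, mul_assoc, ← mul_assoc]
      by_cases hef : e = f
      · subst hef
        rw [h.star_mul_self, ← mul_assoc, h.p_mul_pathOf]
        exact Submodule.subset_span ⟨_, _, _, _, z, hl, hm, rfl⟩
      · rw [h.star_mul_ne _ _ hef, zero_mul]
        exact zero_mem _
  | zero => rw [mul_zero]; exact zero_mem _
  | add a b _ _ ha hb => rw [mul_add]; exact add_mem ha hb
  | smul t a _ ha => rw [mul_smul_comm]; exact Submodule.smul_mem _ _ ha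

theorem pathOf_mem_pathSpan (h : IsLeavittFamily E p x y) {a b : V} {l : List A}
    (hl : E.IsPath a l b) : pathOf p x a l ∈ pathSpan R E p x y :=
  Submodule.subset_span ⟨a, l, b, [], b, hl, rfl, by rw [ghostOf_nil, h.pathOf_mul_p hl]⟩

theorem ghostOf_mem_pathSpan (h : IsLeavittFamily E p x y) {a b : V} {l : List A}
    (hl : E.IsPath a l b) : ghostOf p y a l ∈ pathSpan R E p x y :=
  Submodule.subset_span ⟨b, [], a, l, b, rfl, hl, by rw [pathOf_nil, h.p_mul_ghostOf hl]⟩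

/-- Sums of vertices are eventually right units for a given element of the span. -/
theorem exists_right_unit (h : IsLeavittFamily E p x y) {b : B} (hb : b ∈ pathSpan R E p x y) :
    ∃ F : Finset V, ∀ F', F ⊆ F' → b * ∑ v ∈ F', p v = b := by
  classical
  induction hb using Submodule.span_induction with
  | mem b hb =>
    obtain ⟨v, l, w, m, z, hl, hm, rfl⟩ := hb
    refine ⟨{w}, fun F' hF => ?_⟩
    rw [Finset.mul_sum, Finset.sum_eq_single w]
    · rw [mul_assoc, h.ghostOf_mul_p]
    · intro c _ hc
      rw [mul_assoc, h.ghostOf_mul_p_ne hc.symm, mul_zero]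
    · intro hw
      exact absurd (hF (Finset.mem_singleton_self w)) hw
  | zero => exact ⟨∅, fun _ _ => zero_mul _⟩
  | add a b _ _ ha hb =>
    obtain ⟨F, hF⟩ := ha
    obtain ⟨G, hG⟩ := hb
    refine ⟨F ∪ G, fun F' h' => ?_⟩
    rw [add_mul, hF _ (Finset.union_subset_left h'), hG _ (Finset.union_subset_right h')]
  | smul t a _ ha =>
    obtain ⟨F, hF⟩ := ha
    exact ⟨F, fun F' h' => by rw [smul_mul_assoc, hF _ h']⟩

theorem exists_mul_p_ne_zero (h : IsLeavittFamily E p x y) {b : B}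
    (hb : b ∈ pathSpan R E p x y) (hb0 : b ≠ 0) : ∃ v, b * p v ≠ 0 := by
  by_contra! hcon
  obtain ⟨F, hF⟩ := h.exists_right_unit hb
  apply hb0
  rw [← hF F subset_rfl, Finset.mul_sum, Finset.sum_eq_zero fun v _ => hcon v]

theorem exists_left_unit (h : IsLeavittFamily E p x y) {b : B} (hb : b ∈ pathSpan R E p x y) :
    ∃ F : Finset V, ∀ F', F ⊆ F' → (∑ v ∈ F', p v) * b = b := by
  classical
  induction hb using Submodule.span_induction with
  | mem b hb =>
    obtain ⟨v, l, w, m, z, hl, hm, rfl⟩ := hb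
    refine ⟨{v}, fun F' hF => ?_⟩
    rw [Finset.sum_mul, Finset.sum_eq_single v]
    · rw [← mul_assoc, h.p_mul_pathOf]
    · intro c _ hc
      rw [← mul_assoc, h.p_mul_pathOf_ne hc, zero_mul]
    · intro hw
      exact absurd (hF (Finset.mem_singleton_self v)) hw
  | zero => exact ⟨∅, fun _ _ => mul_zero _⟩
  | add a b _ _ ha hb =>
    obtain ⟨F, hF⟩ := ha
    obtain ⟨G, hG⟩ := hb
    refine ⟨F ∪ G, fun F' h' => ?_⟩
    rw [mul_add, hF _ (Finset.union_subset_left h'), hG _ (Finset.union_subset_right h')]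
  | smul t a _ ha =>
    obtain ⟨F, hF⟩ := ha
    exact ⟨F, fun F' h' => by rw [mul_smul_comm, hF _ h']⟩

end IsLeavittFamily

end Span

/-! ### The Leavitt path algebra and its quotients -/

section Quotients

variable (R : Type w) [CommRing R] {V : Type u} {A : Type v} (E : DirectedGraph V A)

/-- The span of the αβ^* contains the generators and is stable under left multiplication by them,
hence contains every word. -/
theorem mem_pathSpan (a : LeavittAlgebra R E) :
    a ∈ pathSpan R E (vert R E) (edge R E) (ghost R E) := by
  have hL := isLeavittFamily R E
  set T := pathSpan R E (vert R E) (edge R E) (ghost R E) with hT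
  have hgen : ∀ g : Gen V A, LeavittAlgebra.mkHom R E (gen R g) ∈ T ∧
      ∀ b ∈ T, LeavittAlgebra.mkHom R E (gen R g) * b ∈ T := by
    rintro (v | e | e)
    · exact ⟨hL.pathOf_mem_pathSpan (l := []) rfl, fun b hb => hL.p_mul_mem_pathSpan v hb⟩
    · refine ⟨?_, fun b hb => hL.x_mul_mem_pathSpan e hb⟩
      have := hL.pathOf_mem_pathSpan (R := R) (E.isPath_singleton e)
      rwa [hL.pathOf_singleton] at this
    · refine ⟨?_, fun b hb => hL.y_mul_mem_pathSpan e hb⟩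
      have := hL.ghostOf_mem_pathSpan (R := R) (E.isPath_singleton e)
      rwa [hL.ghostOf_singleton] at this
  have hword : ∀ s : FreeSemigroup (Gen V A),
      LeavittAlgebra.mkHom R E (MonoidAlgebra.single s 1) ∈ T := by
    intro s
    induction s using FreeSemigroup.recOnMul with
    | ih1 g => exact (hgen g).1
    | ih2 g s _ ih =>
      have : (MonoidAlgebra.single (FreeSemigroup.of g * s) 1 : FreeAlg R V A) =
          gen R g * MonoidAlgebra.single s 1 := by
        rw [gen, MonoidAlgebra.single_mul_single, one_mul]
      rw [this, map_mul]
      exact (hgen g).2 _ ih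
  obtain ⟨a, rfl⟩ := LeavittAlgebra.mk_surjective R E a
  change LeavittAlgebra.mkHom R E a ∈ T
  induction a using MonoidAlgebra.induction_linear with
  | zero => rw [map_zero]; exact zero_mem _
  | add f g hf hg => rw [map_add]; exact add_mem hf hg
  | single s t =>
    have : (MonoidAlgebra.single s t : FreeAlg R V A) = t • MonoidAlgebra.single s 1 := by
      simp
    rw [this, map_smul]
    exact Submodule.smul_mem _ _ (hword s)

variable {R E}

/-- Finite sums of vertices are local units: a = ua gives ta = (tu)a. Thus ring ideals are subspaces
and the quotients are algebras over R. -/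
theorem smul_mem_ideal (I : TwoSidedIdeal (LeavittAlgebra R E)) (t : R) {a : LeavittAlgebra R E}
    (ha : a ∈ I) : t • a ∈ I := by
  obtain ⟨F, hF⟩ := (isLeavittFamily R E).exists_left_unit (mem_pathSpan R E a)
  rw [← hF F subset_rfl, ← smul_mul_assoc]
  exact I.mul_mem_left _ _ ha

variable (I : TwoSidedIdeal (LeavittAlgebra R E))

noncomputable instance : SMul R I.ringCon.Quotient where
  smul t := Quotient.map' (t • ·) (fun a b h => by
    have h' : a - b ∈ I := (I.rel_iff a b).1 h
    refine (I.rel_iff _ _).2 ?_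
    rw [← smul_sub]
    exact smul_mem_ideal I t h')

/-- The quotient map by an ideal as a homomorphism of additive groups. -/
noncomputable def toQuotAdd : LeavittAlgebra R E →+ I.ringCon.Quotient :=
  ⟨⟨fun a => (a : I.ringCon.Quotient), rfl⟩, fun _ _ => rfl⟩

noncomputable instance : Module R I.ringCon.Quotient :=
  Function.Surjective.module R (toQuotAdd I) Quotient.mk''_surjective (fun _ _ => rfl)

instance : IsScalarTower R I.ringCon.Quotient I.ringCon.Quotient where
  smul_assoc t a b := by
    induction a using Quotient.inductionOn'
    induction b using Quotient.inductionOn'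
    exact congrArg (toQuotAdd I) (smul_mul_assoc t _ _)

instance : SMulCommClass R I.ringCon.Quotient I.ringCon.Quotient where
  smul_comm t a b := by
    induction a using Quotient.inductionOn'
    induction b using Quotient.inductionOn'
    exact congrArg (toQuotAdd I) (mul_smul_comm t _ _).symm

/-- The quotient map by an ideal. -/
noncomputable def toQuot : LeavittAlgebra R E →ₙₐ[R] I.ringCon.Quotient where
  toFun := toQuotAdd I
  map_smul' _ _ := rfl
  map_zero' := rfl
  map_add' _ _ := rfl
  map_mul' _ _ := rfl

theorem toQuot_surjective : Function.Surjective (toQuot I) := Quotient.mk''_surjective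

theorem toQuot_eq_zero {a : LeavittAlgebra R E} : toQuot I a = 0 ↔ a ∈ I :=
  Quotient.eq''.trans Iff.rfl

theorem isLeavittFamily_toQuot :
    IsLeavittFamily E (toQuot I ∘ vert R E) (toQuot I ∘ edge R E) (toQuot I ∘ ghost R E) :=
  (isLeavittFamily R E).map (toQuot I : LeavittAlgebra R E →ₙ+* I.ringCon.Quotient)

theorem mem_pathSpan_toQuot (b : I.ringCon.Quotient) :
    b ∈ pathSpan R E (toQuot I ∘ vert R E) (toQuot I ∘ edge R E) (toQuot I ∘ ghost R E) := by
  obtain ⟨a, rfl⟩ := toQuot_surjective I b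
  induction mem_pathSpan R E a using Submodule.span_induction with
  | mem b hb =>
    obtain ⟨v, l, w, m, z, hl, hm, rfl⟩ := hb
    refine Submodule.subset_span ⟨v, l, w, m, z, hl, hm, ?_⟩
    rw [map_mul]
    exact congrArg₂ (· * ·)
      (map_pathOf _ _ (toQuot I : LeavittAlgebra R E →ₙ+* I.ringCon.Quotient) _ _)
      (map_ghostOf _ _ (toQuot I : LeavittAlgebra R E →ₙ+* I.ringCon.Quotient) _ _)
  | zero => rw [map_zero]; exact zero_mem _
  | add a b _ _ ha hb => rw [map_add]; exact add_mem ha hb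
  | smul t a _ ha => rw [map_smul]; exact Submodule.smul_mem _ _ ha

end Quotients

/-! ### The grading -/

section Grading

variable (R : Type w) [CommRing R] {V : Type u} {A : Type v} (E : DirectedGraph V A)

variable {R E} in
theorem single_inr_mul_single_inr (i j : ℤ) (a b : LeavittAlgebra R E) :
    AddMonoidAlgebra.single i (a : Unitization R (LeavittAlgebra R E)) *
      AddMonoidAlgebra.single j (b : Unitization R (LeavittAlgebra R E)) =
    AddMonoidAlgebra.single (i + j) ((a * b : LeavittAlgebra R E) : Unitization R _) := by
  rw [AddMonoidAlgebra.single_mul_single, Unitization.inr_mul]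

variable {R E} in
theorem single_inr_sum (k : ℤ) (F : Finset A) (f : A → LeavittAlgebra R E) :
    AddMonoidAlgebra.single k ((∑ e ∈ F, f e : LeavittAlgebra R E) : Unitization R _) =
      ∑ e ∈ F, AddMonoidAlgebra.single k (f e : Unitization R (LeavittAlgebra R E)) :=
  map_sum ((AddMonoidAlgebra.singleAddHom (R := Unitization R (LeavittAlgebra R E)) k).comp
    (Unitization.inrHom R R (LeavittAlgebra R E)).toAddMonoidHom) f F

/-- The relations are homogeneous when vertices, edges and ghost edges get degrees 0, 1 and −1, so
the generators multiplied by these powers of a variable T satisfy them again. The unitization only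
supplies a unital coefficient ring. -/
theorem isLeavittFamily_graded :
    IsLeavittFamily E
      (fun v => AddMonoidAlgebra.single (0 : ℤ) (vert R E v : Unitization R (LeavittAlgebra R E)))
      (fun e => AddMonoidAlgebra.single (1 : ℤ) (edge R E e : Unitization R (LeavittAlgebra R E)))
      (fun e => AddMonoidAlgebra.single (-1 : ℤ)
        (ghost R E e : Unitization R (LeavittAlgebra R E))) := by
  have h := isLeavittFamily R E
  constructor
  · intro v; rw [single_inr_mul_single_inr, h.idem, add_zero]
  · intro v w hvw
    rw [single_inr_mul_single_inr, h.orth v w hvw, Unitization.inr_zero,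
      AddMonoidAlgebra.single_zero]
  · intro e; rw [single_inr_mul_single_inr, h.source_mul, zero_add]
  · intro e; rw [single_inr_mul_single_inr, h.mul_range, add_zero]
  · intro e; rw [single_inr_mul_single_inr, h.range_mul, zero_add]
  · intro e; rw [single_inr_mul_single_inr, h.mul_source, add_zero]
  · intro e; rw [single_inr_mul_single_inr, h.star_mul_self, neg_add_cancel]
  · intro e f hef
    rw [single_inr_mul_single_inr, h.star_mul_ne e f hef, Unitization.inr_zero,
      AddMonoidAlgebra.single_zero]
  · intro v hf hn
    simp only [single_inr_mul_single_inr, add_neg_cancel]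
    rw [h.sum_eq v hf hn, single_inr_sum]

/-- The homomorphism `a ↦ ∑ a_k T^k` describing the decomposition into homogeneous components. -/
noncomputable def gradHom :
    LeavittAlgebra R E →ₙₐ[R] AddMonoidAlgebra (Unitization R (LeavittAlgebra R E)) ℤ :=
  (existsUnique_lift R E (isLeavittFamily_graded R E)).choose

theorem gradHom_vert (v : V) : gradHom R E (vert R E v) =
    AddMonoidAlgebra.single (0 : ℤ) (vert R E v : Unitization R (LeavittAlgebra R E)) :=
  (existsUnique_lift R E (isLeavittFamily_graded R E)).choose_spec.1.1 v

theorem gradHom_edge (e : A) : gradHom R E (edge R E e) =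
    AddMonoidAlgebra.single (1 : ℤ) (edge R E e : Unitization R (LeavittAlgebra R E)) :=
  (existsUnique_lift R E (isLeavittFamily_graded R E)).choose_spec.1.2.1 e

theorem gradHom_ghost (e : A) : gradHom R E (ghost R E e) =
    AddMonoidAlgebra.single (-1 : ℤ) (ghost R E e : Unitization R (LeavittAlgebra R E)) :=
  (existsUnique_lift R E (isLeavittFamily_graded R E)).choose_spec.1.2.2 e

theorem gradHom_pathElt (v : V) (l : List A) : gradHom R E (pathElt R E v l) =
    AddMonoidAlgebra.single (l.length : ℤ)
      (pathElt R E v l : Unitization R (LeavittAlgebra R E)) := by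
  induction l using List.reverseRecOn with
  | nil => exact gradHom_vert R E v
  | append_singleton l e ih =>
    have : pathElt R E v (l ++ [e]) = pathElt R E v l * edge R E e := by simp [pathElt]
    rw [this, map_mul, ih, gradHom_edge, AddMonoidAlgebra.single_mul_single, ← Unitization.inr_mul]
    simp

theorem gradHom_ghostElt (v : V) (l : List A) : gradHom R E (ghostElt R E v l) =
    AddMonoidAlgebra.single (-l.length : ℤ)
      (ghostElt R E v l : Unitization R (LeavittAlgebra R E)) := by
  induction l using List.reverseRecOn with
  | nil => exact gradHom_vert R E v
  | append_singleton l e ih =>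
    have : ghostElt R E v (l ++ [e]) = ghost R E e * ghostElt R E v l := by simp [ghostElt]
    rw [this, map_mul, ih, gradHom_ghost, AddMonoidAlgebra.single_mul_single,
      ← Unitization.inr_mul]
    simp [add_comm]

/-- The projection onto the homogeneous component of degree `k`. -/
noncomputable def degPart (k : ℤ) : LeavittAlgebra R E →ₗ[R] LeavittAlgebra R E where
  toFun a := ((gradHom R E a).coeff k).snd
  map_add' a b := by simp
  map_smul' t a := by simp

variable {R E} in
theorem degPart_eq {k : ℤ} {a b : LeavittAlgebra R E}
    (h : gradHom R E a = AddMonoidAlgebra.single k (b : Unitization R (LeavittAlgebra R E)))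
    (j : ℤ) : degPart R E j a = if k = j then b else 0 := by
  change ((gradHom R E a).coeff j).snd = _
  rw [h, AddMonoidAlgebra.coeff_single, Finsupp.single_apply]
  split_ifs <;> simp

/-- `gradHom` comes from the universal property and needs no basis of L. Since it sends degree k
into the multiples of T^k, the components are independent and `degPart` is the projection onto them.
-/
theorem gradHom_of_mem (k : ℤ) {a : LeavittAlgebra R E} (ha : a ∈ component R E k) :
    gradHom R E a = AddMonoidAlgebra.single k (a : Unitization R (LeavittAlgebra R E)) := by
  induction ha using Submodule.span_induction with
  | mem a ha =>
    obtain ⟨v, l, v', w, m, w', -, -, rfl, rfl⟩ := ha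
    rw [map_mul, gradHom_pathElt, gradHom_ghostElt, AddMonoidAlgebra.single_mul_single,
      ← Unitization.inr_mul, sub_eq_add_neg]
  | zero => simp
  | add a b _ _ ha hb => rw [map_add, ha, hb, Unitization.inr_add, AddMonoidAlgebra.single_add]
  | smul t a _ ha => rw [map_smul, ha, Unitization.inr_smul, AddMonoidAlgebra.smul_single]

variable {R E}

theorem degPart_of_mem {k : ℤ} {a : LeavittAlgebra R E} (ha : a ∈ component R E k) :
    degPart R E k a = a := by
  rw [degPart_eq (gradHom_of_mem R E k ha), if_pos rfl]

theorem degPart_of_mem_ne {j k : ℤ} (hjk : j ≠ k) {a : LeavittAlgebra R E}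
    (ha : a ∈ component R E k) : degPart R E j a = 0 := by
  rw [degPart_eq (gradHom_of_mem R E k ha), if_neg hjk.symm]

theorem pathElt_mul_ghostElt_mem {v w v' w' : V} {l m : List A} (hl : E.IsPath v l v')
    (hm : E.IsPath w m w') :
    pathElt R E v l * ghostElt R E w m ∈ component R E ((l.length : ℤ) - m.length) :=
  Submodule.subset_span ⟨v, l, v', w, m, w', hl, hm, rfl, rfl⟩

theorem pathElt_mem {v v' : V} {l : List A} (hl : E.IsPath v l v') :
    pathElt R E v l ∈ component R E l.length := by
  have := pathElt_mul_ghostElt_mem (R := R) hl (m := []) (rfl : E.IsPath v' [] v')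
  have h2 : pathElt R E v l * ghostElt R E v' [] = pathElt R E v l :=
    (isLeavittFamily R E).pathOf_mul_p hl
  simpa [h2] using this

theorem vert_mem (v : V) : vert R E v ∈ component R E 0 :=
  pathElt_mem (l := []) (rfl : E.IsPath v [] v)

variable (R E)

theorem iSup_component : ⨆ k, component R E k = ⊤ := by
  refine eq_top_iff.2 fun a _ => ?_
  refine (Submodule.span_le.2 ?_ : pathSpan R E (vert R E) (edge R E) (ghost R E) ≤ _)
    (mem_pathSpan R E a)
  rintro _ ⟨v, l, w, m, z, hl, hm, rfl⟩
  exact Submodule.mem_iSup_of_mem _ (pathElt_mul_ghostElt_mem hl hm)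

variable {R E}

/-- To prove an additive statement about `L_R(E)` one may consider homogeneous elements. -/
theorem homogeneous_induction {P : LeavittAlgebra R E → Prop}
    (hom : ∀ k, ∀ a ∈ component R E k, P a) (add : ∀ a b, P a → P b → P (a + b))
    (a : LeavittAlgebra R E) : P a := by
  have ha : a ∈ ⨆ k, component R E k := by rw [iSup_component]; trivial
  exact Submodule.iSup_induction _ (motive := P) ha hom (hom 0 0 (zero_mem _)) add

theorem degPart_mem (k : ℤ) (a : LeavittAlgebra R E) : degPart R E k a ∈ component R E k := by
  induction a using homogeneous_induction with
  | hom j a ha =>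
    by_cases hjk : k = j
    · subst hjk; rwa [degPart_of_mem ha]
    · rw [degPart_of_mem_ne hjk ha]; exact zero_mem _
  | add a b ha hb => rw [map_add]; exact add_mem ha hb

theorem exists_sum_degPart (a : LeavittAlgebra R E) :
    ∃ F : Finset ℤ, ∀ F', F ⊆ F' → ∑ k ∈ F', degPart R E k a = a := by
  induction a using homogeneous_induction with
  | hom j a ha =>
    refine ⟨{j}, fun F' hF => ?_⟩
    rw [Finset.sum_eq_single j, degPart_of_mem ha]
    · exact fun k _ hk => degPart_of_mem_ne hk ha
    · exact fun hj => absurd (hF (Finset.mem_singleton_self j)) hj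
  | add a b ha hb =>
    obtain ⟨F, hF⟩ := ha
    obtain ⟨G, hG⟩ := hb
    refine ⟨F ∪ G, fun F' h' => ?_⟩
    simp_rw [map_add]
    rw [Finset.sum_add_distrib, hF _ (Finset.union_subset_left h'),
      hG _ (Finset.union_subset_right h')]

theorem degPart_eq_zero_of_notMem (a : LeavittAlgebra R E) :
    ∃ F : Finset ℤ, ∀ k ∉ F, degPart R E k a = 0 := by
  induction a using homogeneous_induction with
  | hom j a ha =>
    exact ⟨{j}, fun k hk => degPart_of_mem_ne (by simpa using hk) ha⟩
  | add a b ha hb =>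
    obtain ⟨F, hF⟩ := ha
    obtain ⟨G, hG⟩ := hb
    refine ⟨F ∪ G, fun k hk => ?_⟩
    rw [Finset.mem_union, not_or] at hk
    rw [map_add, hF _ hk.1, hG _ hk.2, add_zero]

theorem mul_mem_component {i j : ℤ} {a b : LeavittAlgebra R E} (ha : a ∈ component R E i)
    (hb : b ∈ component R E j) : a * b ∈ component R E (i + j) := by
  have : degPart R E (i + j) (a * b) = a * b := by
    rw [degPart_eq (k := i + j), if_pos rfl]
    rw [map_mul, gradHom_of_mem R E i ha, gradHom_of_mem R E j hb, single_inr_mul_single_inr]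
  exact this ▸ degPart_mem _ _

theorem degPart_mul_right {j : ℤ} (k : ℤ) (a : LeavittAlgebra R E) {b : LeavittAlgebra R E}
    (hb : b ∈ component R E j) : degPart R E k (a * b) = degPart R E (k - j) a * b := by
  induction a using homogeneous_induction with
  | hom i a ha =>
    by_cases h : k - j = i
    · rw [h, degPart_of_mem ha, degPart_of_mem]
      have : k = i + j := by omega
      exact this ▸ mul_mem_component ha hb
    · rw [degPart_of_mem_ne h ha, degPart_of_mem_ne _ (mul_mem_component ha hb), zero_mul]
      omega
  | add a b ha hb => rw [add_mul, map_add, map_add, ha, hb, add_mul]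

theorem degPart_mul_left {j : ℤ} (k : ℤ) (a : LeavittAlgebra R E) {b : LeavittAlgebra R E}
    (hb : b ∈ component R E j) : degPart R E k (b * a) = b * degPart R E (k - j) a := by
  induction a using homogeneous_induction with
  | hom i a ha =>
    by_cases h : k - j = i
    · rw [h, degPart_of_mem ha, degPart_of_mem]
      have : k = j + i := by omega
      exact this ▸ mul_mem_component hb ha
    · rw [degPart_of_mem_ne h ha, degPart_of_mem_ne _ (mul_mem_component hb ha), mul_zero]
      omega
  | add a b ha hb => rw [mul_add, map_add, map_add, ha, hb, mul_add]

/-- Independence is automatic, because `degPart` in degree k is the identity on the k-th component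
and kills the others. Only stability under the projections carries content. -/
theorem isGradedIdeal_iff (I : TwoSidedIdeal (LeavittAlgebra R E)) :
    IsGradedIdeal R E I ↔ ∀ a ∈ I, ∀ k, degPart R E k a ∈ I := by
  constructor
  · rintro ⟨-, hsup⟩ a ha k
    have ha' : a ∈ ⨆ k, idealComponent R E I k := by rw [hsup]; exact ha
    clear ha
    induction ha' using AddSubgroup.iSup_induction' with
    | hp j a hj =>
      by_cases hjk : k = j
      · subst hjk; rw [degPart_of_mem hj.2]; exact hj.1
      · rw [degPart_of_mem_ne hjk hj.2]; exact zero_mem _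
    | h1 => rw [map_zero]; exact zero_mem _
    | hadd a b _ _ ha hb => rw [map_add]; exact add_mem ha hb
  · intro h
    constructor
    · intro k
      rw [disjoint_iff_inf_le]
      rintro a ⟨ha, ha'⟩
      have h1 : degPart R E k a = a := degPart_of_mem ha.2
      have h2 : (⨆ j, ⨆ (_ : j ≠ k), idealComponent R E I j) ≤
          (degPart R E k).toAddMonoidHom.ker :=
        iSup₂_le fun j hj b hb => degPart_of_mem_ne hj.symm hb.2
      have h3 : degPart R E k a = 0 := h2 ha'
      exact h1.symm.trans h3
    · refine le_antisymm (iSup_le fun k => inf_le_left) fun a ha => ?_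
      obtain ⟨F, hF⟩ := exists_sum_degPart a
      rw [← hF F subset_rfl]
      exact sum_mem fun k _ => AddSubgroup.mem_iSup_of_mem k ⟨h a ha k, degPart_mem k a⟩

/-- An ideal generated by homogeneous elements is graded. -/
theorem isGradedIdeal_span {s : Set (LeavittAlgebra R E)}
    (hs : ∀ a ∈ s, ∃ k, a ∈ component R E k) : IsGradedIdeal R E (TwoSidedIdeal.span s) := by
  rw [isGradedIdeal_iff]
  intro a ha
  set J := TwoSidedIdeal.span s with hJ
  induction ha using TwoSidedIdeal.span_induction with
  | mem a ha =>
    intro k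
    obtain ⟨j, hj⟩ := hs a ha
    by_cases hjk : k = j
    · subst hjk; rw [degPart_of_mem hj]; exact TwoSidedIdeal.subset_span ha
    · rw [degPart_of_mem_ne hjk hj]; exact zero_mem _
  | zero => intro k; rw [map_zero]; exact zero_mem _
  | add a b _ _ ha hb => intro k; rw [map_add]; exact add_mem (ha k) (hb k)
  | neg a _ ha => intro k; rw [map_neg]; exact neg_mem (ha k)
  | left_absorb a b _ hb =>
    intro k
    -- Multiplication by a homogeneous factor merely shifts degrees, so the absorbed factor may be
    -- split into homogeneous parts.
    induction a using homogeneous_induction with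
    | hom j a ha => rw [degPart_mul_left k b ha]; exact J.mul_mem_left _ _ (hb _)
    | add a b ha hb => rw [add_mul, map_add]; exact add_mem ha hb
  | right_absorb a b _ hb =>
    intro k
    induction a using homogeneous_induction with
    | hom j a ha => rw [degPart_mul_right k b ha]; exact J.mul_mem_right _ _ (hb _)
    | add a b ha hb => rw [mul_add, map_add]; exact add_mem ha hb

theorem edge_mul_ghost_mem (e : A) : edge R E e * ghost R E e ∈ component R E 0 := by
  have := pathElt_mul_ghostElt_mem (R := R) (E.isPath_singleton e) (E.isPath_singleton e)
  have h1 : pathElt R E (E.s e) [e] = edge R E e := (isLeavittFamily R E).pathOf_singleton e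
  have h2 : ghostElt R E (E.s e) [e] = ghost R E e := (isLeavittFamily R E).ghostOf_singleton e
  simpa [h1, h2] using this

theorem gap_mem (H : Set V) (v : V) : gap R E H v ∈ component R E 0 :=
  sub_mem (vert_mem v) (finsum_mem_induction (· ∈ component R E 0) (zero_mem _)
    (fun _ _ => add_mem) fun e _ => edge_mul_ghost_mem e)

theorem isGradedIdeal_pairIdeal (H S : Set V) : IsGradedIdeal R E (pairIdeal R E H S) := by
  refine isGradedIdeal_span ?_
  rintro _ (⟨v, -, rfl⟩ | ⟨v, -, rfl⟩)
  · exact ⟨0, vert_mem v⟩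
  · exact ⟨0, gap_mem H v⟩

end Grading

/-! ### A representation with prescribed kernel on vertices -/

section Representation

variable {V : Type u} {A : Type v} (E : DirectedGraph V A)

/-- For every vertex `v` outside of `D`, the maps `code e : ℕ → ℕ`, where `e` runs through the edges
from `v` to the complement of `H`, are injective and their ranges partition `ℕ`; for `v ∈ D` their
ranges are disjoint and avoid `0`. -/
structure IsCoding (H D : Set V) (code : A → ℕ → ℕ) : Prop where
  inj : ∀ e f m n, E.s e = E.s f → E.r e ∉ H → E.r f ∉ H → code e m = code f n → e = f ∧ m = n
  surj : ∀ v ∉ D, (∃ e, E.s e = v ∧ E.r e ∉ H) →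
    ∀ k, ∃ e m, E.s e = v ∧ E.r e ∉ H ∧ code e m = k
  ne_zero : ∀ e m, E.s e ∈ D → E.r e ∉ H → code e m ≠ 0

/-- The edges from v to the complement of H, times ℕ, form a countable set. If v ∉ D and there is
such an edge, the set is infinite and so in bijection with ℕ. For v ∈ D an injection followed by the
successor leaves the value 0 free. -/
theorem exists_isCoding [Countable A] (H D : Set V) : ∃ code, IsCoding E H D code := by
  classical
  let F : V → Type v := fun v => {e : A // E.s e = v ∧ E.r e ∉ H}
  have hc : ∀ v, ∃ c : F v × ℕ → ℕ, Function.Injective c ∧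
      (v ∉ D → Nonempty (F v) → Function.Surjective c) ∧ (v ∈ D → ∀ z, c z ≠ 0) := by
    intro v
    by_cases hv : v ∈ D
    · obtain ⟨c, hc⟩ := Countable.exists_injective_nat (F v × ℕ)
      exact ⟨fun z => c z + 1, fun a b hab => hc (Nat.succ_injective hab),
        fun h => absurd hv h, fun _ z => Nat.succ_ne_zero _⟩
    · by_cases hF : Nonempty (F v)
      · obtain ⟨c⟩ := nonempty_equiv_of_countable (α := F v × ℕ) (β := ℕ)
        exact ⟨c, c.injective, fun _ _ => c.surjective, fun h => absurd h hv⟩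
      · have : IsEmpty (F v) := not_nonempty_iff.1 hF
        exact ⟨fun _ => 0, fun a => isEmptyElim a.1, fun _ h => absurd h hF, fun h => absurd h hv⟩
  choose c hinj hsurj hzero using hc
  refine ⟨fun e n => if h : E.r e ∉ H then c (E.s e) (⟨e, rfl, h⟩, n) else 0, ?_, ?_, ?_⟩
  · intro e f m n hs he hf hcode
    have key : ∀ v (h1 : E.s e = v) (h2 : E.s f = v),
        c v (⟨e, h1, he⟩, m) = c v (⟨f, h2, hf⟩, n) → e = f ∧ m = n := by
      intro v h1 h2 h3
      have h4 := Prod.mk.inj (hinj v h3)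
      exact ⟨congrArg Subtype.val h4.1, h4.2⟩
    simp only [dif_pos he, dif_pos hf] at hcode
    refine key (E.s e) rfl hs.symm (hcode.trans ?_)
    have : ∀ v (h : E.s f = v), c (E.s f) (⟨f, rfl, hf⟩, n) = c v (⟨f, h, hf⟩, n) := by
      rintro v rfl; rfl
    exact this _ hs.symm
  · rintro v hv ⟨e, he⟩ k
    obtain ⟨⟨⟨f, hf, hfH⟩, n⟩, hk⟩ := hsurj v hv ⟨⟨e, he⟩⟩ k
    subst hf
    exact ⟨f, n, rfl, hfH, by simp only [dif_pos hfH]; exact hk⟩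
  · intro e m hs he
    simp only [dif_pos he]
    exact hzero _ hs _

variable (R : Type w) [CommRing R] (H D : Set V) (code : A → ℕ → ℕ)

open Classical in
/-- The projection by which a vertex acts. -/
noncomputable def repVert (v : V) : Module.End R ((V × ℕ) →₀ R) :=
  Finsupp.linearCombination R fun z => if z.1 = v ∧ v ∉ H then Finsupp.single z 1 else 0

open Classical in
/-- The operator by which an edge acts. -/
noncomputable def repEdge (e : A) : Module.End R ((V × ℕ) →₀ R) :=
  Finsupp.linearCombination R fun z =>
    if z.1 = E.r e ∧ E.r e ∉ H then Finsupp.single (E.s e, code e z.2) 1 else 0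

open Classical in
/-- The operator by which a ghost edge acts. -/
noncomputable def repGhost (e : A) : Module.End R ((V × ℕ) →₀ R) :=
  Finsupp.linearCombination R fun z =>
    if h : z.1 = E.s e ∧ E.r e ∉ H ∧ ∃ m, code e m = z.2 then
      Finsupp.single (E.r e, h.2.2.choose) 1 else 0

variable {H D code}

theorem repVert_self {v : V} (hv : v ∉ H) (n : ℕ) :
    repVert R H v (Finsupp.single (v, n) 1) = Finsupp.single (v, n) 1 := by
  simp [repVert, hv]

theorem repVert_ne {v w : V} (hw : w ≠ v) (n : ℕ) :
    repVert R H v (Finsupp.single (w, n) 1) = 0 := by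
  simp [repVert, hw]

theorem repVert_of_mem {v : V} (hv : v ∈ H) : repVert R H v = 0 := by
  ext z : 2
  simp [repVert, hv]

theorem repEdge_self {e : A} (he : E.r e ∉ H) (n : ℕ) :
    repEdge E R H code e (Finsupp.single (E.r e, n) 1) = Finsupp.single (E.s e, code e n) 1 := by
  simp [repEdge, he]

theorem repEdge_ne {e : A} {w : V} (hw : w ≠ E.r e) (n : ℕ) :
    repEdge E R H code e (Finsupp.single (w, n) 1) = 0 := by
  simp [repEdge, hw]

theorem repEdge_of_mem {e : A} (he : E.r e ∈ H) : repEdge E R H code e = 0 := by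
  ext z : 2
  simp [repEdge, he]

theorem repGhost_of_mem {e : A} (he : E.r e ∈ H) : repGhost E R H code e = 0 := by
  ext z : 2
  simp [repGhost, he]

theorem repGhost_ne {e : A} {w : V} (hw : w ≠ E.s e) (n : ℕ) :
    repGhost E R H code e (Finsupp.single (w, n) 1) = 0 := by
  simp [repGhost, hw]

theorem repGhost_of_notMem_range {e : A} {w : V} {n : ℕ} (hn : ∀ m, code e m ≠ n) :
    repGhost E R H code e (Finsupp.single (w, n) 1) = 0 := by
  simp [repGhost, hn]

theorem repGhost_self (hcode : IsCoding E H D code) {e : A} (he : E.r e ∉ H) (n : ℕ) :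
    repGhost E R H code e (Finsupp.single (E.s e, code e n) 1) = Finsupp.single (E.r e, n) 1 := by
  have h : ∃ m, code e m = code e n := ⟨n, rfl⟩
  have h2 : h.choose = n := (hcode.inj e e _ _ rfl he he h.choose_spec).2
  rw [repGhost, Finsupp.linearCombination_single, dif_pos ⟨rfl, he, h⟩, h2, one_smul]

theorem repGhost_ne_edge (hcode : IsCoding E H D code) {e f : A} (hef : e ≠ f) (hf : E.r f ∉ H)
    (n : ℕ) : repGhost E R H code e (Finsupp.single (E.s f, code f n) 1) = 0 := by
  by_cases he : E.r e ∈ H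
  · rw [repGhost_of_mem E R he]; rfl
  by_cases hs : E.s f = E.s e
  · exact repGhost_of_notMem_range E R fun m hm => hef (hcode.inj e f m n hs.symm he hf hm).1
  · exact repGhost_ne E R hs _

/-- The operators `e e^*` with `s(e) = v` add up to the identity on the basis vectors at `v`. -/
theorem sum_repEdge_repGhost (hcode : IsCoding E H D code) {v : V} (hvD : v ∉ D)
    (hv : ∃ e, E.s e = v ∧ E.r e ∉ H) (F : Finset A)
    (hF : ∀ e, E.s e = v → E.r e ∉ H → e ∈ F) (n : ℕ) :
    (∑ e ∈ F, repEdge E R H code e * repGhost E R H code e) (Finsupp.single (v, n) 1) =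
      Finsupp.single (v, n) 1 := by
  obtain ⟨e, m, rfl, he, rfl⟩ := hcode.surj v hvD hv n
  rw [LinearMap.sum_apply, Finset.sum_eq_single e]
  · rw [Module.End.mul_apply, repGhost_self E R hcode he, repEdge_self E R he]
  · intro f _ hf
    rw [Module.End.mul_apply, repGhost_ne_edge E R hcode hf he, map_zero]
  · intro h
    exact absurd (hF e rfl he) h

/-- Each vertex outside H carries a copy of ℕ, into which the edges leaving it embed the copies at
their ranges; ghost edges undo these embeddings. The relation v = ∑ e e^* at a finite emitter needs
the embedded copies to exhaust the copy at v: D contains only infinite emitters, and saturation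
provides an edge that leaves H aside. -/
theorem isLeavittFamily_rep (hcode : IsCoding E H D code) (hher : ∀ e, E.s e ∈ H → E.r e ∈ H)
    (hsat : ∀ v, (E.out v).Finite → (E.out v).Nonempty → (∀ e, E.s e = v → E.r e ∈ H) → v ∈ H)
    (hD : ∀ v ∈ D, (E.out v).Infinite) :
    IsLeavittFamily E (repVert R H) (repEdge E R H code) (repGhost E R H code) := by
  constructor
  · intro v
    refine Finsupp.lhom_ext' fun ⟨w, n⟩ => LinearMap.ext_ring ?_
    simp only [LinearMap.comp_apply, Module.End.mul_apply, Finsupp.lsingle_apply]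
    by_cases hv : v ∈ H
    · simp [repVert_of_mem R hv]
    by_cases hw : w = v
    · subst hw; simp [repVert_self R hv]
    · simp [repVert_ne R hw]
  · intro v v' hvv
    refine Finsupp.lhom_ext' fun ⟨w, n⟩ => LinearMap.ext_ring ?_
    simp only [LinearMap.comp_apply, Module.End.mul_apply, Finsupp.lsingle_apply]
    by_cases hv : v' ∈ H
    · simp [repVert_of_mem R hv]
    by_cases hw : w = v'
    · subst hw; simp [repVert_self R hv, repVert_ne R hvv.symm]
    · simp [repVert_ne R hw]
  · intro e
    refine Finsupp.lhom_ext' fun ⟨w, n⟩ => LinearMap.ext_ring ?_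
    simp only [LinearMap.comp_apply, Module.End.mul_apply, Finsupp.lsingle_apply]
    by_cases he : E.r e ∈ H
    · simp [repEdge_of_mem E R he]
    by_cases hw : w = E.r e
    · subst hw
      rw [repEdge_self E R he, repVert_self R fun h => he (hher e h)]
    · simp [repEdge_ne E R hw]
  · intro e
    refine Finsupp.lhom_ext' fun ⟨w, n⟩ => LinearMap.ext_ring ?_
    simp only [LinearMap.comp_apply, Module.End.mul_apply, Finsupp.lsingle_apply]
    by_cases he : E.r e ∈ H
    · simp [repEdge_of_mem E R he]
    by_cases hw : w = E.r e
    · subst hw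
      rw [repVert_self R he]
    · simp [repEdge_ne E R hw, repVert_ne R hw]
  · intro e
    refine Finsupp.lhom_ext' fun ⟨w, n⟩ => LinearMap.ext_ring ?_
    simp only [LinearMap.comp_apply, Module.End.mul_apply, Finsupp.lsingle_apply]
    by_cases he : E.r e ∈ H
    · simp [repGhost_of_mem E R he]
    by_cases hw : w = E.s e
    · subst hw
      by_cases hn : ∃ m, code e m = n
      · obtain ⟨m, rfl⟩ := hn
        rw [repGhost_self E R hcode he, repVert_self R he]
      · push Not at hn
        rw [repGhost_of_notMem_range E R hn, map_zero]
    · simp [repGhost_ne E R hw]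
  · intro e
    refine Finsupp.lhom_ext' fun ⟨w, n⟩ => LinearMap.ext_ring ?_
    simp only [LinearMap.comp_apply, Module.End.mul_apply, Finsupp.lsingle_apply]
    by_cases he : E.r e ∈ H
    · simp [repGhost_of_mem E R he]
    by_cases hw : w = E.s e
    · subst hw
      rw [repVert_self R fun h => he (hher e h)]
    · simp [repGhost_ne E R hw, repVert_ne R hw]
  · intro e
    refine Finsupp.lhom_ext' fun ⟨w, n⟩ => LinearMap.ext_ring ?_
    simp only [LinearMap.comp_apply, Module.End.mul_apply, Finsupp.lsingle_apply]
    by_cases he : E.r e ∈ H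
    · simp [repGhost_of_mem E R he, repVert_of_mem R he]
    by_cases hw : w = E.r e
    · subst hw
      rw [repEdge_self E R he, repGhost_self E R hcode he, repVert_self R he]
    · simp [repEdge_ne E R hw, repVert_ne R hw]
  · intro e f hef
    refine Finsupp.lhom_ext' fun ⟨w, n⟩ => LinearMap.ext_ring ?_
    simp only [LinearMap.comp_apply, Module.End.mul_apply, Finsupp.lsingle_apply]
    by_cases he : E.r f ∈ H
    · simp [repEdge_of_mem E R he]
    by_cases hw : w = E.r f
    · subst hw
      rw [repEdge_self E R he, repGhost_ne_edge E R hcode hef he]; rfl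
    · simp [repEdge_ne E R hw]
  · intro v hfin hne
    refine Finsupp.lhom_ext' fun ⟨w, n⟩ => LinearMap.ext_ring ?_
    simp only [LinearMap.comp_apply, Finsupp.lsingle_apply]
    by_cases hw : w = v
    · subst hw
      by_cases hv : w ∈ H
      · rw [repVert_of_mem R hv, Finset.sum_eq_zero]
        intro e he
        have hs : E.s e = w := by simpa [DirectedGraph.out] using he
        rw [repEdge_of_mem E R (hher e (hs ▸ hv)), zero_mul]
      · rw [repVert_self R hv, sum_repEdge_repGhost E R hcode (fun h => hD _ h hfin)]
        · by_contra! hcon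
          exact hv (hsat w hfin hne hcon)
        · intro e he _
          simpa [DirectedGraph.out] using he
    · rw [repVert_ne R hw, LinearMap.sum_apply, Finset.sum_eq_zero]
      intro e he
      have hs : E.s e = v := by simpa [DirectedGraph.out] using he
      rw [Module.End.mul_apply, repGhost_ne E R (by rwa [hs]), map_zero]

end Representation

/-! ### Vertices and elements v^H not in I(H,S) -/

section NotMem

variable {V : Type u} {A : Type v} {E : DirectedGraph V A} {R : Type w} [CommRing R]

theorem gap_eq_sum {H : Set V} {v : V} (hfin : {e | E.s e = v ∧ E.r e ∉ H}.Finite) :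
    gap R E H v = vert R E v - ∑ e ∈ hfin.toFinset, edge R E e * ghost R E e := by
  rw [gap, finsum_mem_eq_finite_toFinset_sum _ hfin]

/-- The ideal `I(H, S)` contains only the vertices of `H` and, of the elements `v^H`, only those
with `v ∈ S`. -/
theorem notMem_pairIdeal [Countable A] [Nontrivial R] {H S : Set V}
    (hher : ∀ e, E.s e ∈ H → E.r e ∈ H)
    (hsat : ∀ v, (E.out v).Finite → (E.out v).Nonempty → (∀ e, E.s e = v → E.r e ∈ H) → v ∈ H)
    (hS : S ⊆ E.breakingSet H) :
    (∀ v ∉ H, vert R E v ∉ pairIdeal R E H S) ∧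
      ∀ v ∈ E.breakingSet H \ S, gap R E H v ∉ pairIdeal R E H S := by
  -- With D = B_H \ S the operators e e^* with s(e) = v sum to v for v ∈ S, so that v^H acts as zero
  -- there, but fall short of v for v ∈ D.
  obtain ⟨code, hcode⟩ := exists_isCoding E H (E.breakingSet H \ S)
  obtain ⟨ρ, ⟨hv, he, hg⟩, -⟩ := existsUnique_lift R E
    (isLeavittFamily_rep E R hcode hher hsat fun v hv => hv.1.2.1)
  have hker : pairIdeal R E H S ≤ TwoSidedIdeal.ker ρ := by
    refine TwoSidedIdeal.span_le.2 ?_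
    rintro _ (⟨v, hvH, rfl⟩ | ⟨v, hvS, rfl⟩)
    · exact (TwoSidedIdeal.mem_ker _).2 (by rw [hv, repVert_of_mem R hvH])
    · refine (TwoSidedIdeal.mem_ker _).2 ?_
      obtain ⟨hvH, -, hne, hfin⟩ := hS hvS
      rw [gap_eq_sum hfin, map_sub, map_sum, hv, sub_eq_zero]
      simp_rw [map_mul, he, hg]
      refine Finsupp.lhom_ext' fun ⟨w, n⟩ => LinearMap.ext_ring ?_
      simp only [LinearMap.comp_apply, Finsupp.lsingle_apply]
      by_cases hw : w = v
      · subst hw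
        rw [repVert_self R hvH, sum_repEdge_repGhost E R hcode (fun h => h.2 hvS) hne]
        intro e h1 h2
        simpa using ⟨h1, h2⟩
      · rw [repVert_ne R hw, LinearMap.sum_apply, Finset.sum_eq_zero]
        intro e he
        have hs : E.s e = v := by simp at he; exact he.1
        rw [Module.End.mul_apply, repGhost_ne E R (by rwa [hs]), map_zero]
  constructor
  · intro v hvH hmem
    have h0 : ρ (vert R E v) = 0 := (TwoSidedIdeal.mem_ker _).1 (hker hmem)
    have h1 := repVert_self R hvH 0
    rw [← hv, h0] at h1
    simpa using DFunLike.congr_fun h1 (v, 0)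
  · intro v hvD hmem
    obtain ⟨hvH, -, hne, hfin⟩ := hvD.1
    have h0 : ρ (gap R E H v) = 0 := (TwoSidedIdeal.mem_ker _).1 (hker hmem)
    have h1 := repVert_self R hvH 0
    -- For v ∈ D no code takes the value 0, so every e^* kills the basis vector (v, 0) and v^H fixes
    -- it.
    have h2 : ρ (gap R E H v) (Finsupp.single (v, 0) 1) = Finsupp.single (v, 0) 1 := by
      rw [gap_eq_sum hfin, map_sub, map_sum, hv, LinearMap.sub_apply, h1, LinearMap.sum_apply,
        Finset.sum_eq_zero, sub_zero]
      intro e hmem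
      have hs : E.s e = v ∧ E.r e ∉ H := by simpa using hmem
      rw [map_mul, he, hg, Module.End.mul_apply, repGhost_of_notMem_range, map_zero]
      exact fun m => hcode.ne_zero e m (hs.1 ▸ hvD) hs.2
    rw [h0] at h2
    simpa using DFunLike.congr_fun h2 (v, 0)

end NotMem

/-! ### The reduction theorem -/

section Reduction

variable (R : Type w) [Field R] {V : Type u} {A : Type v} (E : DirectedGraph V A) {B : Type*}
  [NonUnitalRing B] [Module R B]

/-- The span of the elements `α β^*` with `β` of length at most `n`. -/
def ghostSpan (p : V → B) (x y : A → B) (n : ℕ) : Submodule R B :=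
  Submodule.span R {a | ∃ v l w m z, E.IsPath v l z ∧ E.IsPath w m z ∧ m.length ≤ n ∧
    a = pathOf p x v l * ghostOf p y w m}

/-- The span of the paths with range `a`. -/
def realSpan (p : V → B) (x : A → B) (a : V) : Submodule R B :=
  Submodule.span R (Set.range fun i : {i : V × List A // E.IsPath i.1 i.2 a} =>
    pathOf p x i.1.1 i.1.2)

/-- `ClosedSum R E p x a n b`: the element `b` is a linear combination of `n` closed paths of
positive length based at `a`. -/
inductive ClosedSum (p : V → B) (x : A → B) (a : V) : ℕ → B → Prop
  | zero : ClosedSum p x a 0 0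
  | add (t : R) (l : List A) (n : ℕ) (b : B) : E.IsPath a l a → l ≠ [] → ClosedSum p x a n b →
      ClosedSum p x a (n + 1) (t • pathOf p x a l + b)

variable {R E}

theorem ClosedSum.add_closedSum {p : V → B} {x : A → B} {a : V} {m n : ℕ} {b c : B}
    (hb : ClosedSum R E p x a m b) (hc : ClosedSum R E p x a n c) :
    ClosedSum R E p x a (m + n) (b + c) := by
  induction hb with
  | zero => simpa using hc
  | add t l m b hl hne _ ih =>
    rw [Nat.add_right_comm, add_assoc (t • _)]
    exact .add t l _ _ hl hne ih

theorem ClosedSum.sum {ι : Type*} {p : V → B} {x : A → B} {a : V} (F : Finset ι) (f : ι → B)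
    (hf : ∀ i ∈ F, ∃ n, ClosedSum R E p x a n (f i)) :
    ∃ n, ClosedSum R E p x a n (∑ i ∈ F, f i) := by
  classical
  induction F using Finset.induction_on with
  | empty => exact ⟨0, by simpa using ClosedSum.zero⟩
  | insert i F hi ih =>
    obtain ⟨n, hn⟩ := ih fun j hj => hf j (Finset.mem_insert_of_mem hj)
    obtain ⟨m, hm⟩ := hf i (Finset.mem_insert_self i F)
    exact ⟨m + n, by rw [Finset.sum_insert hi]; exact hm.add_closedSum hn⟩

variable [IsScalarTower R B B] [SMulCommClass R B B] {p : V → B} {x y : A → B}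

namespace IsLeavittFamily

theorem x_eq_zero (h : IsLeavittFamily E p x y) {e : A} (he : p (E.r e) = 0) : x e = 0 := by
  rw [← h.mul_range, he, mul_zero]

theorem exists_mem_ghostSpan {b : B} (hb : b ∈ pathSpan R E p x y) : ∃ n, b ∈ ghostSpan R E p x y n := by
  have hmono : ∀ {m n : ℕ}, m ≤ n → ghostSpan R E p x y m ≤ ghostSpan R E p x y n := by
    intro m n hmn
    refine Submodule.span_mono ?_
    rintro _ ⟨v, l, w, k, z, hl, hk, hlen, rfl⟩
    exact ⟨v, l, w, k, z, hl, hk, hlen.trans hmn, rfl⟩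
  induction hb using Submodule.span_induction with
  | mem b hb =>
    obtain ⟨v, l, w, m, z, hl, hm, rfl⟩ := hb
    exact ⟨m.length, Submodule.subset_span ⟨v, l, w, m, z, hl, hm, le_rfl, rfl⟩⟩
  | zero => exact ⟨0, zero_mem _⟩
  | add a b _ _ ha hb =>
    obtain ⟨m, hm⟩ := ha
    obtain ⟨n, hn⟩ := hb
    exact ⟨max m n, add_mem (hmono (le_max_left m n) hm) (hmono (le_max_right m n) hn)⟩
  | smul t a _ ha =>
    obtain ⟨m, hm⟩ := ha
    exact ⟨m, Submodule.smul_mem _ _ hm⟩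

theorem ghostSpan_le (p : V → B) (x y : A → B) (n : ℕ) :
    ghostSpan R E p x y n ≤ pathSpan R E p x y := by
  refine Submodule.span_mono ?_
  rintro _ ⟨v, l, w, k, z, hl, hk, -, rfl⟩
  exact ⟨v, l, w, k, z, hl, hk, rfl⟩

/-- The factor e meets the ghost of the first edge of β in αβ^*, so β becomes shorter or the product
vanishes. This drives the induction in `exists_reduction`. -/
theorem mul_x_mem_ghostSpan (h : IsLeavittFamily E p x y) (e : A) {n : ℕ} {b : B}
    (hb : b ∈ ghostSpan R E p x y (n + 1)) : b * x e ∈ ghostSpan R E p x y n := by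
  induction hb using Submodule.span_induction with
  | mem b hb =>
    obtain ⟨v, l, w, m, z, hl, hm, hlen, rfl⟩ := hb
    cases m with
    | nil =>
      cases hm
      rw [ghostOf_nil, h.pathOf_mul_p hl]
      by_cases hs : E.s e = w
      · subst hs
        have key : pathOf p x v l * x e = pathOf p x v (l ++ [e]) * ghostOf p y (E.r e) [] := by
          rw [h.pathOf_append hl, h.pathOf_singleton, ghostOf_nil, mul_assoc, h.mul_range]
        rw [key]
        exact Submodule.subset_span ⟨v, l ++ [e], E.r e, [], E.r e,
          E.isPath_append hl (E.isPath_singleton e), rfl, Nat.zero_le _, rfl⟩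
      · rw [← h.source_mul, ← mul_assoc, h.pathOf_mul_p_ne hl (Ne.symm hs), zero_mul]
        exact zero_mem _
    | cons f m =>
      obtain ⟨rfl, hm⟩ := hm
      rw [h.ghostOf_cons, mul_assoc, mul_assoc]
      by_cases hfe : f = e
      · subst hfe
        rw [h.star_mul_self, h.ghostOf_mul_p]
        exact Submodule.subset_span ⟨v, l, _, m, z, hl, hm, by simpa using hlen, rfl⟩
      · rw [h.star_mul_ne _ _ hfe, mul_zero, mul_zero]
        exact zero_mem _
  | zero => rw [zero_mul]; exact zero_mem _
  | add a b _ _ ha hb => rw [add_mul]; exact add_mem ha hb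
  | smul t a _ ha => rw [smul_mul_assoc]; exact Submodule.smul_mem _ _ ha

theorem pathOf_mem_realSpan {a b : V} {l : List A} (hl : E.IsPath a l b) :
    pathOf p x a l ∈ realSpan R E p x b :=
  Submodule.subset_span ⟨⟨(a, l), hl⟩, rfl⟩

theorem mul_p_mem_realSpan (h : IsLeavittFamily E p x y) (a : V) {b : B}
    (hb : b ∈ ghostSpan R E p x y 0) : b * p a ∈ realSpan R E p x a := by
  induction hb using Submodule.span_induction with
  | mem b hb =>
    obtain ⟨v, l, w, m, z, hl, hm, hlen, rfl⟩ := hb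
    obtain rfl : m = [] := List.eq_nil_of_length_eq_zero (Nat.le_zero.1 hlen)
    cases hm
    rw [ghostOf_nil, h.pathOf_mul_p hl]
    by_cases hz : w = a
    · subst hz
      rw [h.pathOf_mul_p hl]
      exact pathOf_mem_realSpan hl
    · rw [h.pathOf_mul_p_ne hl hz]
      exact zero_mem _
  | zero => rw [zero_mul]; exact zero_mem _
  | add a b _ _ ha hb => rw [add_mul]; exact add_mem ha hb
  | smul t a _ ha => rw [smul_mul_assoc]; exact Submodule.smul_mem _ _ ha

theorem realSpan_mul_p (h : IsLeavittFamily E p x y) {a : V} {b : B}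
    (hb : b ∈ realSpan R E p x a) : b * p a = b := by
  induction hb using Submodule.span_induction with
  | mem b hb =>
    obtain ⟨⟨⟨v, l⟩, hl⟩, rfl⟩ := hb
    exact h.pathOf_mul_p hl
  | zero => rw [zero_mul]
  | add a b _ _ ha hb => rw [add_mul, ha, hb]
  | smul t a _ ha => rw [smul_mul_assoc, ha]

/-- Up to elements annihilated by `v - ∑_{e ∈ F} e e^*` for all large `F ⊆ s⁻¹(v)`, an element of
`B v` is a linear combination of paths. -/
theorem exists_realSpan_approx (h : IsLeavittFamily E p x y) (a : V) {b : B}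
    (hb : b ∈ pathSpan R E p x y) :
    ∃ c ∈ realSpan R E p x a, ∃ F₀ : Finset A, (∀ e ∈ F₀, E.s e = a) ∧
      ∀ F : Finset A, F₀ ⊆ F → (∀ e ∈ F, E.s e = a) →
        b * (p a - ∑ e ∈ F, x e * y e) = c * (p a - ∑ e ∈ F, x e * y e) := by
  classical
  induction hb using Submodule.span_induction with
  | mem b hb =>
    obtain ⟨v, l, w, m, z, hl, hm, rfl⟩ := hb
    cases m with
    | nil =>
      cases hm
      rw [ghostOf_nil, h.pathOf_mul_p hl]
      by_cases hw : w = a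
      · subst hw
        exact ⟨_, pathOf_mem_realSpan hl, ∅, by simp, fun _ _ _ => rfl⟩
      · refine ⟨0, zero_mem _, ∅, by simp, fun F _ hF => ?_⟩
        have hq : p a - ∑ e ∈ F, x e * y e = p a * (p a - ∑ e ∈ F, x e * y e) := by
          rw [mul_sub, h.idem, Finset.mul_sum]
          congr 1
          refine Finset.sum_congr rfl fun e he => ?_
          rw [← mul_assoc, ← hF e he, h.source_mul]
        rw [hq, ← mul_assoc, h.pathOf_mul_p_ne hl hw, zero_mul, zero_mul]
    | cons f m =>
      obtain ⟨rfl, hm⟩ := hm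
      rw [h.ghostOf_cons]
      by_cases hf : E.s f = a
      · subst hf
        -- Once f ∈ F, the sum contributes f^* f f^* = f^*, which cancels f^* v.
        refine ⟨0, zero_mem _, {f}, by simp, fun F hF hF' => ?_⟩
        have : y f * (p (E.s f) - ∑ e ∈ F, x e * y e) = 0 := by
          rw [mul_sub, h.mul_source, Finset.mul_sum, Finset.sum_eq_single f, ← mul_assoc,
            h.star_mul_self, h.range_mul, sub_self]
          · intro e _ hef
            rw [← mul_assoc, h.star_mul_ne _ _ hef.symm, zero_mul]
          · intro hfF
            exact absurd (hF (Finset.mem_singleton_self f)) hfF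
        rw [mul_assoc, mul_assoc, this, mul_zero, mul_zero, zero_mul]
      · refine ⟨0, zero_mem _, ∅, by simp, fun F _ hF => ?_⟩
        have : y f * (p a - ∑ e ∈ F, x e * y e) = 0 := by
          rw [mul_sub, ← h.mul_source, mul_assoc, h.orth _ _ hf, mul_zero, zero_sub, neg_eq_zero,
            Finset.mul_sum]
          refine Finset.sum_eq_zero fun e he => ?_
          have hfe : f ≠ e := by rintro rfl; exact hf (hF _ he)
          rw [h.mul_source, ← mul_assoc, h.star_mul_ne _ _ hfe, zero_mul]
        rw [mul_assoc, mul_assoc, this, mul_zero, mul_zero, zero_mul]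
  | zero => exact ⟨0, zero_mem _, ∅, by simp, fun _ _ _ => rfl⟩
  | add b b' _ _ hb hb' =>
    obtain ⟨c, hc, F, hF, hF'⟩ := hb
    obtain ⟨c', hc', G, hG, hG'⟩ := hb'
    refine ⟨c + c', add_mem hc hc', F ∪ G, ?_, fun F' h1 h2 => ?_⟩
    · intro e he
      exact (Finset.mem_union.1 he).elim (hF e) (hG e)
    · rw [add_mul, add_mul, hF' _ (Finset.union_subset_left h1) h2,
        hG' _ (Finset.union_subset_right h1) h2]
  | smul t b _ hb =>
    obtain ⟨c, hc, F, hF, hF'⟩ := hb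
    refine ⟨t • c, Submodule.smul_mem _ _ hc, F, hF, fun F' h1 h2 => ?_⟩
    rw [smul_mul_assoc, smul_mul_assoc, hF' _ h1 h2]

/-- A nonzero linear combination of paths with range `a` can be multiplied on the left so that the
result has a nonzero constant term. -/
theorem exists_mul_eq_add_closedSum (h : IsLeavittFamily E p x y) {a : V} {b : B}
    (hb : b ∈ realSpan R E p x a) (hb0 : b ≠ 0) :
    ∃ c, ∃ k : R, k ≠ 0 ∧ ∃ n g, ClosedSum R E p x a n g ∧ c * b = k • p a + g := by
  obtain ⟨c, rfl⟩ := (Finsupp.mem_span_range_iff_exists_finsupp).1 hb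
  have hsupp : c.support.Nonempty := by
    rw [Finsupp.support_nonempty_iff]
    rintro rfl
    simp at hb0
  -- For a shortest path γ in the combination, γ^*γ = a, while γ^*γ' for any other γ' is zero or a
  -- closed path of positive length. The combination need not be unique for this.
  obtain ⟨i, hi, hmin⟩ := Finset.exists_min_image c.support (fun i => i.1.2.length) hsupp
  classical
  have hsum : ∃ n, ClosedSum R E p x a n (∑ j ∈ c.support.erase i,
      c j • (ghostOf p y i.1.1 i.1.2 * pathOf p x j.1.1 j.1.2)) := by
    refine ClosedSum.sum _ _ fun j hj => ?_
    rw [Finset.mem_erase] at hj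
    by_cases hpre : i.1.1 = j.1.1 ∧ i.1.2 <+: j.1.2
    · obtain ⟨h1, m, hm⟩ := hpre
      rw [← h1, ← hm, h.ghostOf_mul_pathOf_append i.2]
      have hcl : E.IsPath a m a := by
        have hj2 := j.2
        rw [← h1, ← hm] at hj2
        obtain ⟨z, hz, hz'⟩ := E.isPath_of_append hj2
        rwa [E.isPath_range_unique hz i.2] at hz'
      have hne : m ≠ [] := by
        rintro rfl
        rw [List.append_nil] at hm
        exact hj.1 (Subtype.ext (Prod.ext h1.symm hm.symm))
      have := ClosedSum.add (p := p) (x := x) (c j) m 0 0 hcl hne .zero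
      rw [add_zero] at this
      exact ⟨_, this⟩
    · rw [h.ghostOf_mul_pathOf_eq_zero i.2 j.2 (hmin j hj.2) hpre, smul_zero]
      exact ⟨0, .zero⟩
  obtain ⟨n, hn⟩ := hsum
  refine ⟨ghostOf p y i.1.1 i.1.2, c i, Finsupp.mem_support_iff.1 hi, n, _, hn, ?_⟩
  rw [Finsupp.sum, Finset.mul_sum, ← Finset.add_sum_erase _ _ hi, mul_smul_comm,
    h.ghostOf_mul_pathOf i.2]
  simp_rw [mul_smul_comm]

theorem mul_closedSum_eq_zero (h : IsLeavittFamily E p x y) {a : V} {q : B}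
    (hq : ∀ e, E.s e = a → q * x e = 0) {n : ℕ} {g : B} (hg : ClosedSum R E p x a n g) :
    q * g = 0 := by
  induction hg with
  | zero => rw [mul_zero]
  | add t l n b hl hne _ ih =>
    cases l with
    | nil => exact absurd rfl hne
    | cons e l =>
      obtain ⟨rfl, hl⟩ := hl
      rw [mul_add, ih, mul_smul_comm, h.pathOf_cons, ← mul_assoc, hq e rfl, zero_mul, smul_zero,
        add_zero]

theorem exists_y_mul_closedSum_eq_zero (h : IsLeavittFamily E p x y) {a : V} {n : ℕ} {g : B}
    (hg : ClosedSum R E p x a n g) : ∃ F : Finset A, ∀ f ∉ F, y f * g = 0 := by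
  classical
  induction hg with
  | zero => exact ⟨∅, fun f _ => mul_zero _⟩
  | add t l n b hl hne _ ih =>
    obtain ⟨F, hF⟩ := ih
    refine ⟨F ∪ l.toFinset, fun f hf => ?_⟩
    rw [Finset.mem_union, not_or, List.mem_toFinset] at hf
    rw [mul_add, hF f hf.1, mul_smul_comm, h.y_mul_pathOf f hl hne, smul_zero, add_zero]
    exact fun h => hf.2 (List.mem_of_mem_head? h)

/-- The element `v - ∑ e e^*`, where `e` runs through the edges with source `v` whose range does not
vanish in the family; meaningful if there are only finitely many such edges. -/
noncomputable def defect (_ : IsLeavittFamily E p x y) (a : V) : B :=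
  p a - ∑ᶠ e ∈ {e | E.s e = a ∧ p (E.r e) ≠ 0}, x e * y e

theorem defect_mul_x (h : IsLeavittFamily E p x y) {a : V}
    (hfin : {e | E.s e = a ∧ p (E.r e) ≠ 0}.Finite) {e : A} (he : E.s e = a) :
    h.defect a * x e = 0 := by
  subst he
  by_cases hr : p (E.r e) = 0
  · rw [h.x_eq_zero hr, mul_zero]
  · rw [defect, finsum_mem_eq_finite_toFinset_sum _ hfin, sub_mul, h.source_mul,
      Finset.sum_mul, Finset.sum_eq_single e, mul_assoc, h.star_mul_self, h.mul_range, sub_self]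
    · intro f _ hfe
      rw [mul_assoc, h.star_mul_ne _ _ hfe, mul_zero]
    · intro hmem
      exact absurd (by simpa using hr) hmem

theorem p_mul_defect (h : IsLeavittFamily E p x y) {a : V}
    (hfin : {e | E.s e = a ∧ p (E.r e) ≠ 0}.Finite) : p a * h.defect a = h.defect a := by
  rw [defect, finsum_mem_eq_finite_toFinset_sum _ hfin, mul_sub, h.idem, Finset.mul_sum]
  congr 1
  refine Finset.sum_congr rfl fun e he => ?_
  have he' : E.s e = a := by simp at he; exact he.1
  rw [← mul_assoc, ← he', h.source_mul]

theorem defect_mul_p (h : IsLeavittFamily E p x y) {a : V}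
    (hfin : {e | E.s e = a ∧ p (E.r e) ≠ 0}.Finite) : h.defect a * p a = h.defect a := by
  rw [defect, finsum_mem_eq_finite_toFinset_sum _ hfin, sub_mul, h.idem, Finset.sum_mul]
  congr 1
  refine Finset.sum_congr rfl fun e he => ?_
  have he' : E.s e = a := by simp at he; exact he.1
  rw [mul_assoc, ← he', h.mul_source]

theorem defect_mul_defect (h : IsLeavittFamily E p x y) {a : V}
    (hfin : {e | E.s e = a ∧ p (E.r e) ≠ 0}.Finite) : h.defect a * h.defect a = h.defect a := by
  nth_rewrite 2 [defect]
  rw [finsum_mem_eq_finite_toFinset_sum _ hfin, mul_sub, h.defect_mul_p hfin, Finset.mul_sum,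
    Finset.sum_eq_zero, sub_zero]
  intro e he
  have he' : E.s e = a := by simp at he; exact he.1
  rw [← mul_assoc, h.defect_mul_x hfin he', zero_mul]

/-- First part of the reduction theorem: from a nonzero element one obtains by multiplication
either a multiple of a defect element or a polynomial in closed paths with nonzero constant term. -/
theorem exists_reduction (h : IsLeavittFamily E p x y) {b : B} (hb : b ∈ pathSpan R E p x y)
    (hb0 : b ≠ 0) :
    ∃ c d a, ∃ k : R, k ≠ 0 ∧
      (({e | E.s e = a ∧ p (E.r e) ≠ 0}.Finite ∧ h.defect a ≠ 0 ∧ c * b * d = k • h.defect a) ∨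
        p a ≠ 0 ∧ ∃ n g, ClosedSum R E p x a n g ∧ c * b * d = k • p a + g) := by
  obtain ⟨n, hn⟩ := exists_mem_ghostSpan hb
  clear hb
  induction n generalizing b with
  | zero =>
    obtain ⟨a, ha⟩ := h.exists_mul_p_ne_zero (ghostSpan_le p x y _ hn) hb0
    obtain ⟨c, k, hk, n, g, hg, hcb⟩ :=
      h.exists_mul_eq_add_closedSum (h.mul_p_mem_realSpan a hn) ha
    refine ⟨c, p a, a, k, hk, Or.inr ⟨?_, n, g, hg, by rw [mul_assoc, hcb]⟩⟩
    intro h0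
    exact ha (by rw [h0, mul_zero])
  | succ n ih =>
    by_cases hx : ∃ e, b * x e ≠ 0
    · obtain ⟨e, he⟩ := hx
      obtain ⟨c, d, a, k, hk, hcd⟩ := ih he (h.mul_x_mem_ghostSpan e hn)
      refine ⟨c, x e * d, a, k, hk, ?_⟩
      have : c * b * (x e * d) = c * (b * x e) * d := by simp only [mul_assoc]
      rwa [this]
    push Not at hx
    obtain ⟨a, ha⟩ := h.exists_mul_p_ne_zero (ghostSpan_le p x y _ hn) hb0
    obtain ⟨z, hz, F₀, hF₀, happ⟩ := h.exists_realSpan_approx a (ghostSpan_le p x y _ hn)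
    -- As b annihilates every edge, b v = b(v − ∑ e e^*) for every finite sum, and b may be replaced
    -- there by the combination z of paths.
    have key : ∀ F : Finset A, F₀ ⊆ F → (∀ e ∈ F, E.s e = a) →
        b * p a = z * (p a - ∑ e ∈ F, x e * y e) := by
      intro F h1 h2
      rw [← happ F h1 h2, mul_sub, Finset.mul_sum, Finset.sum_eq_zero, sub_zero]
      intro e _
      rw [← mul_assoc, hx, zero_mul]
    have hz0 : z ≠ 0 := by
      rintro rfl
      exact ha (by rw [key F₀ subset_rfl hF₀, zero_mul])
    have hpa : p a ≠ 0 := fun h0 => ha (by rw [h0, mul_zero])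
    obtain ⟨c, k, hk, m, g, hg, hcz⟩ := h.exists_mul_eq_add_closedSum hz hz0
    classical
    by_cases hfin : {e | E.s e = a ∧ p (E.r e) ≠ 0}.Finite
    · have hdef : b * p a = z * h.defect a := by
        rw [key (F₀ ∪ hfin.toFinset) Finset.subset_union_left, defect,
          finsum_mem_eq_finite_toFinset_sum _ hfin]
        · congr 2
          symm
          refine Finset.sum_subset Finset.subset_union_right fun e he he' => ?_
          have hs : E.s e = a := by
            rcases Finset.mem_union.1 he with he | he
            · exact hF₀ e he
            · exact absurd he he'
          have : p (E.r e) = 0 := by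
            by_contra hr
            exact he' (by simpa using ⟨hs, hr⟩)
          rw [h.x_eq_zero this, zero_mul]
        · intro e he
          rcases Finset.mem_union.1 he with he | he
          · exact hF₀ e he
          · simp at he; exact he.1
      -- Writing q for the idempotent defect element, q c (b a) = q (c z) q = q (k a + g) q = k q,
      -- because q kills the first edge of each closed path in g.
      refine ⟨h.defect a * c, p a, a, k, hk, Or.inl ⟨hfin, ?_, ?_⟩⟩
      · intro h0
        exact ha (by rw [hdef, h0, mul_zero])
      · rw [mul_assoc, hdef, mul_assoc, ← mul_assoc c, hcz, add_mul, mul_add, smul_mul_assoc,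
          mul_smul_comm, h.p_mul_defect hfin, h.defect_mul_defect hfin, ← mul_assoc (h.defect a) g,
          h.mul_closedSum_eq_zero (fun e he => h.defect_mul_x hfin he) hg, zero_mul, add_zero]
    · exfalso
      obtain ⟨F₁, hF₁⟩ := h.exists_y_mul_closedSum_eq_zero hg
      -- An edge f avoiding the finitely many exceptional ones gives a contradiction: z f = b f = 0,
      -- whereas f^*(c z) f = k r(f) ≠ 0 since f^* g = 0.
      obtain ⟨f, ⟨hfs, hfr⟩, hf⟩ := Set.Infinite.exists_notMem_finset hfin (F₀ ∪ F₁)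
      rw [Finset.mem_union, not_or] at hf
      have h1 : b * p a * x f = z * x f := by
        rw [key F₀ subset_rfl hF₀, mul_assoc, sub_mul, Finset.sum_mul, Finset.sum_eq_zero, sub_zero,
          ← mul_assoc, h.realSpan_mul_p hz]
        intro e he
        have hef : e ≠ f := by rintro rfl; exact hf.1 he
        rw [mul_assoc, h.star_mul_ne _ _ hef, mul_zero]
      have h2 : z * x f = 0 := by
        rw [← h1, ← hfs, mul_assoc, h.source_mul, hx]
      have h3 : y f * (c * z) * x f = 0 := by
        rw [mul_assoc, mul_assoc, h2, mul_zero, mul_zero]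
      rw [hcz, mul_add, hF₁ f hf.2, add_zero, mul_smul_comm, smul_mul_assoc, ← hfs, h.mul_source,
        h.star_mul_self, smul_eq_zero] at h3
      exact h3.elim hk hfr

/-- For a closed path γ and a path δ, the product δ^*γδ vanishes unless γδ begins with δ, and then
equals the remaining part of γδ, a closed path at the range of δ as long as γ. No new terms arise.
-/
theorem conj_closedSum (h : IsLeavittFamily E p x y) {a b : V} {d : List A} (hd : E.IsPath a d b)
    {n : ℕ} {g : B} (hg : ClosedSum R E p x a n g) :
    ∃ m ≤ n, ClosedSum R E p x b m (ghostOf p y a d * g * pathOf p x a d) := by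
  induction hg with
  | zero => exact ⟨0, le_rfl, by simpa using ClosedSum.zero⟩
  | add t l n g hl hne _ ih =>
    obtain ⟨m, hmn, hm⟩ := ih
    rw [mul_add, add_mul, mul_smul_comm, smul_mul_assoc, mul_assoc, ← h.pathOf_append hl]
    by_cases hpre : a = a ∧ d <+: l ++ d
    · obtain ⟨-, l', hl'⟩ := hpre
      rw [← hl', h.ghostOf_mul_pathOf_append hd]
      have hp : E.IsPath a (d ++ l') b := hl' ▸ E.isPath_append hl hd
      obtain ⟨z, hz, hz'⟩ := E.isPath_of_append hp
      rw [E.isPath_range_unique hz hd] at hz'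
      refine ⟨m + 1, by omega, .add t l' m _ hz' ?_ hm⟩
      rintro rfl
      apply hne
      have := congrArg List.length hl'
      simp at this
      exact this
    · rw [h.ghostOf_mul_pathOf_eq_zero hd (E.isPath_append hl hd) (by simp) hpre, smul_zero,
        zero_add]
      exact ⟨m, by omega, hm⟩

/-- Second part of the reduction theorem: a polynomial in closed paths with nonzero constant term
yields a multiple of a vertex, unless there is a closed path without exits. -/
theorem exists_reduction_closedSum (h : IsLeavittFamily E p x y)
    (hL : ∀ a l, E.IsPath a l a → l ≠ [] → p a ≠ 0 →
      ∃ e ∈ l, ∃ f, E.s f = E.s e ∧ p (E.r f) ≠ 0 ∧ f ≠ e)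
    {k : R} {a : V} (ha : p a ≠ 0) {n : ℕ} {g : B}
    (hg : ClosedSum R E p x a n g) :
    ∃ c d b, p b ≠ 0 ∧ c * (k • p a + g) * d = k • p b := by
  induction n using Nat.strong_induction_on generalizing a g with
  | _ n ih =>
    cases hg with
    | zero =>
      refine ⟨p a, p a, a, ha, ?_⟩
      rw [add_zero, mul_smul_comm, smul_mul_assoc, h.idem, h.idem]
    | add t l n g hl hne hg =>
      obtain ⟨e, hel, f, hfs, hfr, hfe⟩ := hL a l hl hne ha
      obtain ⟨l₁, l₂, rfl⟩ := List.append_of_mem hel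
      obtain ⟨z, hz, hz'⟩ := E.isPath_of_append hl
      have hse : E.s e = z := hz'.1
      -- Let δ follow the first closed path γ up to its exit and leave it there by f. Then γδ does
      -- not begin with δ, so conjugation by δ kills that term and turns the constant term into k
      -- r(f). Fewer closed paths remain.
      have hd : E.IsPath a (l₁ ++ [f]) (E.r f) :=
        E.isPath_append hz ⟨hfs.trans hse, rfl⟩
      obtain ⟨m, hmn, hm⟩ := h.conj_closedSum hd hg
      have hzero : ghostOf p y a (l₁ ++ [f]) * pathOf p x a ((l₁ ++ e :: l₂) ++ (l₁ ++ [f])) = 0 := by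
        refine h.ghostOf_mul_pathOf_eq_zero hd (E.isPath_append hl hd) (by simp) ?_
        rintro ⟨-, hpre⟩
        rw [List.append_assoc, List.prefix_append_right_inj] at hpre
        simp at hpre
        exact hfe hpre
      obtain ⟨c, d, b, hb, hcd⟩ := ih m (by omega) hfr hm
      refine ⟨c * ghostOf p y a (l₁ ++ [f]), pathOf p x a (l₁ ++ [f]) * d, b, hb, ?_⟩
      rw [← hcd]
      have : ghostOf p y a (l₁ ++ [f]) *
          (k • p a + (t • pathOf p x a (l₁ ++ e :: l₂) + g)) * pathOf p x a (l₁ ++ [f]) =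
          k • p (E.r f) + ghostOf p y a (l₁ ++ [f]) * g * pathOf p x a (l₁ ++ [f]) := by
        rw [mul_add, mul_add, add_mul, add_mul, mul_smul_comm, mul_smul_comm, smul_mul_assoc,
          smul_mul_assoc, mul_assoc (ghostOf p y a (l₁ ++ [f])) (pathOf p x a _),
          ← h.pathOf_append hl, hzero, h.ghostOf_mul_p, h.ghostOf_mul_pathOf hd, smul_zero,
          zero_add]
      rw [← this]
      simp only [mul_assoc]

end IsLeavittFamily

end Reduction

/-! ### Primitive rings -/

section Primitive

variable {L B : Type u} [NonUnitalRing L] [NonUnitalRing B]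

theorem action_mul {N : Type*} [AddCommGroup N] (ρ : L →ₙ+* AddMonoid.End N) (a b : L) (n : N) :
    ρ (a * b) n = ρ a (ρ b n) := by
  rw [map_mul]; rfl

theorem action_add {N : Type*} [AddCommGroup N] (ρ : L →ₙ+* AddMonoid.End N) (a b : L) (n : N) :
    ρ (a + b) n = ρ a n + ρ b n := by
  rw [map_add]; rfl

theorem action_sub {N : Type*} [AddCommGroup N] (ρ : L →ₙ+* AddMonoid.End N) (a b : L) (n : N) :
    ρ (a - b) n = ρ a n - ρ b n := by
  rw [map_sub]; rfl

/-- A quotient of `L` is left primitive if and only if its kernel is the annihilator of a simple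
`L`-module. -/
theorem isLeftPrimitiveRing_iff (f : L →ₙ+* B) (hf : Function.Surjective f) :
    IsLeftPrimitiveRing B ↔ ∃ (N : Type u) (_ : AddCommGroup N) (ρ : L →ₙ+* AddMonoid.End N),
      (∀ a, ρ a = 0 ↔ f a = 0) ∧ IsSimpleAction ρ := by
  constructor
  · rintro ⟨N, _, σ, hinj, ⟨b, n, hbn⟩, hsub⟩
    refine ⟨N, _, σ.comp f, fun a => ?_, ?_, ?_⟩
    · rw [← map_eq_zero_iff σ hinj]; rfl
    · obtain ⟨a, rfl⟩ := hf b
      exact ⟨a, n, hbn⟩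
    · intro N' hN'
      refine hsub N' fun b n hn => ?_
      obtain ⟨a, rfl⟩ := hf b
      exact hN' a n hn
  · rintro ⟨N, _, ρ, hker, ⟨a, n, han⟩, hsub⟩
    have hwd : ∀ a a', f a = f a' → ρ a = ρ a' := by
      intro a a' h
      rw [← sub_eq_zero, ← map_sub, hker, map_sub, h, sub_self]
    let g := Function.surjInv hf
    have hg : ∀ b, f (g b) = b := Function.surjInv_eq hf
    let σ : B →ₙ+* AddMonoid.End N :=
      { toFun := fun b => ρ (g b)
        map_mul' := fun b b' => by
          rw [← map_mul]
          exact hwd _ _ (by rw [map_mul, hg, hg, hg])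
        map_zero' := (hker _).2 (hg 0)
        map_add' := fun b b' => by
          rw [← map_add]
          exact hwd _ _ (by rw [map_add, hg, hg, hg]) }
    have hσ : ∀ a, σ (f a) = ρ a := fun a => hwd _ _ (hg (f a))
    refine ⟨N, _, σ, ?_, ⟨f a, n, by rwa [hσ]⟩, fun N' hN' => hsub N' fun b n hn => ?_⟩
    · rw [injective_iff_map_eq_zero]
      intro b hb
      rw [← hg b]
      exact (hker _).1 hb
    · rw [← hσ]
      exact hN' _ n hn

theorem isLeftPrimitiveIdeal_iff (I : TwoSidedIdeal L) :
    IsLeftPrimitiveIdeal I ↔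
      ∃ (N : Type u) (_ : AddCommGroup N) (ρ : L →ₙ+* AddMonoid.End N),
        (∀ a, ρ a = 0 ↔ a ∈ I) ∧ IsSimpleAction ρ := by
  let f : L →ₙ+* I.ringCon.Quotient :=
    { toFun := fun a => (a : I.ringCon.Quotient)
      map_mul' := fun _ _ => rfl
      map_zero' := rfl
      map_add' := fun _ _ => rfl }
  have hf : ∀ a, f a = 0 ↔ a ∈ I := fun a => Quotient.eq''.trans Iff.rfl
  have := isLeftPrimitiveRing_iff f Quotient.mk''_surjective
  simp only [hf] at this
  exact this

/-- An ideal `J` is left primitive if there is a decreasing sequence of idempotents outside of `J`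
such that every larger ideal contains one of them. -/
theorem isLeftPrimitiveIdeal_of_idempotents {J : TwoSidedIdeal L} (q : ℕ → L)
    (hq : ∀ m n, m ≤ n → q m * q n = q n) (hqJ : ∀ n, q n ∉ J)
    (hJ : ∀ P : TwoSidedIdeal L, J < P → ∃ n, q n ∈ P) : IsLeftPrimitiveIdeal J := by
  -- If b q_n ∈ J, the same holds for all later indices. This left ideal contains J and all b − b
  -- q_n, and misses q_0 because q_0 q_n = q_n ∉ J.
  let K₀ : AddSubgroup L :=
    { carrier := {b | ∃ n, b * q n ∈ J}
      zero_mem' := ⟨0, by rw [zero_mul]; exact J.zero_mem⟩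
      add_mem' := by
        rintro a b ⟨m, hm⟩ ⟨n, hn⟩
        refine ⟨max m n, ?_⟩
        have h1 : a * q (max m n) = a * q m * q (max m n) := by
          rw [mul_assoc, hq m _ (le_max_left m n)]
        have h2 : b * q (max m n) = b * q n * q (max m n) := by
          rw [mul_assoc, hq n _ (le_max_right m n)]
        rw [add_mul, h1, h2]
        exact J.add_mem (J.mul_mem_right _ _ hm) (J.mul_mem_right _ _ hn)
      neg_mem' := by
        rintro a ⟨m, hm⟩
        exact ⟨m, by rw [neg_mul]; exact J.neg_mem hm⟩ }
  have hK₀ : ∀ b n, b - b * q n ∈ K₀ := fun b n =>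
    ⟨n, by rw [sub_mul, mul_assoc, hq n n le_rfl, sub_self]; exact J.zero_mem⟩
  -- Since a − a q_0 ∈ K₀ for all a, a left ideal containing K₀ and q_0 is everything. Thus a
  -- maximal member K of T has no proper left ideal above it, and L/K is the desired simple module.
  let T : Set (AddSubgroup L) := {K | K₀ ≤ K ∧ (∀ b, ∀ k ∈ K, b * k ∈ K) ∧ q 0 ∉ K}
  have hK₀T : K₀ ∈ T := by
    refine ⟨le_rfl, ?_, ?_⟩
    · rintro b k ⟨n, hn⟩
      exact ⟨n, by rw [mul_assoc]; exact J.mul_mem_left _ _ hn⟩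
    · rintro ⟨n, hn⟩
      rw [hq 0 n n.zero_le] at hn
      exact hqJ n hn
  obtain ⟨K, -, ⟨⟨hK₀K, hleft, hqK⟩, hmax⟩⟩ := zorn_le_nonempty₀ T (by
    intro C hC hchain K hK
    refine ⟨sSup C, ⟨(hC hK).1.trans (le_sSup hK), ?_, ?_⟩, fun _ => le_sSup⟩
    · intro b k hk
      obtain ⟨K', hK', hk'⟩ := (AddSubgroup.mem_sSup_of_directedOn ⟨K, hK⟩ hchain.directedOn).1 hk
      exact le_sSup hK' ((hC hK').2.1 b k hk')
    · intro hmem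
      obtain ⟨K', hK', hk'⟩ :=
        (AddSubgroup.mem_sSup_of_directedOn ⟨K, hK⟩ hchain.directedOn).1 hmem
      exact (hC hK').2.2 hk') K₀ hK₀T
  let ρ : L →ₙ+* AddMonoid.End (L ⧸ K) :=
    { toFun := fun b => QuotientAddGroup.map K K (AddMonoidHom.mulLeft b) (hleft b)
      map_mul' := fun a b => by
        refine AddMonoidHom.ext fun c => QuotientAddGroup.induction_on c fun c => ?_
        exact congrArg (QuotientAddGroup.mk (s := K)) (mul_assoc a b c)
      map_zero' := by
        refine AddMonoidHom.ext fun c => QuotientAddGroup.induction_on c fun c => ?_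
        exact congrArg (QuotientAddGroup.mk (s := K)) (zero_mul c)
      map_add' := fun a b => by
        refine AddMonoidHom.ext fun c => QuotientAddGroup.induction_on c fun c => ?_
        exact congrArg (QuotientAddGroup.mk (s := K)) (add_mul a b c) }
  have hρ : ∀ a b : L, ρ a (b : L ⧸ K) = ((a * b : L) : L ⧸ K) := fun _ _ => rfl
  have hmk : ∀ a : L, (a : L ⧸ K) = 0 ↔ a ∈ K := fun a => QuotientAddGroup.eq_zero_iff a
  have hJK : ∀ a ∈ J, a ∈ K := fun a ha => hK₀K ⟨0, J.mul_mem_right _ _ ha⟩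
  have hann : ∀ a, ρ a = 0 ↔ ∀ b, a * b ∈ K := by
    intro a
    constructor
    · intro h b
      rw [← hmk, ← hρ, h]; rfl
    · intro h
      exact AddMonoidHom.ext fun b => QuotientAddGroup.induction_on b fun b => (hmk _).2 (h b)
  refine (isLeftPrimitiveIdeal_iff J).2 ⟨L ⧸ K, inferInstance, ρ, ?_, ?_, ?_⟩
  · have hle : J ≤ TwoSidedIdeal.ker ρ := fun a ha =>
      (TwoSidedIdeal.mem_ker _).2 ((hann a).2 fun b => hJK _ (J.mul_mem_right _ _ ha))
    -- A larger annihilator would contain some q_n, so q_n = q_n q_n ∈ K. Together with q_0 − q_0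
    -- q_n = q_0 − q_n ∈ K this puts q_0 into K.
    have heq : J = TwoSidedIdeal.ker ρ := by
      by_contra hne
      obtain ⟨n, hn⟩ := hJ _ (lt_of_le_of_ne hle hne)
      have h1 : q n * q n ∈ K := (hann _).1 ((TwoSidedIdeal.mem_ker _).1 hn) _
      rw [hq n n le_rfl] at h1
      have h2 := hK₀K (hK₀ (q 0) n)
      rw [hq 0 n n.zero_le] at h2
      exact hqK (by simpa using add_mem h2 h1)
    intro a
    rw [heq, TwoSidedIdeal.mem_ker]
  · refine ⟨q 0, (q 0 : L), ?_⟩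
    rw [hρ, hq 0 0 le_rfl, Ne, hmk]
    exact hqK
  · intro N' hN'
    by_cases hbot : N' = ⊥
    · exact Or.inl hbot
    right
    let K' : AddSubgroup L := N'.comap (QuotientAddGroup.mk' K)
    have hKK' : K ≤ K' := fun a ha => by
      have : QuotientAddGroup.mk' K a = 0 := (hmk a).2 ha
      simp only [K', AddSubgroup.mem_comap, this, zero_mem]
    have hK'left : ∀ b, ∀ k ∈ K', b * k ∈ K' := fun b k hk => hN' b _ hk
    have hqK' : q 0 ∈ K' := by
      by_contra hq'
      have hK'K := hmax (⟨hK₀K.trans hKK', hK'left, hq'⟩ : K' ∈ T) hKK'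
      apply hbot
      rw [eq_bot_iff]
      intro z hz
      obtain ⟨a, rfl⟩ := QuotientAddGroup.mk_surjective z
      exact (hmk a).2 (hK'K hz)
    rw [eq_top_iff]
    intro z _
    obtain ⟨a, rfl⟩ := QuotientAddGroup.mk_surjective z
    have h1 : a - a * q 0 ∈ K' := hKK' (hK₀K (hK₀ a 0))
    have h2 := add_mem h1 (hK'left a _ hqK')
    rw [sub_add_cancel] at h2
    exact h2

namespace IsSimpleAction

variable {N : Type*} [AddCommGroup N] {ρ : L →ₙ+* AddMonoid.End N}

/-- L m is a submodule, but without a unit it might vanish although m ≠ 0. Then the elements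
annihilated by L would form a nonzero submodule, hence all of N, contrary to L N ≠ 0. -/
theorem exists_apply_eq (hρ : IsSimpleAction ρ) {m : N} (hm : m ≠ 0) (n : N) :
    ∃ z, ρ z m = n := by
  obtain ⟨⟨b, k, hbk⟩, hsub⟩ := hρ
  let N₁ : AddSubgroup N :=
    (⟨⟨fun z => ρ z m, by simp⟩, fun _ _ => action_add _ _ _ _⟩ : L →+ N).range
  rcases hsub N₁ (by
    rintro b _ ⟨z, rfl⟩
    exact ⟨b * z, action_mul _ _ _ _⟩) with h | h
  · let N₂ : AddSubgroup N :=
      { carrier := {k | ∀ z, ρ z k = 0}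
        zero_mem' := fun z => map_zero _
        add_mem' := fun h1 h2 z => by rw [map_add, h1, h2, add_zero]
        neg_mem' := fun h1 z => by rw [map_neg, h1, neg_zero] }
    have hm2 : m ∈ N₂ := by
      intro z
      have hz : ρ z m ∈ N₁ := ⟨z, rfl⟩
      rw [h] at hz
      exact hz
    rcases hsub N₂ (by
      intro b n hn z
      have := hn (z * b)
      rwa [map_mul] at this) with h2 | h2
    · rw [h2] at hm2
      exact absurd hm2 hm
    · have hk : k ∈ N₂ := by rw [h2]; trivial
      exact absurd (hk b) hbk
  · have hn : n ∈ N₁ := by rw [h]; trivial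
    exact hn

variable {I : TwoSidedIdeal L}

/-- Primitive ideals are prime. -/
theorem exists_mul_mul_notMem (hρ : IsSimpleAction ρ) (hker : ∀ a, ρ a = 0 ↔ a ∈ I) {a b : L}
    (ha : a ∉ I) (hb : b ∉ I) : ∃ z, a * z * b ∉ I := by
  rw [← hker, DFunLike.ext_iff, not_forall] at ha hb
  obtain ⟨n, hn⟩ := hb
  obtain ⟨n', hn'⟩ := ha
  obtain ⟨z, hz⟩ := hρ.exists_apply_eq hn n'
  refine ⟨z, fun h => hn' ?_⟩
  rw [← hker] at h
  rw [← hz]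
  simpa using DFunLike.congr_fun h n

/-- In a commutative corner of the quotient by a primitive ideal, nonzero elements are
invertible. -/
theorem exists_corner_inverse (hρ : IsSimpleAction ρ) (hker : ∀ a, ρ a = 0 ↔ a ∈ I) {e d : L}
    (he : e * e = e) (hed : e * d = d) (hde : d * e = d)
    (hcomm : ∀ z z', e * z * e * (e * z' * e) - e * z' * e * (e * z * e) ∈ I) (hd : d ∉ I) :
    ∃ z, e * z * e * d - e ∈ I := by
  rw [← hker, DFunLike.ext_iff, not_forall] at hd
  obtain ⟨n, hn⟩ := hd
  obtain ⟨z, hz⟩ := hρ.exists_apply_eq hn (ρ e n)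
  have hm : ρ e n ≠ 0 := by
    intro h0
    apply hn
    rw [← hde, map_mul]
    simp [h0]
  refine ⟨z, (hker _).1 ?_⟩
  -- With z chosen so that z d n = e n, the element w = e z e d − e kills e n. It lies in the
  -- commutative corner and satisfies w e = w, so w z' e n = w (e z' e) e n = (e z' e) w e n = 0 for
  -- every z'. As e n generates the module, w acts as zero.
  have hw : ρ (e * z * e * d - e) (ρ e n) = 0 := by
    have h1 : (e * z * e * d - e) * e = e * z * d - e := by
      simp only [sub_mul, mul_assoc, hde, he, hed]
    rw [← action_mul, h1, action_sub, mul_assoc, action_mul, action_mul, hz, ← action_mul, he,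
      sub_self]
  ext k
  obtain ⟨z', rfl⟩ := hρ.exists_apply_eq hm k
  have h2 := (hker _).2 (hcomm (z * e * d - e) z')
  have h3 : e * (z * e * d - e) * e = e * z * e * d - e := by
    simp only [mul_sub, sub_mul, mul_assoc, hde, he]
  rw [h3, map_sub, sub_eq_zero] at h2
  have h4 : ρ ((e * z * e * d - e) * (e * z' * e)) (ρ e n) = 0 := by
    rw [h2, action_mul, hw, map_zero]
  have h5 : (e * z * e * d - e) * e = e * z * e * d - e := by
    simp only [sub_mul, mul_assoc, hde, he]
  have h6 : (e * z * e * d - e) * (e * z' * e) * e = (e * z * e * d - e) * z' * e := by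
    rw [← mul_assoc, ← mul_assoc, h5, mul_assoc, he]
  have h7 : ρ ((e * z * e * d - e) * (e * z' * e) * e) n = 0 := by
    rw [action_mul]; exact h4
  rw [h6, action_mul, action_mul] at h7
  exact h7

end IsSimpleAction

end Primitive

/-! ### The involution -/

section Involution

open MulOpposite

variable (R : Type w) [CommRing R] {V : Type u} {A : Type v} (E : DirectedGraph V A)

/-- The relations are unchanged when edges and ghost edges are exchanged and products reversed. -/
theorem isLeavittFamily_op :
    IsLeavittFamily E (fun v => op (vert R E v)) (fun e => op (ghost R E e))
      (fun e => op (edge R E e)) := by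
  have h := isLeavittFamily R E
  constructor
  · intro v; rw [← op_mul, h.idem]
  · intro v w hvw; rw [← op_mul, h.orth w v hvw.symm, op_zero]
  · intro e; rw [← op_mul, h.mul_source]
  · intro e; rw [← op_mul, h.range_mul]
  · intro e; rw [← op_mul, h.mul_range]
  · intro e; rw [← op_mul, h.source_mul]
  · intro e; rw [← op_mul, h.star_mul_self]
  · intro e f hef; rw [← op_mul, h.star_mul_ne f e hef.symm, op_zero]
  · intro v hf hn
    simp_rw [← op_mul]
    rw [← Finset.op_sum, ← h.sum_eq v hf hn]

/-- The involution as a homomorphism into the opposite algebra. -/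
noncomputable def starHom : LeavittAlgebra R E →ₙₐ[R] (LeavittAlgebra R E)ᵐᵒᵖ :=
  (existsUnique_lift R E (isLeavittFamily_op R E)).choose

/-- The involution `α β^* ↦ β α^*` of the Leavitt path algebra. -/
noncomputable def starMap : LeavittAlgebra R E →ₗ[R] LeavittAlgebra R E where
  toFun a := unop (starHom R E a)
  map_add' a b := by simp
  map_smul' t a := by simp

theorem starMap_vert (v : V) : starMap R E (vert R E v) = vert R E v :=
  congrArg unop ((existsUnique_lift R E (isLeavittFamily_op R E)).choose_spec.1.1 v)

theorem starMap_edge (e : A) : starMap R E (edge R E e) = ghost R E e :=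
  congrArg unop ((existsUnique_lift R E (isLeavittFamily_op R E)).choose_spec.1.2.1 e)

theorem starMap_ghost (e : A) : starMap R E (ghost R E e) = edge R E e :=
  congrArg unop ((existsUnique_lift R E (isLeavittFamily_op R E)).choose_spec.1.2.2 e)

variable {R E}

theorem starMap_mul (a b : LeavittAlgebra R E) :
    starMap R E (a * b) = starMap R E b * starMap R E a :=
  congrArg unop (map_mul (starHom R E) a b)

theorem starMap_pathElt (v : V) (l : List A) :
    starMap R E (pathElt R E v l) = ghostElt R E v l := by
  induction l using List.reverseRecOn with
  | nil => exact starMap_vert R E v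
  | append_singleton l e ih =>
    have h1 : pathElt R E v (l ++ [e]) = pathElt R E v l * edge R E e := by simp [pathElt]
    have h2 : ghostElt R E v (l ++ [e]) = ghost R E e * ghostElt R E v l := by simp [ghostElt]
    rw [h1, h2, starMap_mul, ih, starMap_edge]

theorem starMap_ghostElt (v : V) (l : List A) :
    starMap R E (ghostElt R E v l) = pathElt R E v l := by
  induction l using List.reverseRecOn with
  | nil => exact starMap_vert R E v
  | append_singleton l e ih =>
    have h1 : pathElt R E v (l ++ [e]) = pathElt R E v l * edge R E e := by simp [pathElt]
    have h2 : ghostElt R E v (l ++ [e]) = ghost R E e * ghostElt R E v l := by simp [ghostElt]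
    rw [h1, h2, starMap_mul, ih, starMap_ghost]

theorem starMap_starMap (a : LeavittAlgebra R E) : starMap R E (starMap R E a) = a := by
  induction mem_pathSpan R E a using Submodule.span_induction with
  | mem a ha =>
    obtain ⟨v, l, w, m, z, -, -, rfl⟩ := ha
    change starMap R E (starMap R E (pathElt R E v l * ghostElt R E w m)) = _
    rw [starMap_mul, starMap_pathElt, starMap_ghostElt, starMap_mul, starMap_pathElt,
      starMap_ghostElt]
    rfl
  | zero => rw [map_zero, map_zero]
  | add a b _ _ ha hb => rw [map_add, map_add, ha, hb]
  | smul t a _ ha => rw [map_smul, map_smul, ha]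

theorem starMap_mem_component {k : ℤ} {a : LeavittAlgebra R E} (ha : a ∈ component R E k) :
    starMap R E a ∈ component R E (-k) := by
  induction ha using Submodule.span_induction with
  | mem a ha =>
    obtain ⟨v, l, v', w, m, w', hl, hm, rfl, rfl⟩ := ha
    rw [starMap_mul, starMap_pathElt, starMap_ghostElt, neg_sub]
    exact pathElt_mul_ghostElt_mem hm hl
  | zero => rw [map_zero]; exact zero_mem _
  | add a b _ _ ha hb => rw [map_add]; exact add_mem ha hb
  | smul t a _ ha => rw [map_smul]; exact Submodule.smul_mem _ _ ha

theorem degPart_starMap (k : ℤ) (a : LeavittAlgebra R E) :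
    degPart R E k (starMap R E a) = starMap R E (degPart R E (-k) a) := by
  induction a using homogeneous_induction with
  | hom j a ha =>
    by_cases h : -k = j
    · have hk : k = -j := by omega
      rw [h, degPart_of_mem ha, hk, degPart_of_mem (starMap_mem_component ha)]
    · rw [degPart_of_mem_ne h ha, map_zero, degPart_of_mem_ne _ (starMap_mem_component ha)]
      omega
  | add a b ha hb => rw [map_add, map_add, map_add, map_add, ha, hb]

/-- The image of an ideal under the involution. -/
noncomputable def starIdeal (I : TwoSidedIdeal (LeavittAlgebra R E)) :
    TwoSidedIdeal (LeavittAlgebra R E) :=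
  TwoSidedIdeal.mk' {a | starMap R E a ∈ I}
    (by simp [I.zero_mem])
    (fun ha hb => by simpa using I.add_mem ha hb)
    (fun ha => by simpa using I.neg_mem ha)
    (fun hb => by simpa [starMap_mul] using I.mul_mem_right _ _ hb)
    (fun ha => by simpa [starMap_mul] using I.mul_mem_left _ _ ha)

theorem mem_starIdeal {I : TwoSidedIdeal (LeavittAlgebra R E)} {a : LeavittAlgebra R E} :
    a ∈ starIdeal I ↔ starMap R E a ∈ I := by
  simp [starIdeal]

theorem starIdeal_starIdeal (I : TwoSidedIdeal (LeavittAlgebra R E)) :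
    starIdeal (starIdeal I) = I := by
  ext a
  rw [mem_starIdeal, mem_starIdeal, starMap_starMap]

theorem IsGradedIdeal.starIdeal {I : TwoSidedIdeal (LeavittAlgebra R E)}
    (hI : IsGradedIdeal R E I) : IsGradedIdeal R E (starIdeal I) := by
  rw [isGradedIdeal_iff] at hI ⊢
  intro a ha k
  rw [mem_starIdeal] at ha ⊢
  have := hI _ ha (-k)
  rwa [degPart_starMap, neg_neg] at this

/-- The involution identifies the opposite ring of L/I with L/I^*. -/
theorem isRightPrimitiveIdeal_iff (I : TwoSidedIdeal (LeavittAlgebra R E)) :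
    IsRightPrimitiveIdeal I ↔ IsLeftPrimitiveIdeal (starIdeal I) := by
  let f : LeavittAlgebra R E →ₙ+* (I.ringCon.Quotient)ᵐᵒᵖ :=
    { toFun := fun a => op (toQuot I (starMap R E a))
      map_mul' := fun a b => by rw [starMap_mul, map_mul, op_mul]
      map_zero' := by simp
      map_add' := fun a b => by simp }
  have hf : Function.Surjective f := by
    intro b
    obtain ⟨a, ha⟩ := toQuot_surjective I (unop b)
    refine ⟨starMap R E a, ?_⟩
    change op (toQuot I (starMap R E (starMap R E a))) = b
    rw [starMap_starMap, ha, op_unop]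
  have hker : ∀ a, f a = 0 ↔ a ∈ LPA.starIdeal I := by
    intro a
    rw [mem_starIdeal, ← toQuot_eq_zero I]
    exact op_eq_zero_iff _
  rw [isLeftPrimitiveIdeal_iff, IsRightPrimitiveIdeal, IsRightPrimitiveRing,
    isLeftPrimitiveRing_iff f hf]
  simp only [hker]

theorem starMap_gap {H : Set V} {v : V} (hfin : {e | E.s e = v ∧ E.r e ∉ H}.Finite) :
    starMap R E (gap R E H v) = gap R E H v := by
  rw [gap_eq_sum hfin, map_sub, starMap_vert, map_sum]
  simp_rw [starMap_mul, starMap_edge, starMap_ghost]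

/-- The generators are fixed by the involution, so the ideal is contained in its image. Applying the
involution again gives equality. -/
theorem starIdeal_pairIdeal {H S : Set V} (hS : S ⊆ E.breakingSet H) :
    starIdeal (pairIdeal R E H S) = pairIdeal R E H S := by
  have hle : pairIdeal R E H S ≤ starIdeal (pairIdeal R E H S) := by
    refine TwoSidedIdeal.span_le.2 ?_
    rintro _ (⟨v, hv, rfl⟩ | ⟨v, hv, rfl⟩)
    · refine mem_starIdeal.2 ?_
      rw [starMap_vert]
      exact TwoSidedIdeal.subset_span (Or.inl ⟨v, hv, rfl⟩)
    · refine mem_starIdeal.2 ?_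
      rw [starMap_gap (hS hv).2.2.2]
      exact TwoSidedIdeal.subset_span (Or.inr ⟨v, hv, rfl⟩)
  refine le_antisymm (fun a ha => ?_) hle
  have := hle (mem_starIdeal.1 ha)
  rwa [mem_starIdeal, starMap_starMap] at this

theorem starIdeal_of_mem_listedIdeals {I : TwoSidedIdeal (LeavittAlgebra R E)}
    (hI : I ∈ listedIdeals R E) : starIdeal I = I := by
  rcases hI with ⟨M, -, rfl⟩ | ⟨v, -, rfl⟩
  · exact starIdeal_pairIdeal subset_rfl
  · exact starIdeal_pairIdeal Set.sdiff_subset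

end Involution

/-! ### Ideals containing `I(H, S)` -/

section Uniqueness

variable {R : Type w} [Field R] {V : Type u} {A : Type v} {E : DirectedGraph V A}

namespace IsLeavittFamily

variable {B : Type*} [NonUnitalRing B] {p : V → B} {x y : A → B}

theorem sub_sum_idem (h : IsLeavittFamily E p x y) {a : V} {F : Finset A}
    (hF : ∀ e ∈ F, E.s e = a) :
    (p a - ∑ e ∈ F, x e * y e) * (p a - ∑ e ∈ F, x e * y e) = p a - ∑ e ∈ F, x e * y e := by
  have h1 : (p a - ∑ e ∈ F, x e * y e) * p a = p a - ∑ e ∈ F, x e * y e := by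
    rw [sub_mul, h.idem, Finset.sum_mul]
    congr 1
    refine Finset.sum_congr rfl fun e he => ?_
    rw [mul_assoc, ← hF e he, h.mul_source]
  have h2 : (p a - ∑ e ∈ F, x e * y e) * ∑ e ∈ F, x e * y e = 0 := by
    rw [Finset.mul_sum]
    refine Finset.sum_eq_zero fun e he => ?_
    rw [← mul_assoc, sub_mul, ← hF e he, h.source_mul, Finset.sum_mul, Finset.sum_eq_single e,
      mul_assoc, h.star_mul_self, h.mul_range, sub_self, zero_mul]
    · intro f _ hfe
      rw [mul_assoc, h.star_mul_ne _ _ hfe, mul_zero]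
    · exact fun h => absurd he h
  rw [mul_sub, h1, h2, sub_zero]

end IsLeavittFamily

theorem gap_mul_gap {H : Set V} {v : V} (hfin : {e | E.s e = v ∧ E.r e ∉ H}.Finite) :
    gap R E H v * gap R E H v = gap R E H v := by
  rw [gap_eq_sum hfin]
  refine (isLeavittFamily R E).sub_sum_idem fun e he => ?_
  simp at he
  exact he.1

theorem vert_mul_gap {H : Set V} {v : V} (hfin : {e | E.s e = v ∧ E.r e ∉ H}.Finite) :
    vert R E v * gap R E H v = gap R E H v := by
  have h := isLeavittFamily R E
  rw [gap_eq_sum hfin, mul_sub, h.idem, Finset.mul_sum]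
  congr 1
  refine Finset.sum_congr rfl fun e he => ?_
  have he' : E.s e = v := by simp at he; exact he.1
  rw [← mul_assoc, ← he', h.source_mul]

theorem gap_mul_vert {H : Set V} {v : V} (hfin : {e | E.s e = v ∧ E.r e ∉ H}.Finite) :
    gap R E H v * vert R E v = gap R E H v := by
  have h := isLeavittFamily R E
  rw [gap_eq_sum hfin, sub_mul, h.idem, Finset.sum_mul]
  congr 1
  refine Finset.sum_congr rfl fun e he => ?_
  have he' : E.s e = v := by simp at he; exact he.1
  rw [mul_assoc, ← he', h.mul_source]

theorem mem_of_smul_mem {I : TwoSidedIdeal (LeavittAlgebra R E)} {k : R} (hk : k ≠ 0)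
    {a : LeavittAlgebra R E} (ha : k • a ∈ I) : a ∈ I := by
  have := smul_mem_ideal I k⁻¹ ha
  rwa [smul_smul, inv_mul_cancel₀ hk, one_smul] at this

theorem vert_mem_of_reaches {I : TwoSidedIdeal (LeavittAlgebra R E)} {v w : V}
    (hvw : E.Reaches v w) (hv : vert R E v ∈ I) : vert R E w ∈ I := by
  have h := isLeavittFamily R E
  obtain ⟨l, hl⟩ := hvw
  rw [← h.ghostOf_mul_pathOf hl, ← h.p_mul_pathOf, ← mul_assoc]
  exact I.mul_mem_right _ _ (I.mul_mem_left _ _ hv)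

theorem edge_mem {I : TwoSidedIdeal (LeavittAlgebra R E)} {e : A} (he : vert R E (E.r e) ∈ I) :
    edge R E e ∈ I := by
  rw [← (isLeavittFamily R E).mul_range]
  exact I.mul_mem_left _ _ he

theorem ghost_mem {I : TwoSidedIdeal (LeavittAlgebra R E)} {e : A} (he : vert R E (E.r e) ∈ I) :
    ghost R E e ∈ I := by
  rw [← (isLeavittFamily R E).range_mul]
  exact I.mul_mem_right _ _ he

variable {H S : Set V}

theorem vert_mem_pairIdeal {v : V} (hv : v ∈ H) : vert R E v ∈ pairIdeal R E H S :=
  TwoSidedIdeal.subset_span (Or.inl ⟨v, hv, rfl⟩)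

theorem gap_mem_pairIdeal {v : V} (hv : v ∈ S) : gap R E H v ∈ pairIdeal R E H S :=
  TwoSidedIdeal.subset_span (Or.inr ⟨v, hv, rfl⟩)

/-- A vertex `v` with `v^H ∉ I(H, S)` is a breaking vertex for `H` outside of `S`, or emits no edges
to the complement of `H`. -/
theorem mem_breakingSet_of_gap_notMem (hher : ∀ e, E.s e ∈ H → E.r e ∈ H) {v : V}
    (hfin : {e | E.s e = v ∧ E.r e ∉ H}.Finite) (hv : gap R E H v ∉ pairIdeal R E H S) :
    v ∉ H ∧ ({e | E.s e = v ∧ E.r e ∉ H} = ∅ ∧ gap R E H v = vert R E v ∨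
      v ∈ E.breakingSet H \ S) := by
  have hempty : {e | E.s e = v ∧ E.r e ∉ H} = ∅ → gap R E H v = vert R E v := by
    intro h0
    rw [gap, h0]
    simp
  have hvH : v ∉ H := by
    intro hvH
    apply hv
    rw [hempty]
    · exact vert_mem_pairIdeal hvH
    · rw [Set.eq_empty_iff_forall_notMem]
      rintro e ⟨rfl, he⟩
      exact he (hher e hvH)
  refine ⟨hvH, ?_⟩
  by_cases hne : {e | E.s e = v ∧ E.r e ∉ H}.Nonempty
  · refine Or.inr ⟨⟨hvH, ?_, hne, hfin⟩, fun hvS => hv (gap_mem_pairIdeal hvS)⟩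
    -- At a finite emitter v = ∑ e e^*, so v^H would be the sum of the e e^* with r(e) ∈ H, which
    -- lies in the ideal.
    intro hout
    apply hv
    classical
    have hsub : hfin.toFinset ⊆ hout.toFinset := by
      intro e he
      simp at he
      simpa [DirectedGraph.out] using he.1
    have hne' : (E.out v).Nonempty := hne.mono fun e he => he.1
    rw [gap_eq_sum hfin, (isLeavittFamily R E).sum_eq v hout hne', ← Finset.sum_sdiff hsub,
      add_sub_cancel_right]
    refine sum_mem fun e he => ?_
    have hmem : E.s e = v ∧ (E.s e = v → E.r e ∈ H) := by
      simpa [DirectedGraph.out] using he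
    exact TwoSidedIdeal.mul_mem_left _ _ _ (ghost_mem (vert_mem_pairIdeal (hmem.2 hmem.1)))
  · rw [Set.not_nonempty_iff_eq_empty] at hne
    exact Or.inl ⟨hne, hempty hne⟩

theorem toQuot_vert_ne_zero (hv : ∀ v, vert R E v ∈ pairIdeal R E H S → v ∈ H) (v : V) :
    (toQuot (pairIdeal R E H S) ∘ vert R E) v ≠ 0 ↔ v ∉ H := by
  rw [Function.comp, Ne, toQuot_eq_zero, not_iff_not]
  exact ⟨hv v, vert_mem_pairIdeal⟩

theorem setOf_toQuot_vert_ne_zero (hv : ∀ v, vert R E v ∈ pairIdeal R E H S → v ∈ H) (v : V) :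
    {e | E.s e = v ∧ (toQuot (pairIdeal R E H S) ∘ vert R E) (E.r e) ≠ 0} =
      {e | E.s e = v ∧ E.r e ∉ H} :=
  Set.ext fun _ => and_congr_right fun _ => toQuot_vert_ne_zero hv _

theorem toQuot_gap (hv : ∀ v, vert R E v ∈ pairIdeal R E H S → v ∈ H) {v : V}
    (hfin : {e | E.s e = v ∧ E.r e ∉ H}.Finite) :
    toQuot (pairIdeal R E H S) (gap R E H v) =
      (isLeavittFamily_toQuot (pairIdeal R E H S)).defect v := by
  rw [IsLeavittFamily.defect, setOf_toQuot_vert_ne_zero hv, finsum_mem_eq_finite_toFinset_sum _ hfin, gap_eq_sum hfin, map_sub, map_sum]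
  simp_rw [map_mul]
  rfl

/-- An ideal properly containing `I(H, S)` contains a further element `v^H` or the image of a
polynomial in closed paths with nonzero constant term. -/
theorem exists_mem_of_lt (hher : ∀ e, E.s e ∈ H → E.r e ∈ H)
    (hv : ∀ v, vert R E v ∈ pairIdeal R E H S → v ∈ H) {P : TwoSidedIdeal (LeavittAlgebra R E)}
    (hP : pairIdeal R E H S < P) :
    (∃ v ∈ E.breakingSet H \ S, gap R E H v ∈ P) ∨
      ∃ v ∉ H, ∃ k : R, k ≠ 0 ∧ ∃ n g, ClosedSum R E (toQuot (pairIdeal R E H S) ∘ vert R E)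
        (toQuot (pairIdeal R E H S) ∘ edge R E) v n g ∧ ∃ z ∈ P,
          toQuot (pairIdeal R E H S) z =
            k • (toQuot (pairIdeal R E H S) ∘ vert R E) v + g := by
  set J := pairIdeal R E H S with hJ
  have hB := isLeavittFamily_toQuot J
  obtain ⟨a, haP, haJ⟩ := Set.exists_of_ssubset ((TwoSidedIdeal.lt_iff _ _).1 hP)
  have ha0 : toQuot J a ≠ 0 := fun h => haJ ((toQuot_eq_zero J).1 h)
  obtain ⟨c, d, v, k, hk, hcase⟩ := hB.exists_reduction (mem_pathSpan_toQuot J _) ha0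
  obtain ⟨c, rfl⟩ := toQuot_surjective J c
  obtain ⟨d, rfl⟩ := toQuot_surjective J d
  rw [← map_mul, ← map_mul] at hcase
  have hcad : c * a * d ∈ P := P.mul_mem_right _ _ (P.mul_mem_left _ _ haP)
  rcases hcase with ⟨hfin, hdef, heq⟩ | ⟨hpv, n, g, hg, heq⟩
  · replace hfin : {e | E.s e = v ∧ E.r e ∉ H}.Finite := setOf_toQuot_vert_ne_zero hv v ▸ hfin
    rw [← toQuot_gap hv hfin] at hdef heq
    have hgapP : gap R E H v ∈ P := by
      refine mem_of_smul_mem hk ?_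
      rw [← map_smul, ← sub_eq_zero, ← map_sub, toQuot_eq_zero] at heq
      have := P.sub_mem hcad (hP.le heq)
      rwa [sub_sub_cancel] at this
    have hgapJ : gap R E H v ∉ J := fun h => hdef ((toQuot_eq_zero J).2 h)
    obtain ⟨hvH, ⟨-, hgap⟩ | hbr⟩ := mem_breakingSet_of_gap_notMem hher hfin hgapJ
    -- If v has no edge to the complement of H, then v^H is v itself, a constant polynomial in
    -- closed paths.
    · refine Or.inr ⟨v, hvH, 1, one_ne_zero, 0, 0, .zero, gap R E H v, hgapP, ?_⟩
      rw [hgap, one_smul, add_zero]; rfl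
    · exact Or.inl ⟨v, hbr, hgapP⟩
  · exact Or.inr ⟨v, (toQuot_vert_ne_zero hv v).1 hpv, k, hk, n, g, hg, _, hcad, heq⟩

/-- Each closed path is lifted to the same path in L, which has positive degree. The lift therefore
contributes nothing in degree zero. -/
theorem ClosedSum.exists_lift {I : TwoSidedIdeal (LeavittAlgebra R E)} {v : V} {n : ℕ}
    {g : I.ringCon.Quotient}
    (hg : ClosedSum R E (toQuot I ∘ vert R E) (toQuot I ∘ edge R E) v n g) :
    ∃ g', degPart R E 0 g' = 0 ∧ toQuot I g' = g := by
  induction hg with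
  | zero => exact ⟨0, map_zero _, map_zero _⟩
  | add t l n b hl hne _ ih =>
    obtain ⟨g', h0, rfl⟩ := ih
    refine ⟨t • pathElt R E v l + g', ?_, ?_⟩
    · rw [map_add, h0, add_zero, map_smul, degPart_of_mem_ne _ (pathElt_mem hl), smul_zero]
      have : l.length ≠ 0 := by simpa using hne
      omega
    · rw [map_add, map_smul]
      congr 2
      exact map_pathOf _ _ (toQuot I : LeavittAlgebra R E →ₙ+* I.ringCon.Quotient) v l

/-- A graded ideal properly containing `I(H, S)` contains a further vertex or a further
element `v^H`. -/
theorem exists_mem_of_lt_graded (hher : ∀ e, E.s e ∈ H → E.r e ∈ H)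
    (hv : ∀ v, vert R E v ∈ pairIdeal R E H S → v ∈ H) {P : TwoSidedIdeal (LeavittAlgebra R E)}
    (hP : pairIdeal R E H S < P) (hgr : IsGradedIdeal R E P) :
    (∃ v ∈ E.breakingSet H \ S, gap R E H v ∈ P) ∨ ∃ v ∉ H, vert R E v ∈ P := by
  rcases exists_mem_of_lt hher hv hP with h | ⟨v, hvH, k, hk, n, g, hg, z, hz, hzg⟩
  · exact Or.inl h
  · refine Or.inr ⟨v, hvH, mem_of_smul_mem hk ?_⟩
    obtain ⟨g', hg'0, rfl⟩ := hg.exists_lift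
    rw [Function.comp, ← map_smul, ← map_add, ← sub_eq_zero, ← map_sub, toQuot_eq_zero] at hzg
    have h1 := P.sub_mem hz (hP.le hzg)
    rw [sub_sub_cancel] at h1
    -- The lift k v + g' lies in the graded ideal P, and its degree zero part is k v.
    have h2 := (isGradedIdeal_iff P).1 hgr _ h1 0
    rwa [map_add, hg'0, add_zero, map_smul, degPart_of_mem (vert_mem v)] at h2

/-- If closed paths outside of `H` have exits outside of `H`, then an ideal properly containing
`I(H, S)` contains a further vertex or a further element `v^H`. -/
theorem exists_mem_of_lt_conditionL (hher : ∀ e, E.s e ∈ H → E.r e ∈ H)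
    (hv : ∀ v, vert R E v ∈ pairIdeal R E H S → v ∈ H) {P : TwoSidedIdeal (LeavittAlgebra R E)}
    (hP : pairIdeal R E H S < P)
    (hL : ∀ a l, E.IsPath a l a → l ≠ [] → a ∉ H →
      ∃ e ∈ l, ∃ f, E.s f = E.s e ∧ E.r f ∉ H ∧ f ≠ e) :
    (∃ v ∈ E.breakingSet H \ S, gap R E H v ∈ P) ∨ ∃ v ∉ H, vert R E v ∈ P := by
  rcases exists_mem_of_lt hher hv hP with h | ⟨v, hvH, k, hk, n, g, hg, z, hz, hzg⟩
  · exact Or.inl h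
  · right
    have hB := isLeavittFamily_toQuot (pairIdeal R E H S)
    obtain ⟨c, d, b, hb, hcd⟩ := hB.exists_reduction_closedSum (k := k)
      (by simpa only [toQuot_vert_ne_zero hv] using hL) ((toQuot_vert_ne_zero hv v).2 hvH) hg
    obtain ⟨c, rfl⟩ := toQuot_surjective _ c
    obtain ⟨d, rfl⟩ := toQuot_surjective _ d
    refine ⟨b, (toQuot_vert_ne_zero hv b).1 hb, mem_of_smul_mem hk ?_⟩
    rw [← hzg, ← map_mul, ← map_mul, Function.comp, ← map_smul, ← sub_eq_zero, ← map_sub,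
      toQuot_eq_zero] at hcd
    have h1 := P.sub_mem (P.mul_mem_right _ d (P.mul_mem_left c _ hz)) (hP.le hcd)
    rwa [sub_sub_cancel] at h1

end Uniqueness

/-! ### The listed ideals are primitive -/

section Listed

variable {R : Type w} [Field R] {V : Type u} {A : Type v} {E : DirectedGraph V A}

theorem notMem_omega_singleton {v w : V} : w ∉ E.omega {v} ↔ E.Reaches w v := by
  constructor
  · intro h
    by_contra hr
    refine h ⟨?_, ?_⟩
    · rintro rfl
      exact hr (E.reaches_refl w)
    · rintro _ rfl
      exact hr
  · intro h hw
    exact hw.2 v rfl h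

theorem omega_eq_compl {M : Set V} (hM : ∀ v w, w ∈ M → E.Reaches v w → v ∈ M) :
    E.omega M = Mᶜ := by
  ext w
  exact ⟨fun h => h.1, fun h => ⟨h, fun v hv hr => h (hM w v hv hr)⟩⟩

theorem reaches_edge (e : A) : E.Reaches (E.s e) (E.r e) := ⟨[e], E.isPath_singleton e⟩

theorem omega_singleton_hereditary {v : V} (e : A) (he : E.s e ∈ E.omega {v}) :
    E.r e ∈ E.omega {v} := by
  by_contra h
  exact notMem_omega_singleton.2 ((reaches_edge e).trans (notMem_omega_singleton.1 h)) he

/-- A path from w to v of positive length passes through the range of its first edge, which then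
reaches v as well. Length zero would mean w = v, impossible for the infinite emitter v. -/
theorem omega_singleton_saturated {v : V} (hv : (E.out v).Infinite) (w : V)
    (hfin : (E.out w).Finite) (h : ∀ e, E.s e = w → E.r e ∈ E.omega {v}) : w ∈ E.omega {v} := by
  by_contra hw
  obtain ⟨l, hl⟩ := notMem_omega_singleton.1 hw
  cases l with
  | nil => cases hl; exact hv hfin
  | cons e l => exact notMem_omega_singleton.2 ⟨l, hl.2⟩ (h e hl.1)

/-- The ideals attached to breaking vertices are left primitive. -/
theorem isLeftPrimitiveIdeal_breakingVertex [Countable A] {v : V} (hv : v ∈ E.breakingVertices) :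
    IsLeftPrimitiveIdeal
      (pairIdeal R E (E.omega {v}) (E.breakingSet (E.omega {v}) \ {v})) := by
  obtain ⟨hinf, hbr⟩ := hv
  have hher : ∀ e, E.s e ∈ E.omega {v} → E.r e ∈ E.omega {v} := omega_singleton_hereditary
  obtain ⟨hnotv, hnotg⟩ := notMem_pairIdeal (R := R) (S := E.breakingSet (E.omega {v}) \ {v}) hher
    (fun w h1 _ h2 => omega_singleton_saturated hinf w h1 h2) Set.sdiff_subset
  set J := pairIdeal R E (E.omega {v}) (E.breakingSet (E.omega {v}) \ {v}) with hJ
  have hmem : ∀ w, vert R E w ∈ J → w ∈ E.omega {v} := fun w hw => by_contra fun h => hnotv w h hw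
  have hfin := hbr.2.2.2
  -- The only element of B_H missing from S is v, so the single idempotent v^H must lie in every
  -- larger ideal.
  refine isLeftPrimitiveIdeal_of_idempotents (fun _ => gap R E (E.omega {v}) v)
    (fun _ _ _ => gap_mul_gap hfin) (fun _ => hnotg v ⟨hbr, fun h => h.2 rfl⟩) fun P hP => ⟨0, ?_⟩
  rcases exists_mem_of_lt hher hmem hP with ⟨w, hw, hwP⟩ | ⟨w, hw, k, hk, n, g, hg, z, hz, hzg⟩
  · have : w = v := by
      by_contra hne
      exact hw.2 ⟨hw.1, hne⟩
    rwa [this] at hwP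
  -- A path from w to v exists because w ∉ Ω(v). Conjugation by it moves k w + g to v, and
  -- multiplying by v^H on both sides kills the closed paths and leaves k v^H. No exits are needed
  -- here.
  · obtain ⟨l, hl⟩ := notMem_omega_singleton.1 hw
    have hB := isLeavittFamily_toQuot J
    replace hzg : toQuot J z = k • (toQuot J ∘ vert R E) w + g := hzg
    obtain ⟨m, -, hm⟩ := hB.conj_closedSum hl hg
    have hfin' : {e | E.s e = v ∧ (toQuot J ∘ vert R E) (E.r e) ≠ 0}.Finite := by
      rw [setOf_toQuot_vert_ne_zero hmem]; exact hfin
    have hgap : toQuot J (gap R E (E.omega {v}) v) = hB.defect v := toQuot_gap hmem hfin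
    have hgh : toQuot J (ghostElt R E w l) = ghostOf (toQuot J ∘ vert R E) (toQuot J ∘ ghost R E) w l :=
      map_ghostOf _ _ (toQuot J : LeavittAlgebra R E →ₙ+* J.ringCon.Quotient) w l
    have hpa : toQuot J (pathElt R E w l) = pathOf (toQuot J ∘ vert R E) (toQuot J ∘ edge R E) w l :=
      map_pathOf _ _ (toQuot J : LeavittAlgebra R E →ₙ+* J.ringCon.Quotient) w l
    have key : toQuot J (gap R E (E.omega {v}) v * (ghostElt R E w l * z * pathElt R E w l) *
        gap R E (E.omega {v}) v) = toQuot J (k • gap R E (E.omega {v}) v) := by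
      simp only [map_mul, map_smul, hgap, hgh, hpa, hzg]
      rw [mul_add (ghostOf _ _ _ _), add_mul _ _ (pathOf _ _ _ _), mul_smul_comm, smul_mul_assoc,
        hB.ghostOf_mul_p, hB.ghostOf_mul_pathOf hl, mul_add, add_mul, mul_smul_comm,
        smul_mul_assoc, hB.mul_closedSum_eq_zero (fun e he => hB.defect_mul_x hfin' he) hm,
        zero_mul, add_zero, hB.defect_mul_p hfin', hB.defect_mul_defect hfin']
    rw [← sub_eq_zero, ← map_sub, toQuot_eq_zero] at key
    have hzP := P.mul_mem_right _ (gap R E (E.omega {v}) v) (P.mul_mem_left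
      (gap R E (E.omega {v}) v) _ (P.mul_mem_right _ (pathElt R E w l)
        (P.mul_mem_left (ghostElt R E w l) _ hz)))
    have h1 := P.sub_mem hzP (hP.le key)
    rw [sub_sub_cancel] at h1
    exact mem_of_smul_mem hk h1

theorem exists_tailSubgraph_path {M : Set V} (hM : ∀ v w, w ∈ M → E.Reaches v w → v ∈ M)
    {a b : V} {l : List A} (hl : E.IsPath a l b) (hb : b ∈ M) :
    ∃ (ha : a ∈ M) (l' : List {e : A // E.r e ∈ M}), l'.map Subtype.val = l ∧
      (E.tailSubgraph M hM).IsPath ⟨a, ha⟩ l' ⟨b, hb⟩ := by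
  induction l generalizing a with
  | nil => cases hl; exact ⟨hb, [], rfl, rfl⟩
  | cons e l ih =>
    obtain ⟨rfl, hl⟩ := hl
    obtain ⟨hr, l', hl', hp⟩ := ih hl
    exact ⟨hM _ _ hr (reaches_edge e), ⟨e, hr⟩ :: l', by rw [List.map_cons, hl'], rfl, hp⟩

/-- In a graph with Condition (L) every closed path has an exit. -/
theorem DirectedGraph.ConditionL.exists_exit {V : Type*} {A : Type*} {E : DirectedGraph V A}
    (hL : E.ConditionL) {a : V} {l : List A} (hl : E.IsPath a l a) (hne : l ≠ []) :
    E.HasExit l := by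
  induction hn : l.length using Nat.strong_induction_on generalizing l with
  | _ n ih =>
    cases l with
    | nil => exact absurd rfl hne
    | cons e l =>
      obtain ⟨rfl, hl'⟩ := hl
      by_cases hs : ∀ f ∈ l, E.s f ≠ E.s e
      · exact hL e l ⟨⟨rfl, hl'⟩, hs⟩
      · push Not at hs
        -- The path returns to its source before its end; cutting it there gives a shorter closed
        -- path.
        obtain ⟨f, hf, hfe⟩ := hs
        obtain ⟨l₁, l₂, rfl⟩ := List.append_of_mem hf
        obtain ⟨b, hb, hb'⟩ := E.isPath_of_append hl'
        have hbe : E.s e = b := hfe.symm.trans hb'.1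
        rw [← hbe] at hb
        obtain ⟨e', he', h⟩ := ih (e :: l₁).length (by subst hn; simp) (l := e :: l₁) ⟨rfl, hb⟩
          (by simp) rfl
        refine ⟨e', ?_, h⟩
        rw [← List.cons_append]
        exact List.mem_append_left _ he'

/-- A directed countable set of vertices admits a cofinal sequence of initial segments of a path. -/
theorem exists_cofinal_paths [Countable V] {M : Set V} (hM : E.IsMaximalTail M) :
    ∃ (a : V) (L : ℕ → List A) (b : ℕ → V), (∀ n, b n ∈ M ∧ E.IsPath a (L n) (b n)) ∧
      (∀ m n, m ≤ n → L m <+: L n) ∧ ∀ v ∈ M, ∃ n, E.Reaches v (b n) := by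
  obtain ⟨f, hf⟩ := (Set.to_countable M).exists_eq_range hM.nonempty
  have hfM : ∀ n, f n ∈ M := fun n => hf ▸ ⟨n, rfl⟩
  let T := {z : List A × V // z.2 ∈ M ∧ E.IsPath (f 0) z.1 z.2}
  -- By (MT3) the current end vertex and the n-th vertex f n of the tail reach a common vertex of
  -- the tail, to which the path is prolonged.
  have hstep : ∀ (n : ℕ) (z : T), ∃ z' : T, z.1.1 <+: z'.1.1 ∧ E.Reaches (f n) z'.1.2 := by
    rintro n ⟨⟨l, b⟩, hb, hl⟩
    obtain ⟨c, hc, ⟨m, hm⟩, hr⟩ := hM.mt3 b hb (f n) (hfM n)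
    exact ⟨⟨(l ++ m, c), hc, E.isPath_append hl hm⟩, List.prefix_append l m, hr⟩
  choose g hg hr using hstep
  let z : ℕ → T := fun n => Nat.rec ⟨([], f 0), hfM 0, rfl⟩ g n
  refine ⟨f 0, fun n => (z n).1.1, fun n => (z n).1.2, fun n => (z n).2, ?_, ?_⟩
  · intro m n hmn
    induction n, hmn using Nat.le_induction with
    | base => exact List.prefix_rfl
    | succ n _ ih => exact ih.trans (hg n (z n))
  · intro v hv
    rw [hf] at hv
    obtain ⟨n, rfl⟩ := hv
    -- The vertex f n is taken care of in the passage from z n to z (n + 1).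
    exact ⟨n + 1, hr n (z n)⟩

theorem IsMaximalTail_hereditary {M : Set V} (hM : E.IsMaximalTail M) (e : A)
    (he : E.s e ∈ Mᶜ) : E.r e ∈ Mᶜ :=
  fun hr => he (hM.mt1 _ _ hr (reaches_edge e))

/-- The ideals attached to maximal tails with Condition (L) are left primitive. -/
theorem isLeftPrimitiveIdeal_maximalTail [Countable V] [Countable A] {M : Set V}
    (hM : M ∈ E.maximalTailsL) :
    IsLeftPrimitiveIdeal (pairIdeal R E (E.omega M) (E.breakingSet (E.omega M))) := by
  obtain ⟨hM, hL⟩ := hM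
  rw [omega_eq_compl hM.mt1]
  have hher := IsMaximalTail_hereditary hM
  obtain ⟨hnotv, -⟩ := notMem_pairIdeal (R := R) (S := E.breakingSet Mᶜ) hher (by
    intro v hfin hne h hv
    obtain ⟨e, he, heM⟩ := hM.mt2 v hv hne hfin
    exact h e he heM) subset_rfl
  set J := pairIdeal R E Mᶜ (E.breakingSet Mᶜ) with hJ
  have hmem : ∀ w, vert R E w ∈ J → w ∈ Mᶜ := fun w hw => by_contra fun h => hnotv w h hw
  obtain ⟨a, L, b, hb, hmono, hcof⟩ := exists_cofinal_paths hM
  have h := isLeavittFamily R E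
  -- The idempotents are q_n = α_n α_n^* with α_n the n-th initial segment; they decrease because
  -- α_m^* α_n is the rest of α_n after α_m for m ≤ n.
  refine isLeftPrimitiveIdeal_of_idempotents
    (fun n => pathElt R E a (L n) * ghostElt R E a (L n)) ?_ ?_ ?_
  · intro m n hmn
    obtain ⟨l, hl⟩ := hmono m n hmn
    have h1 : ghostElt R E a (L m) * pathElt R E a (L n) = pathElt R E (b m) l := by
      rw [← hl]
      exact h.ghostOf_mul_pathOf_append (hb m).2 l
    have h2 : pathElt R E a (L n) = pathElt R E a (L m) * pathElt R E (b m) l := by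
      rw [← hl]
      exact h.pathOf_append (hb m).2 l
    rw [mul_assoc, ← mul_assoc (ghostElt R E a (L m)), h1, ← mul_assoc, ← h2]
  · intro n hn
    refine hnotv (b n) (fun hc => hc (hb n).1) ?_
    have h1 : ghostElt R E a (L n) * pathElt R E a (L n) = vert R E (b n) :=
      h.ghostOf_mul_pathOf (hb n).2
    have h2 := J.mul_mem_right _ (pathElt R E a (L n)) (J.mul_mem_left (ghostElt R E a (L n)) _ hn)
    rwa [← mul_assoc, h1, mul_assoc, h1, h.idem] at h2
  · intro P hP
    rcases exists_mem_of_lt_conditionL hher hmem hP (by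
      intro c l hl hne hc
      rw [Set.mem_compl_iff, not_not] at hc
      obtain ⟨hcM, l', rfl, hl'⟩ := exists_tailSubgraph_path hM.mt1 hl hc
      obtain ⟨e, he, f, hfs, hfe⟩ := hL.exists_exit hl' (by rintro rfl; exact hne rfl)
      refine ⟨e.1, List.mem_map_of_mem he, f.1, congrArg Subtype.val hfs, fun h => h f.2, ?_⟩
      exact fun h => hfe (Subtype.ext h)) with ⟨v, hv, -⟩ | ⟨v, hv, hvP⟩
    -- With S = B_H there is no further v^H, so the larger ideal contains a vertex of M. That vertex
    -- reaches some b_n, whence b_n and q_n = α_n b_n α_n^* are in the ideal.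
    · exact absurd hv.1 hv.2
    · rw [Set.mem_compl_iff, not_not] at hv
      obtain ⟨n, hn⟩ := hcof v hv
      refine ⟨n, ?_⟩
      have h1 : pathElt R E a (L n) * vert R E (b n) = pathElt R E a (L n) :=
        h.pathOf_mul_p (hb n).2
      rw [← h1]
      exact P.mul_mem_right _ _ (P.mul_mem_left _ _ (vert_mem_of_reaches hn hvP))

end Listed

/-! ### The corner at a cycle without exits -/

section Corner

variable {R : Type w} [CommRing R] {V : Type u} {A : Type v} {E : DirectedGraph V A} {B : Type*}
  [NonUnitalRing B] [Module R B] [IsScalarTower R B B] [SMulCommClass R B B]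
  {p : V → B} {x y : A → B}

/-- A closed path `c` based at `a` on which every edge is the only one with its source among
the edges which do not vanish in the family, and `e e^* = s(e)` for the edges on `c`. -/
structure IsExitlessCycle (E : DirectedGraph V A) (p : V → B) (x y : A → B) (a : V)
    (c : List A) : Prop where
  isPath : E.IsPath a c a
  ne_nil : c ≠ []
  ne_zero : p a ≠ 0
  unique : ∀ e ∈ c, ∀ f, E.s f = E.s e → p (E.r f) ≠ 0 → f = e
  mul_star : ∀ e ∈ c, x e * y e = p (E.s e)

namespace IsExitlessCycle

variable {a : V} {c : List A}

theorem source_mem (hc : IsExitlessCycle E p x y a c) : ∃ e ∈ c, E.s e = a := by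
  have h1 := hc.isPath
  have h2 := hc.ne_nil
  cases c with
  | nil => exact absurd rfl h2
  | cons e l => exact ⟨e, List.mem_cons_self, h1.1⟩

theorem exists_path (hc : IsExitlessCycle E p x y a c) {e : A} (he : e ∈ c) :
    ∃ l, E.IsPath (E.r e) l a ∧ ∀ f ∈ l, f ∈ c := by
  obtain ⟨l₁, l₂, rfl⟩ := List.append_of_mem he
  obtain ⟨b, -, hb⟩ := E.isPath_of_append hc.isPath
  exact ⟨l₂, hb.2, fun f hf => by simp [hf]⟩

theorem range_mem (hc : IsExitlessCycle E p x y a c) {e : A} (he : e ∈ c) :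
    ∃ f ∈ c, E.s f = E.r e := by
  obtain ⟨l, hl, hlc⟩ := hc.exists_path he
  cases l with
  | nil => rw [show E.r e = a from hl]; exact hc.source_mem
  | cons f l => exact ⟨f, hlc f List.mem_cons_self, hl.1⟩

end IsExitlessCycle

namespace IsLeavittFamily

variable {a : V} {c : List A}

theorem p_ne_zero_of_isPath (h : IsLeavittFamily E p x y) {b d : V} {l : List A}
    (hl : E.IsPath b l d) (hd : p d ≠ 0) : p b ≠ 0 := by
  intro h0
  apply hd
  rw [← h.ghostOf_mul_pathOf hl, ← h.p_mul_pathOf, h0, zero_mul, mul_zero]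

/-- All vertices on a path to a nonvanishing vertex are nonvanishing, and from a vertex of the cycle
only the cycle edge has a nonvanishing range. So such a path runs along the cycle and is determined
by its length. -/
theorem eq_of_exitless (h : IsLeavittFamily E p x y) (hc : IsExitlessCycle E p x y a c)
    {b d d' : V} {l l' : List A} (hb : ∃ e ∈ c, E.s e = b) (hl : E.IsPath b l d)
    (hl' : E.IsPath b l' d') (hd : p d ≠ 0) (hd' : p d' ≠ 0) (hlen : l.length = l'.length) :
    l = l' := by
  induction l generalizing b l' with
  | nil => exact (List.eq_nil_of_length_eq_zero hlen.symm).symm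
  | cons f l ih =>
    cases l' with
    | nil => simp at hlen
    | cons f' l' =>
      obtain ⟨e, he, rfl⟩ := hb
      obtain rfl := hc.unique e he f hl.1 (h.p_ne_zero_of_isPath hl.2 hd)
      obtain rfl := hc.unique f he f' hl'.1 (h.p_ne_zero_of_isPath hl'.2 hd')
      rw [ih (hc.range_mem he) hl.2 hl'.2 (by simpa using hlen)]

/-- The path uses only cycle edges, and the products e e^* = s(e) collapse from the inside out. -/
theorem pathOf_mul_ghostOf_exitless (h : IsLeavittFamily E p x y)
    (hc : IsExitlessCycle E p x y a c) {b d : V} {l : List A} (hb : ∃ e ∈ c, E.s e = b)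
    (hl : E.IsPath b l d) (hd : p d ≠ 0) :
    (∃ e ∈ c, E.s e = d) ∧ pathOf p x b l * ghostOf p y b l = p b := by
  induction l generalizing b with
  | nil => cases hl; exact ⟨hb, h.idem _⟩
  | cons f l ih =>
    obtain ⟨e, he, rfl⟩ := hb
    obtain rfl := hc.unique e he f hl.1 (h.p_ne_zero_of_isPath hl.2 hd)
    obtain ⟨h1, h2⟩ := ih (hc.range_mem he) hl.2
    refine ⟨h1, ?_⟩
    rw [h.pathOf_cons, h.ghostOf_cons, mul_assoc, ← mul_assoc (pathOf _ _ _ _), h2, h.range_mul,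
      hc.mul_star f he]

/-- A nonvanishing αβ^* in the corner has its common range d on the cycle. Inserting d = γγ^*, with
γ the way along the cycle back to a, turns α and β into closed paths at a. -/
theorem corner_mem_span (h : IsLeavittFamily E p x y) (hc : IsExitlessCycle E p x y a c) {z : B}
    (hz : z ∈ pathSpan R E p x y) :
    p a * z * p a ∈ Submodule.span R
      {b | ∃ l m, E.IsPath a l a ∧ E.IsPath a m a ∧ b = pathOf p x a l * ghostOf p y a m} := by
  induction hz using Submodule.span_induction with
  | mem z hz =>
    obtain ⟨v, l, w, m, d, hl, hm, rfl⟩ := hz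
    by_cases hv : a = v
    swap
    · rw [← mul_assoc, h.p_mul_pathOf_ne hv, zero_mul, zero_mul]
      exact zero_mem _
    by_cases hw : w = a
    swap
    · rw [mul_assoc, mul_assoc, h.ghostOf_mul_p_ne hw, mul_zero, mul_zero]
      exact zero_mem _
    subst hv hw
    rw [← mul_assoc, h.p_mul_pathOf, mul_assoc, h.ghostOf_mul_p]
    by_cases hd : p d = 0
    · rw [← h.pathOf_mul_p hl, hd, mul_zero, zero_mul]
      exact zero_mem _
    obtain ⟨e, he, rfl⟩ := (h.pathOf_mul_ghostOf_exitless hc hc.source_mem hl hd).1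
    obtain ⟨k, hk, -⟩ := hc.exists_path he
    have hk' : E.IsPath (E.s e) (e :: k) w := ⟨rfl, hk⟩
    have h1 := (h.pathOf_mul_ghostOf_exitless hc ⟨e, he, rfl⟩ hk' hc.ne_zero).2
    refine Submodule.subset_span ⟨l ++ e :: k, m ++ e :: k, E.isPath_append hl hk',
      E.isPath_append hm hk', ?_⟩
    rw [h.pathOf_append hl, h.ghostOf_append hm, mul_assoc, ← mul_assoc (pathOf _ _ (E.s e) _), h1,
      ← mul_assoc, h.pathOf_mul_p hl]
  | zero => rw [mul_zero, zero_mul]; exact zero_mem _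
  | add z z' _ _ hz hz' => rw [mul_add, add_mul]; exact add_mem hz hz'
  | smul t z _ hz => rw [mul_smul_comm, smul_mul_assoc]; exact Submodule.smul_mem _ _ hz

/-- Both concatenations have the same length and therefore coincide. -/
theorem commute_pathOf_exitless (h : IsLeavittFamily E p x y) (hc : IsExitlessCycle E p x y a c)
    {l m : List A} (hl : E.IsPath a l a) (hm : E.IsPath a m a) :
    Commute (pathOf p x a l) (pathOf p x a m) := by
  rw [Commute, SemiconjBy, ← h.pathOf_append hl, ← h.pathOf_append hm,
    h.eq_of_exitless hc hc.source_mem (E.isPath_append hl hm) (E.isPath_append hm hl) hc.ne_zero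
      hc.ne_zero (by simp [Nat.add_comm])]

theorem commute_ghostOf_exitless (h : IsLeavittFamily E p x y) (hc : IsExitlessCycle E p x y a c)
    {l m : List A} (hl : E.IsPath a l a) (hm : E.IsPath a m a) :
    Commute (ghostOf p y a l) (ghostOf p y a m) := by
  rw [Commute, SemiconjBy, ← h.ghostOf_append hl, ← h.ghostOf_append hm,
    h.eq_of_exitless hc hc.source_mem (E.isPath_append hl hm) (E.isPath_append hm hl) hc.ne_zero
      hc.ne_zero (by simp [Nat.add_comm])]

/-- In the corner the ghost path is a two-sided inverse of its path, so it commutes with whatever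
that path commutes with. -/
theorem commute_pathOf_ghostOf_exitless (h : IsLeavittFamily E p x y)
    (hc : IsExitlessCycle E p x y a c) {l m : List A} (hl : E.IsPath a l a)
    (hm : E.IsPath a m a) : Commute (pathOf p x a l) (ghostOf p y a m) := by
  have h1 := (h.pathOf_mul_ghostOf_exitless hc hc.source_mem hm hc.ne_zero).2
  have h2 := h.ghostOf_mul_pathOf hm
  have h3 := h.commute_pathOf_exitless hc hl hm
  symm
  calc ghostOf p y a m * pathOf p x a l
      = ghostOf p y a m * (pathOf p x a l * pathOf p x a m) * ghostOf p y a m := by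
        rw [mul_assoc, mul_assoc, h1, h.pathOf_mul_p hl]
    _ = pathOf p x a l * ghostOf p y a m := by
        rw [h3.eq, ← mul_assoc, h2, h.p_mul_pathOf]

/-- The corner at a cycle without exits is commutative. -/
theorem corner_commute (h : IsLeavittFamily E p x y) (hc : IsExitlessCycle E p x y a c) {z z' : B}
    (hz : z ∈ pathSpan R E p x y) (hz' : z' ∈ pathSpan R E p x y) :
    Commute (p a * z * p a) (p a * z' * p a) := by
  have h1 := h.corner_mem_span hc hz
  have h2 := h.corner_mem_span hc hz'
  generalize p a * z * p a = b at h1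
  generalize p a * z' * p a = b' at h2
  induction h1 using Submodule.span_induction with
  | mem b hb =>
    obtain ⟨l, m, hl, hm, rfl⟩ := hb
    induction h2 using Submodule.span_induction with
    | mem b' hb' =>
      obtain ⟨l', m', hl', hm', rfl⟩ := hb'
      exact ((h.commute_pathOf_exitless hc hl hl').mul_right
        (h.commute_pathOf_ghostOf_exitless hc hl hm')).mul_left
        ((h.commute_pathOf_ghostOf_exitless hc hl' hm).symm.mul_right
        (h.commute_ghostOf_exitless hc hm hm'))
    | zero => exact Commute.zero_right _
    | add b b' _ _ hb hb' => exact hb.add_right hb'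
    | smul t b _ hb => exact hb.smul_right t
  | zero => exact Commute.zero_left _
  | add b b' _ _ hb hb' => exact hb.add_left hb'
  | smul t b _ hb => exact hb.smul_left t

end IsLeavittFamily

end Corner

/-! ### Graded primitive ideals -/

section GradedPrimitive

variable {R : Type w} [Field R] {V : Type u} {A : Type v} {E : DirectedGraph V A}
  {I : TwoSidedIdeal (LeavittAlgebra R E)}

theorem vertexSet_hereditary (e : A) (he : vert R E (E.s e) ∈ I) : vert R E (E.r e) ∈ I :=
  vert_mem_of_reaches (reaches_edge e) he

theorem vertexSet_saturated (v : V) (hfin : (E.out v).Finite) (hne : (E.out v).Nonempty)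
    (h : ∀ e, E.s e = v → vert R E (E.r e) ∈ I) : vert R E v ∈ I := by
  rw [(isLeavittFamily R E).sum_eq v hfin hne]
  refine sum_mem fun e he => ?_
  have : E.s e = v := by simpa [DirectedGraph.out] using he
  exact I.mul_mem_left _ _ (ghost_mem (h e this))

/-- A graded ideal is generated by its vertices and its elements `v^H`. -/
theorem IsGradedIdeal.eq_pairIdeal (hI : IsGradedIdeal R E I) :
    I = pairIdeal R E {v | vert R E v ∈ I}
      {v ∈ E.breakingSet {v | vert R E v ∈ I} | gap R E {v | vert R E v ∈ I} v ∈ I} := by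
  set H := {v | vert R E v ∈ I} with hH
  have hle : pairIdeal R E H {v ∈ E.breakingSet H | gap R E H v ∈ I} ≤ I := by
    refine TwoSidedIdeal.span_le.2 ?_
    rintro _ (⟨v, hv, rfl⟩ | ⟨v, hv, rfl⟩)
    · exact hv
    · exact hv.2
  by_contra hne
  rcases exists_mem_of_lt_graded (R := R) (E := E) (H := H)
    (fun e he => vertexSet_hereditary e he) (fun v hv => hle hv) (lt_of_le_of_ne hle (Ne.symm hne)) hI with ⟨v, hv, hvI⟩ | ⟨v, hv, hvI⟩
  · exact hv.2 ⟨hv.1, hvI⟩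
  · exact hv hvI

/-- Modulo I the edges at v have been subtracted from v, so f^* v − f^* f f^* = 0 if r(f) ∉ H, and
f^* ∈ I otherwise. Hence a product αβ^* v^H can only survive if β has length zero. -/
theorem ghost_mul_gap_mem {v : V} (hfin : {e | E.s e = v ∧ E.r e ∉ {v | vert R E v ∈ I}}.Finite)
    (f : A) : ghost R E f * gap R E {v | vert R E v ∈ I} v ∈ I := by
  have h := isLeavittFamily R E
  by_cases hr : vert R E (E.r f) ∈ I
  · exact I.mul_mem_right _ _ (ghost_mem hr)
  rw [gap_eq_sum hfin]
  by_cases hs : E.s f = v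
  · have hf : f ∈ hfin.toFinset := by simpa using ⟨hs, hr⟩
    rw [mul_sub, Finset.mul_sum, Finset.sum_eq_single_of_mem f hf, ← mul_assoc, h.star_mul_self,
      h.range_mul, ← hs, h.mul_source, sub_self]
    · exact I.zero_mem
    · intro e _ hef
      rw [← mul_assoc, h.star_mul_ne _ _ hef.symm, zero_mul]
  · rw [← gap_eq_sum hfin, ← vert_mul_gap hfin, ← mul_assoc, ← h.mul_source, mul_assoc (ghost R E f),
      h.orth _ _ hs, mul_zero, zero_mul]
    exact I.zero_mem

theorem gap_mul_edge_mem {v : V} (hfin : {e | E.s e = v ∧ E.r e ∉ {v | vert R E v ∈ I}}.Finite)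
    (f : A) : gap R E {v | vert R E v ∈ I} v * edge R E f ∈ I := by
  have h := isLeavittFamily R E
  by_cases hr : vert R E (E.r f) ∈ I
  · exact I.mul_mem_left _ _ (edge_mem hr)
  rw [gap_eq_sum hfin]
  by_cases hs : E.s f = v
  · have hf : f ∈ hfin.toFinset := by simpa using ⟨hs, hr⟩
    rw [sub_mul, Finset.sum_mul, Finset.sum_eq_single_of_mem f hf, mul_assoc, h.star_mul_self,
      h.mul_range, ← hs, h.source_mul, sub_self]
    · exact I.zero_mem
    · intro e _ hef
      rw [mul_assoc, h.star_mul_ne _ _ hef, mul_zero]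
  · rw [← gap_eq_sum hfin, ← gap_mul_vert hfin, ← h.source_mul, mul_assoc, ← mul_assoc (vert R E v),
      h.orth _ _ (Ne.symm hs), zero_mul, mul_zero]
    exact I.zero_mem

/-- In the quotient by a prime ideal any two nonzero elements are linked by paths. -/
theorem exists_path_notMem (hprime : ∀ a b, a ∉ I → b ∉ I → ∃ z, a * z * b ∉ I)
    {a b : LeavittAlgebra R E} (ha : a ∉ I) (hb : b ∉ I) :
    ∃ v l w m d, E.IsPath v l d ∧ E.IsPath w m d ∧
      a * (pathElt R E v l * ghostElt R E w m) * b ∉ I := by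
  by_contra! hcon
  obtain ⟨z, hz⟩ := hprime a b ha hb
  apply hz
  clear hz
  induction mem_pathSpan R E z using Submodule.span_induction with
  | mem z hz =>
    obtain ⟨v, l, w, m, d, hl, hm, rfl⟩ := hz
    exact hcon v l w m d hl hm
  | zero => rw [mul_zero, zero_mul]; exact I.zero_mem
  | add z z' _ _ hz hz' =>
    rw [mul_add, add_mul]
    exact I.add_mem hz hz'
  | smul t z _ hz =>
    rw [mul_smul_comm, smul_mul_assoc]
    exact smul_mem_ideal I t hz

end GradedPrimitive

/-! ### Cycles without exits and the classification of graded primitive ideals -/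

section GradedPrimitive

variable {R : Type w} [Field R] {V : Type u} {A : Type v} {E : DirectedGraph V A}
  {I : TwoSidedIdeal (LeavittAlgebra R E)}

/-- Modulo a graded ideal not containing `v`, an element `v - c` with `c` a cycle such that
`c c^* = v` has no left inverse. -/
theorem IsGradedIdeal.no_inverse (hI : IsGradedIdeal R E I) {v : V} {c : List A}
    (hc : E.IsPath v c v) (hne : c ≠ []) (hv : vert R E v ∉ I)
    (hcc : pathElt R E v c * ghostElt R E v c - vert R E v ∈ I) {b : LeavittAlgebra R E}
    (hb : b * vert R E v = b) (hbc : b * (vert R E v - pathElt R E v c) - vert R E v ∈ I) :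
    False := by
  have h := isLeavittFamily R E
  rw [isGradedIdeal_iff] at hI
  set C := pathElt R E v c with hC
  obtain ⟨n, hn⟩ : ∃ n : ℤ, n = (c.length : ℤ) := ⟨_, rfl⟩
  have hn0 : 0 < n := by
    have : c.length ≠ 0 := by simpa using hne
    omega
  have hCmem : C ∈ component R E n := hn ▸ pathElt_mem hc
  -- The degree k part of b(v − c) ≡ v, where c has degree n. The recursion forces b to be the
  -- infinite series v + c + c² + ⋯ along the multiples of n.
  have hrec : ∀ k, degPart R E k b - degPart R E (k - n) b * C - degPart R E k (vert R E v) ∈ I := by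
    intro k
    have h1 := hI _ hbc k
    rwa [mul_sub, hb, map_sub, map_sub, degPart_mul_right k b hCmem] at h1
  obtain ⟨F, hF⟩ := degPart_eq_zero_of_notMem b
  obtain ⟨N, hN⟩ : ∃ N : ℕ, ∀ k ∈ F, |k| < N := by
    refine ⟨(∑ k ∈ F, k.natAbs) + 1, fun k hk => ?_⟩
    have := Finset.single_le_sum (f := Int.natAbs) (fun _ _ => Nat.zero_le _) hk
    rw [Int.abs_eq_natAbs]
    omega
  have hbig : ∀ k : ℤ, (N : ℤ) ≤ |k| → degPart R E k b = 0 := by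
    intro k hk
    exact hF k fun hkF => absurd (hN k hkF) (not_lt.2 hk)
  -- In degrees at most −N the parts of b are zero, and the recursion carries this, modulo I, up to
  -- all negative degrees.
  have hneg : ∀ m : ℕ, ∀ k : ℤ, k < 0 → k ≤ -N + m → degPart R E k b ∈ I := by
    intro m
    induction m with
    | zero =>
      intro k hk hkN
      rw [hbig k (by rw [abs_of_neg hk]; push_cast at hkN; omega)]
      exact I.zero_mem
    | succ m ih =>
      intro k hk hkN
      have h1 := hrec k
      rw [degPart_of_mem_ne (by omega) (vert_mem v), sub_zero] at h1
      have h2 := I.mul_mem_right _ C (ih (k - n) (by omega) (by push_cast at hkN; omega))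
      simpa using I.add_mem h1 h2
  have hb0 : degPart R E 0 b - vert R E v ∈ I := by
    have h1 := hrec 0
    rw [degPart_of_mem (vert_mem v)] at h1
    have h2 := I.mul_mem_right _ C (hneg N (0 - n) (by omega) (by omega))
    have h3 := I.add_mem h1 h2
    rwa [sub_right_comm, sub_add_cancel] at h3
  -- The part in degree 0 is v modulo I. If the part in degree (j+1)n were in I, so would be b_{jn}
  -- c, and then b_{jn} after multiplication by c^*, as c c^* ≡ v.
  have hpos : ∀ j : ℕ, degPart R E (j * n) b ∉ I := by
    intro j
    induction j with
    | zero =>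
      intro h1
      apply hv
      have h2 := I.sub_mem (by simpa using h1) hb0
      rwa [sub_sub_cancel] at h2
    | succ j ih =>
      intro h1
      apply ih
      have h2 := hrec ((j + 1 : ℕ) * n)
      have h0 : ((j + 1 : ℕ) : ℤ) * n ≠ 0 := by positivity
      have h4 : ((j + 1 : ℕ) : ℤ) * n - n = j * n := by push_cast; ring
      rw [degPart_of_mem_ne h0 (vert_mem v), sub_zero, h4] at h2
      have h5 : degPart R E (j * n) b * C ∈ I := by simpa using I.sub_mem h1 h2
      have h6 : degPart R E (j * n) b * vert R E v = degPart R E (j * n) b := by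
        have := degPart_mul_right (j * n) b (vert_mem (R := R) (E := E) v)
        rwa [hb, sub_zero, eq_comm] at this
      have h7 := I.sub_mem (I.mul_mem_right _ (ghostElt R E v c) h5)
        (I.mul_mem_left (degPart R E (j * n) b) _ hcc)
      rwa [mul_sub, h6, mul_assoc, sub_sub_cancel] at h7
  -- The degree Nn is at least N since n > 0, and there b has no component.
  apply hpos N
  rw [hbig]
  · exact I.zero_mem
  · rw [abs_of_nonneg (by positivity)]
    nlinarith

/-- The graph of a graded primitive ideal has no cycles without exits at which `e e^* = s(e)`. -/
theorem IsGradedIdeal.not_isExitlessCycle (hI : IsGradedIdeal R E I) {N : Type*} [AddCommGroup N]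
    {ρ : LeavittAlgebra R E →ₙ+* AddMonoid.End N} (hρ : IsSimpleAction ρ)
    (hker : ∀ a, ρ a = 0 ↔ a ∈ I) {v : V} {c : List A} :
    ¬ IsExitlessCycle E (toQuot I ∘ vert R E) (toQuot I ∘ edge R E) (toQuot I ∘ ghost R E) v c := by
  intro hc
  have h := isLeavittFamily R E
  have hB := isLeavittFamily_toQuot I
  have hv : vert R E v ∉ I := fun hv => hc.ne_zero ((toQuot_eq_zero I).2 hv)
  have hvc : vert R E v * pathElt R E v c = pathElt R E v c := h.p_mul_pathOf v c
  have hcv : pathElt R E v c * vert R E v = pathElt R E v c := h.pathOf_mul_p hc.isPath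
  have hcc : pathElt R E v c * ghostElt R E v c - vert R E v ∈ I := by
    rw [← toQuot_eq_zero, map_sub, map_mul, sub_eq_zero]
    have h1 := (hB.pathOf_mul_ghostOf_exitless hc hc.source_mem hc.isPath hc.ne_zero).2
    have h2 : toQuot I (pathElt R E v c) = pathOf (toQuot I ∘ vert R E) (toQuot I ∘ edge R E) v c :=
      map_pathOf _ _ (toQuot I : LeavittAlgebra R E →ₙ+* I.ringCon.Quotient) v c
    have h3 : toQuot I (ghostElt R E v c) =
        ghostOf (toQuot I ∘ vert R E) (toQuot I ∘ ghost R E) v c :=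
      map_ghostOf _ _ (toQuot I : LeavittAlgebra R E →ₙ+* I.ringCon.Quotient) v c
    rw [h2, h3, h1]; rfl
  -- The degree zero part of v − c is v, which is not in the graded ideal I.
  have hd : vert R E v - pathElt R E v c ∉ I := by
    intro hmem
    have h1 := (isGradedIdeal_iff I).1 hI _ hmem 0
    rw [map_sub, degPart_of_mem (vert_mem v), degPart_of_mem_ne _ (pathElt_mem hc.isPath),
      sub_zero] at h1
    · exact hv h1
    · have : c.length ≠ 0 := by simpa using hc.ne_nil
      omega
  obtain ⟨z, hz⟩ := hρ.exists_corner_inverse hker (h.idem v)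
    (by rw [mul_sub, h.idem, hvc]) (by rw [sub_mul, h.idem, hcv]) (by
      intro z z'
      rw [← toQuot_eq_zero, map_sub, sub_eq_zero]
      simp only [map_mul]
      exact (hB.corner_commute hc (mem_pathSpan_toQuot I (toQuot I z))
        (mem_pathSpan_toQuot I (toQuot I z'))).eq) hd
  exact hI.no_inverse hc.isPath hc.ne_nil hv hcc (by rw [mul_assoc, h.idem]) hz

/-- Graded left primitive ideals are listed. -/
theorem IsGradedIdeal.mem_listedIdeals (hI : IsGradedIdeal R E I) (hprim : IsLeftPrimitiveIdeal I) :
    I ∈ listedIdeals R E := by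
  obtain ⟨N, _, ρ, hker, hρ⟩ := (isLeftPrimitiveIdeal_iff I).1 hprim
  have h := isLeavittFamily R E
  have hprime : ∀ a b, a ∉ I → b ∉ I → ∃ z, a * z * b ∉ I :=
    fun a b ha hb => hρ.exists_mul_mul_notMem hker ha hb
  set H := {v | vert R E v ∈ I} with hH
  have hup : ∀ v w, w ∈ Hᶜ → E.Reaches v w → v ∈ Hᶜ :=
    fun v w hw hr hv => hw (vert_mem_of_reaches hr hv)
  -- By primeness some v^H αβ^* w^H is not in I. Edges in α or β would put it into I, so both are
  -- vertices, and orthogonality leaves only v = w.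
  have hone : ∀ v ∈ E.breakingSet H, ∀ w ∈ E.breakingSet H, gap R E H v ∉ I → gap R E H w ∉ I →
      v = w := by
    intro v hv w hw hvI hwI
    by_contra hvw
    obtain ⟨a, l, b, m, d, hl, hm, hmem⟩ := exists_path_notMem hprime hvI hwI
    apply hmem
    cases l with
    | cons e l =>
      obtain ⟨rfl, hl⟩ := hl
      have h1 : pathElt R E (E.s e) (e :: l) = edge R E e * pathElt R E (E.r e) l :=
        h.pathOf_cons e l
      have h2 : gap R E H v * (pathElt R E (E.s e) (e :: l) * ghostElt R E b m) * gap R E H w =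
          gap R E H v * edge R E e * (pathElt R E (E.r e) l * ghostElt R E b m * gap R E H w) := by
        rw [h1]; simp only [mul_assoc]
      rw [h2]
      exact I.mul_mem_right _ _ (gap_mul_edge_mem hv.2.2.2 e)
    | nil =>
      obtain rfl : a = d := hl
      cases m with
      | cons e m =>
        obtain ⟨rfl, hm⟩ := hm
        have h1 : ghostElt R E (E.s e) (e :: m) = ghostElt R E (E.r e) m * ghost R E e :=
          h.ghostOf_cons e m
        rw [h1, ← mul_assoc (pathElt _ _ _ _), ← mul_assoc, mul_assoc]
        exact I.mul_mem_left _ _ (ghost_mul_gap_mem hw.2.2.2 e)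
      | nil =>
        obtain rfl : b = a := hm
        change gap R E H v * (vert R E b * vert R E b) * gap R E H w ∈ I
        rw [h.idem]
        by_cases hb : v = b
        · subst hb
          rw [mul_assoc, ← vert_mul_gap hw.2.2.2, ← mul_assoc (vert R E v), h.orth _ _ hvw,
            zero_mul, mul_zero]
          exact I.zero_mem
        · rw [← gap_mul_vert hv.2.2.2, mul_assoc (gap R E H v), h.orth _ _ hb, mul_zero, zero_mul]
          exact I.zero_mem
  have hIeq : I = pairIdeal R E H {v ∈ E.breakingSet H | gap R E H v ∈ I} := hI.eq_pairIdeal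
  by_cases hbr : ∃ v ∈ E.breakingSet H, gap R E H v ∉ I
  · obtain ⟨v, hv, hvI⟩ := hbr
    right
    -- Some w αβ^* v^H is not in I, hence β has length zero and α is a path from w to v.
    have hreach : ∀ w ∉ H, E.Reaches w v := by
      intro w hw
      obtain ⟨a, l, b, m, d, hl, hm, hmem⟩ := exists_path_notMem hprime hw hvI
      have hmnil : m = [] := by
        cases m with
        | nil => rfl
        | cons e m =>
          obtain ⟨rfl, hm⟩ := hm
          have h1 : ghostElt R E (E.s e) (e :: m) = ghostElt R E (E.r e) m * ghost R E e :=
            h.ghostOf_cons e m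
          refine absurd ?_ hmem
          rw [h1, ← mul_assoc (pathElt _ _ _ _), ← mul_assoc, mul_assoc]
          exact I.mul_mem_left _ _ (ghost_mul_gap_mem hv.2.2.2 e)
      subst hmnil
      cases hm
      have hwa : w = a := by
        by_contra hwa
        apply hmem
        have h1 : vert R E w * pathElt R E a l = 0 := h.p_mul_pathOf_ne hwa l
        rw [← mul_assoc, h1, zero_mul, zero_mul]
        exact I.zero_mem
      have hbv : b = v := by
        by_contra hbv
        apply hmem
        have h1 : ghostElt R E b [] * vert R E v = 0 := h.ghostOf_mul_p_ne hbv []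
        rw [← vert_mul_gap hv.2.2.2, mul_assoc, mul_assoc, ← mul_assoc (ghostElt R E b []), h1,
          zero_mul, mul_zero, mul_zero]
        exact I.zero_mem
      exact ⟨l, hwa ▸ hbv ▸ hl⟩
    have hHomega : H = E.omega {v} := by
      ext w
      rw [← not_iff_not, notMem_omega_singleton]
      exact ⟨hreach w, fun hr => hup w v hv.1 hr⟩
    have hS : {w ∈ E.breakingSet H | gap R E H w ∈ I} = E.breakingSet H \ {v} := by
      ext w
      constructor
      · rintro ⟨hw, hwI⟩
        exact ⟨hw, by rintro rfl; exact hvI hwI⟩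
      · rintro ⟨hw, hwv⟩
        exact ⟨hw, by_contra fun hwI => hwv (hone w hw v hv hwI hvI)⟩
    rw [hS, hHomega] at hIeq
    rw [hHomega] at hv
    exact ⟨v, ⟨hv.2.1, hv⟩, hIeq⟩
  · push Not at hbr
    left
    have hS : {v ∈ E.breakingSet H | gap R E H v ∈ I} = E.breakingSet H :=
      Set.sep_eq_self_iff_mem_true.2 hbr
    have hM : E.IsMaximalTail Hᶜ := by
      refine ⟨?_, hup, ?_, ?_⟩
      -- If I contained all vertices, local units would put all of L into I, and the simple action
      -- would be zero.
      · rw [Set.nonempty_compl]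
        intro hHuniv
        obtain ⟨⟨a, n, han⟩, -⟩ := hρ
        obtain ⟨F, hF⟩ := h.exists_left_unit (mem_pathSpan R E a)
        have haI : a ∈ I := by
          rw [← hF F subset_rfl]
          refine I.mul_mem_right _ _ (sum_mem fun v _ => ?_)
          have : v ∈ H := hHuniv ▸ trivial
          exact this
        rw [(hker a).2 haI] at han
        exact han rfl
      · intro v hv hne hfin
        by_contra! hcon
        refine hv (vertexSet_saturated v hfin hne fun e he => ?_)
        exact not_not.1 (hcon e he)
      · intro v hv w hw
        -- In v αβ^* w ∉ I the common range d of α and β is outside H and serves as the vertex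
        -- required by (MT3).
        obtain ⟨a, l, b, m, d, hl, hm, hmem⟩ := exists_path_notMem hprime hv hw
        have hva : v = a := by
          by_contra hva
          apply hmem
          have h1 : vert R E v * pathElt R E a l = 0 := h.p_mul_pathOf_ne hva l
          rw [← mul_assoc, h1, zero_mul, zero_mul]
          exact I.zero_mem
        have hbw : b = w := by
          by_contra hbw
          apply hmem
          have h1 : ghostElt R E b m * vert R E w = 0 := h.ghostOf_mul_p_ne hbw m
          rw [mul_assoc, mul_assoc, h1, mul_zero, mul_zero]
          exact I.zero_mem
        subst hva hbw
        refine ⟨d, fun hd => hmem ?_, ⟨l, hl⟩, ⟨m, hm⟩⟩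
        have h1 : pathElt R E v l * vert R E d = pathElt R E v l := h.pathOf_mul_p hl
        rw [← h1]
        exact I.mul_mem_right _ _ (I.mul_mem_left _ _ (I.mul_mem_right _ _ (I.mul_mem_left _ _ hd)))
    have homega : E.omega Hᶜ = H := by rw [omega_eq_compl hup, compl_compl]
    refine ⟨Hᶜ, ⟨hM, ?_⟩, by rw [homega, ← hS]; exact hIeq⟩
    intro e l hcl
    by_contra hexit
    have hmap : ∀ {a b : (Hᶜ : Set V)} {k : List {e : A // E.r e ∈ Hᶜ}},
        (E.tailSubgraph Hᶜ hM.mt1).IsPath a k b → E.IsPath a.1 (k.map Subtype.val) b.1 := by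
      intro a b k hk
      induction k generalizing a with
      | nil => exact congrArg Subtype.val hk
      | cons f k ih => exact ⟨congrArg Subtype.val hk.1, ih hk.2⟩
    have huniq : ∀ f ∈ (e :: l).map Subtype.val, ∀ g, E.s g = E.s f → g ∉ {g | E.r g ∈ H} →
        g = f := by
      intro f hf g hgs hgr
      obtain ⟨f', hf', rfl⟩ := List.mem_map.1 hf
      by_contra hne
      refine hexit ⟨f', hf', ⟨g, hgr⟩, Subtype.ext hgs, fun heq => hne (congrArg Subtype.val heq)⟩
    have hmem : ∀ f ∈ (e :: l).map Subtype.val, E.r f ∉ H := by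
      intro f hf
      obtain ⟨f', hf', rfl⟩ := List.mem_map.1 hf
      exact f'.2
    -- A closed path without exits in the subgraph of the tail is a cycle without exits for the
    -- quotient family.
    refine hI.not_isExitlessCycle hρ hker (v := E.s e.1) (c := (e :: l).map Subtype.val)
      ⟨hmap hcl.1, by simp, ?_, ?_, ?_⟩
    · rw [Function.comp, Ne, toQuot_eq_zero]
      exact hup _ _ (hmem e.1 (by simp)) (reaches_edge e.1)
    · intro f hf g hgs hgr
      refine huniq f hf g hgs fun hgH => hgr ((toQuot_eq_zero I).2 hgH)
    · intro f hf
      -- As f is the only edge from s(f) to the complement of H, the element v^H at v = s(f) is s(f)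
      -- − f f^*. It lies in I whether or not s(f) is in B_H, because S = B_H; this gives f f^* =
      -- s(f) in the quotient.
      have hset : {g | E.s g = E.s f ∧ E.r g ∉ H} = {f} := by
        ext g
        constructor
        · rintro ⟨hgs, hgr⟩
          exact huniq f hf g hgs hgr
        · rintro rfl
          exact ⟨rfl, hmem _ hf⟩
      have hfin : {g | E.s g = E.s f ∧ E.r g ∉ H}.Finite := by
        rw [hset]; exact Set.finite_singleton f
      have hgap : gap R E H (E.s f) = vert R E (E.s f) - edge R E f * ghost R E f := by
        rw [gap, hset, finsum_mem_singleton]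
      have hgapI : gap R E H (E.s f) ∈ I := by
        by_contra hgapI
        rw [hIeq, hS] at hgapI
        rcases (mem_breakingSet_of_gap_notMem (fun e he => vertexSet_hereditary e he) hfin
          hgapI).2 with ⟨h0, -⟩ | h0
        · rw [hset] at h0
          exact Set.singleton_ne_empty f h0
        · exact h0.2 h0.1
      rw [hgap, ← toQuot_eq_zero, map_sub, map_mul, sub_eq_zero] at hgapI
      exact hgapI.symm

end GradedPrimitive

end LPA

theorem proposition6p9 {V A : Type*} [Countable V] [Countable A] (E : LPA.DirectedGraph V A)
    (R : Type*) [Field R] :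
    {I : TwoSidedIdeal (LPA.LeavittAlgebra R E) |
        LPA.IsGradedIdeal R E I ∧ LPA.IsLeftPrimitiveIdeal I} = LPA.listedIdeals R E ∧
    {I : TwoSidedIdeal (LPA.LeavittAlgebra R E) |
        LPA.IsGradedIdeal R E I ∧ LPA.IsRightPrimitiveIdeal I} = LPA.listedIdeals R E := by
  have hleft : ∀ I ∈ LPA.listedIdeals R E,
      LPA.IsGradedIdeal R E I ∧ LPA.IsLeftPrimitiveIdeal I := by
    rintro I (⟨M, hM, rfl⟩ | ⟨v, hv, rfl⟩)
    · exact ⟨LPA.isGradedIdeal_pairIdeal _ _, LPA.isLeftPrimitiveIdeal_maximalTail hM⟩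
    · exact ⟨LPA.isGradedIdeal_pairIdeal _ _, LPA.isLeftPrimitiveIdeal_breakingVertex hv⟩
  constructor
  · ext I
    exact ⟨fun hI => hI.1.mem_listedIdeals hI.2, hleft I⟩
  · ext I
    constructor
    · rintro ⟨hgr, hprim⟩
      -- The image I^* is graded and left primitive, hence listed. Listed ideals are fixed by the
      -- involution, so I = I^*.
      have h1 := hgr.starIdeal.mem_listedIdeals ((LPA.isRightPrimitiveIdeal_iff I).1 hprim)
      have h2 := LPA.starIdeal_of_mem_listedIdeals h1
      rw [LPA.starIdeal_starIdeal] at h2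
      rwa [← h2] at h1
    · intro hI
      refine ⟨(hleft I hI).1, (LPA.isRightPrimitiveIdeal_iff I).2 ?_⟩
      rw [LPA.starIdeal_of_mem_listedIdeals hI]
      exact (hleft I hI).2
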